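/- **Setting.** Let $n\ge 2$, $k\ge 0$, and let $\Omega\subset\mathbb R^n$ be a (connected, open) polyhedral domain with a conforming simplicial mesh $\mathcal T_h$. Let $\alpha:\Omega\to\mathbb R^{n\times n}$ be measurable, symmetric and positive definite at every point, with $\|\alpha(x)\|\le\Gamma$ and $\|c(x)\|\le\Gamma$ on $\Omega$, where $c=\alpha^{-1}$. Let $\tau\ge 0$ be a penalty function on the element boundaries whose branch from each element $K$ is constant on each face of $K$ and positive on at least one face of $K$. Let $\vec n$ be the outward unit normal on $\partial K$, $h_K=\operatorname{diam}K$, $h=\max_K h_K$. Write $(\cdot,\cdot)_{\Omega_h}=\sum_K(\cdot,\cdot)_{L^2(K)}$ and $\langle\cdot,\cdot\rangle_{\partial\Omega_h}=\sum_K\langle\cdot,\cdot\rangle_{L^2(\partial K)}$. Put $$W_h=\{w: w|_K\in P_k(K)\ \forall K\},\quad V_h=\{v: v|_K\in P_k(K)^n\ \forall K\},$$ $$M_h=\{\mu:\ \mu|_F\in P_k(F)\text{ for every mesh face }F,\ \mu|_F=0\text{ if }F\subseteq\partial\Omega\}.$$ The local solution operators $Q:M_h\to V_h$, $U:M_h\to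 W_h$, $Q_w:L^2(\Omega)\to V_h$, $U_w:L^2(\Omega)\to W_h$ are defined on every element $K$ by $$(c\,Q\mu,r)_K-(U\mu,\nabla\!\cdot r)_K=-\langle\mu,r\cdot\vec n\rangle_{\partial K},\qquad (w,\nabla\!\cdot Q\mu)_K+\langle\tau(U\mu-\mu),w\rangle_{\partial K}=0,$$ $$(c\,Q_wf,r)_K-(U_wf,\nabla\!\cdot r)_K=0,\qquad (w,\nabla\!\cdot Q_wf)_K+\langle\tau U_wf,w\rangle_{\partial K}=(f,w)_K,$$ for all $r\in P_k(K)^n$, $w\in P_k(K)$. Put $a_h(\eta,\mu)=(c\,Q\eta,Q\mu)_{\Omega_h}+\langle\tau(U\eta-\eta),U\mu-\mu\rangle_{\partial\Omega_h}$. A number $\lambda$ and a triple $(q,u,\eta)\in V_h\times W_h\times M_h$, not all zero, *solve the HDG eigenproblem* if, with $\hat q=q+\tau(u-\eta)\vec n$, $$(c\,q,r)_{\Omega_h}-(u,\nabla\!\cdot r)_{\Omega_h}+\langle\eta,r\cdot\vec n\rangle_{\partial\Omega_h}=0\quad\forall r\in V_h,$$ $$-(q,\nabla w)_{\Omega_h}+\langle\hat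 q\cdot\vec n,w\rangle_{\partial\Omega_h}=\lambda\,(u,w)_{\Omega_h}\quad\forall w\in W_h,$$ $$\langle\mu,\hat q\cdot\vec n\rangle_{\partial\Omega_h}=0\quad\forall\mu\in M_h.$$ Let $\tau_K^{\max}=\max\tau|_{\partial K}$, let $\tau_K^*$ be the maximum of $\tau$ over $\partial K$ minus a face where $\tau|_{\partial K}$ is maximal, and let $d_K=1+(\tau_K^{\max}h_K)^{-1/2}$, $c_K=1+(\tau_K^*h_K)^{1/2}$. **Theorem.** There is a constant $C_0>0$, depending only on $n$, $k$, $\Gamma$, such that in every such setting the two local problems are uniquely solvable, $$\|U_wf\|_{L^2(K)}\le C_0\,d_K^2\,h_K^2\,\|f\|_{L^2(K)}\qquad\text{for all }K\text{ and all }f\in L^2(\Omega),$$ and the following holds. Let $C_*>0$ satisfy $d_K^2h_K\le C_*$ and $c_K\le C_*$ for all $K$, let $0<C_3<(C_0C_*)^{-1}$, and let $0<\lambda_h<C_3/h$. Then: 1. $I-\lambda_hU_w$ is invertible as a bounded operator on $L^2(\Omega)$. 2. For every $\eta_h\in M_h$, the function $u_h=(I-\lambda_hU_w)^{-1}U\eta_h$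 belongs to $W_h$; and $\eta_h\neq0$ satisfies $$a_h(\eta_h,\mu)=\lambda_h\big((I-\lambda_hU_w)^{-1}U\eta_h,\,U\mu\big)_{\Omega_h}\qquad\forall\mu\in M_h\tag{$*$}$$ if and only if $\lambda_h$ and $(q_h,u_h,\eta_h)$, with $q_h=Q\eta_h+\lambda_hQ_wu_h$, solve the HDG eigenproblem. 3. Consequently $\lambda_h$ is an eigenvalue of the HDG eigenproblem if and only if $(*)$ holds for some nonzero $\eta_h\in M_h$; that is, condensation loses no eigenvalues in $(0,C_3/h)$. -/

import Mathlib

open MeasureTheory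

namespace HDG

noncomputable section

/-! ### Polynomials -/

/-- `P_k`: real polynomials in `n` variables of total degree at most `k`. -/
abbrev Pk (n k : ℕ) : Submodule ℝ (MvPolynomial (Fin n) ℝ) :=
  MvPolynomial.restrictTotalDegree (Fin n) ℝ k

/-- Value of a polynomial at a point. -/
def ev {n : ℕ} (p : MvPolynomial (Fin n) ℝ) (x : EuclideanSpace ℝ (Fin n)) : ℝ :=
  MvPolynomial.eval (fun i => x i) p

/-- Value of a vector of polynomials at a point. -/
def evv {n k : ℕ} (q : Fin n → Pk n k) (x : EuclideanSpace ℝ (Fin n)) : Fin n → ℝ :=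
  fun i => ev (q i : MvPolynomial (Fin n) ℝ) x

/-- Divergence of a polynomial vector field, at a point. -/
def dv {n k : ℕ} (q : Fin n → Pk n k) (x : EuclideanSpace ℝ (Fin n)) : ℝ :=
  ∑ i, ev (MvPolynomial.pderiv i (q i : MvPolynomial (Fin n) ℝ)) x

/-- Gradient of a polynomial, at a point. -/
def gd {n k : ℕ} (w : Pk n k) (x : EuclideanSpace ℝ (Fin n)) : Fin n → ℝ :=
  fun i => ev (MvPolynomial.pderiv i (w : MvPolynomial (Fin n) ℝ)) x

lemma ev_add {n : ℕ} (p q : MvPolynomial (Fin n) ℝ) (x : EuclideanSpace ℝ (Fin n)) :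
    ev (p + q) x = ev p x + ev q x := by simp [ev]

lemma ev_smul {n : ℕ} (a : ℝ) (p : MvPolynomial (Fin n) ℝ) (x : EuclideanSpace ℝ (Fin n)) :
    ev (a • p) x = a * ev p x := by simp [ev]

lemma evv_add {n k : ℕ} (p q : Fin n → Pk n k) (x : EuclideanSpace ℝ (Fin n)) :
    evv (p + q) x = evv p x + evv q x := by funext i; simp [evv, ev_add]

lemma evv_smul {n k : ℕ} (a : ℝ) (p : Fin n → Pk n k) (x : EuclideanSpace ℝ (Fin n)) :
    evv (a • p) x = a • evv p x := by funext i; simp [evv, ev_smul]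

lemma dv_add {n k : ℕ} (p q : Fin n → Pk n k) (x : EuclideanSpace ℝ (Fin n)) :
    dv (p + q) x = dv p x + dv q x := by simp [dv, ev_add, Finset.sum_add_distrib]

lemma dv_smul {n k : ℕ} (a : ℝ) (p : Fin n → Pk n k) (x : EuclideanSpace ℝ (Fin n)) :
    dv (a • p) x = a * dv p x := by simp [dv, ev_smul, Finset.mul_sum]

/-! ### Meshes, coefficients and penalty functions -/

/-- A conforming simplicial mesh of the open set `Ω`: a finite, pure `n`-dimensional simplicial
complex that triangulates `closure Ω`. The last two fields say that `∂Ω` is a union of mesh faces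
(`Ω` need not be the interior of its closure). -/
structure Mesh {n : ℕ} (Ω : Set (EuclideanSpace ℝ (Fin n))) where
  complex : Geometry.SimplicialComplex ℝ (EuclideanSpace ℝ (Fin n))
  finite : complex.faces.Finite
  pure : ∀ s ∈ complex.faces, ∃ t ∈ complex.faces, s ⊆ t ∧ t.card = n + 1
  space_eq : complex.space = closure Ω
  interior_subset : ∀ s ∈ complex.faces, s.card = n + 1 →
    interior (convexHull ℝ (s : Set (EuclideanSpace ℝ (Fin n)))) ⊆ Ω
  face_boundary_or_interior : ∀ s ∈ complex.faces, s.card = n →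
    convexHull ℝ (s : Set (EuclideanSpace ℝ (Fin n))) ⊆ frontier Ω ∨
      intrinsicInterior ℝ (convexHull ℝ (s : Set (EuclideanSpace ℝ (Fin n)))) ⊆ Ω

/-- The coefficient `α` on `Ω`: measurable, symmetric positive definite at all points of `Ω`,
with the (Euclidean operator) norms of `α` and of `α⁻¹` bounded by `Γ`. -/
structure Coeff {n : ℕ} (Ω : Set (EuclideanSpace ℝ (Fin n))) (Γ : ℝ) where
  toFun : EuclideanSpace ℝ (Fin n) → Matrix (Fin n) (Fin n) ℝ
  aemeasurable : ∀ i j, AEMeasurable (fun x => toFun x i j) (volume.restrict Ω)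
  posDef : ∀ x ∈ Ω, (toFun x).PosDef
  norm_le : ∀ x ∈ Ω, ‖Matrix.toEuclideanCLM (𝕜 := ℝ) (toFun x)‖ ≤ Γ
  norm_inv_le : ∀ x ∈ Ω, ‖Matrix.toEuclideanCLM (𝕜 := ℝ) (toFun x)⁻¹‖ ≤ Γ

/-- `c = α⁻¹`. -/
def Coeff.c {n : ℕ} {Ω : Set (EuclideanSpace ℝ (Fin n))} {Γ : ℝ} (α : Coeff Ω Γ)
    (x : EuclideanSpace ℝ (Fin n)) : Matrix (Fin n) (Fin n) ℝ := (α.toFun x)⁻¹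

section MeshDefs

variable {n : ℕ} {Ω : Set (EuclideanSpace ℝ (Fin n))}

/-- Mesh elements: the `n`-simplices (given by their vertices). -/
def Mesh.Elem (T : Mesh Ω) : Type := {s : Finset (EuclideanSpace ℝ (Fin n)) //
  s ∈ T.complex.faces ∧ s.card = n + 1}

/-- Mesh faces: the `(n-1)`-simplices (given by their vertices). -/
def Mesh.Face (T : Mesh Ω) : Type := {s : Finset (EuclideanSpace ℝ (Fin n)) //
  s ∈ T.complex.faces ∧ s.card = n}

instance (T : Mesh Ω) : Fintype T.Elem :=
  (T.finite.subset (fun _ h => h.1) : {s : Finset (EuclideanSpace ℝ (Fin n)) |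
    s ∈ T.complex.faces ∧ s.card = n + 1}.Finite).fintype

instance (T : Mesh Ω) : Fintype T.Face :=
  (T.finite.subset (fun _ h => h.1) : {s : Finset (EuclideanSpace ℝ (Fin n)) |
    s ∈ T.complex.faces ∧ s.card = n}.Finite).fintype

/-- The closed simplex of a mesh element. -/
def Mesh.Elem.set {T : Mesh Ω} (K : T.Elem) : Set (EuclideanSpace ℝ (Fin n)) :=
  convexHull ℝ (K.1 : Set (EuclideanSpace ℝ (Fin n)))

/-- The closed simplex of a mesh face. -/
def Mesh.Face.set {T : Mesh Ω} (F : T.Face) : Set (EuclideanSpace ℝ (Fin n)) :=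
  convexHull ℝ (F.1 : Set (EuclideanSpace ℝ (Fin n)))

open Classical in
/-- The `n + 1` faces that make up `∂K`. -/
def Mesh.Elem.faces {T : Mesh Ω} (K : T.Elem) : Finset T.Face :=
  Finset.univ.filter fun F => F.1 ⊆ K.1

/-- The unit normal of the face `F` of `K` pointing out of `K`: the normalized component,
orthogonal to `F`, of the vector from the barycentre of `K` to that of `F`. -/
def Mesh.Elem.normal {T : Mesh Ω} (K : T.Elem) (F : T.Face) : EuclideanSpace ℝ (Fin n) :=
  NormedSpace.normalize
    ((vectorSpan ℝ (F.1 : Set (EuclideanSpace ℝ (Fin n))))ᗮ.starProjection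
      (F.1.centroid ℝ id - K.1.centroid ℝ id))

/-- Mesh element size `h_K = diam K`. -/
def Mesh.Elem.size {T : Mesh Ω} (K : T.Elem) : ℝ := Metric.diam K.set

/-- Mesh size `h = max_K h_K`. -/
def Mesh.size (T : Mesh Ω) : ℝ := ⨆ K : T.Elem, K.size

/-- A penalty function `τ ≥ 0`, whose branch from `K` is constant on each face of `K`
(`τ K F` is that constant) and positive on at least one face of `K`. Only the values `τ K F`
with `F ⊆ ∂K` are ever used. -/
structure Penalty (T : Mesh Ω) where
  toFun : T.Elem → T.Face → ℝ
  nonneg : ∀ K, ∀ F ∈ K.faces, 0 ≤ toFun K F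
  exists_pos : ∀ K, ∃ F ∈ K.faces, 0 < toFun K F

/-- `τ_K^max = max τ|_{∂K}`. -/
def Penalty.tmax {T : Mesh Ω} (τ : Penalty T) (K : T.Elem) : ℝ :=
  sSup (τ.toFun K '' (K.faces : Set T.Face))

/-- `τ_K^* = max τ|_{∂K ∖ F_max}`, where `F_max` is a face of `K` on which `τ|_{∂K}` is maximal.
Among the numbers `max τ|_{∂K ∖ F}`, the one with `F = F_max` is the smallest, so this is the
minimum over the removed face. -/
def Penalty.tstar {T : Mesh Ω} (τ : Penalty T) (K : T.Elem) : ℝ :=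
  ⨅ F : K.faces, sSup (τ.toFun K '' ((K.faces : Set T.Face) \ {F.1}))

/-- `d_{hτ}^K = 1 + (τ_K^max h_K)^{-1/2}`. -/
def Penalty.d {T : Mesh Ω} (τ : Penalty T) (K : T.Elem) : ℝ :=
  1 + (Real.sqrt (τ.tmax K * K.size))⁻¹

/-- `c_{hτ}^K = 1 + (τ_K^* h_K)^{1/2}`. -/
def Penalty.cc {T : Mesh Ω} (τ : Penalty T) (K : T.Elem) : ℝ :=
  1 + Real.sqrt (τ.tstar K * K.size)

/-! ### Discrete spaces -/

/-- `W_h`: one polynomial of degree at most `k` for every mesh element. -/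
abbrev Mesh.W (T : Mesh Ω) (k : ℕ) : Type := T.Elem → Pk n k

/-- `V_h`: `n` polynomials of degree at most `k` for every mesh element. -/
abbrev Mesh.V (T : Mesh Ω) (k : ℕ) : Type := T.Elem → Fin n → Pk n k

/-- `M_h`: functions on the mesh faces (extended by zero off each face) which are polynomials of
degree at most `k` on every face, and vanish on the faces contained in `∂Ω`. -/
def Mesh.M (T : Mesh Ω) (k : ℕ) : Submodule ℝ (T.Face → EuclideanSpace ℝ (Fin n) → ℝ) where
  carrier := {μ | ∀ F : T.Face,
    (∃ p ∈ Pk n k, ∀ x ∈ F.set, μ F x = ev p x) ∧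
    (∀ x ∉ F.set, μ F x = 0) ∧
    (F.set ⊆ frontier Ω → ∀ x ∈ F.set, μ F x = 0)}
  zero_mem' := fun F => ⟨⟨0, Submodule.zero_mem _, by simp [ev]⟩, by simp, by simp⟩
  add_mem' := by
    intro a b ha hb F
    obtain ⟨⟨p, hp, hpa⟩, ha2, ha3⟩ := ha F
    obtain ⟨⟨q, hq, hqb⟩, hb2, hb3⟩ := hb F
    refine ⟨⟨p + q, Submodule.add_mem _ hp hq, fun x hx => ?_⟩, fun x hx => ?_, fun h x hx => ?_⟩
    · simp [ev, hpa x hx, hqb x hx]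
    · simp [ha2 x hx, hb2 x hx]
    · simp [ha3 h x hx, hb3 h x hx]
  smul_mem' := by
    intro t a ha F
    obtain ⟨⟨p, hp, hpa⟩, ha2, ha3⟩ := ha F
    refine ⟨⟨t • p, Submodule.smul_mem _ t hp, fun x hx => ?_⟩, fun x hx => ?_, fun h x hx => ?_⟩
    · simp [ev, hpa x hx]
    · simp [ha2 x hx]
    · simp [ha3 h x hx]

/-! ### Integrability facts -/

lemma continuous_ev (p : MvPolynomial (Fin n) ℝ) : Continuous (ev p) := by
  unfold ev
  exact (MvPolynomial.continuous_eval p).comp (by fun_prop)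

lemma continuous_evv {k : ℕ} (q : Fin n → Pk n k) : Continuous (evv q) :=
  continuous_pi fun _ => continuous_ev _

lemma continuous_dv {k : ℕ} (q : Fin n → Pk n k) : Continuous (dv q) :=
  continuous_finsetSum _ fun _ _ => continuous_ev _

lemma isCompact_elem {T : Mesh Ω} (K : T.Elem) : IsCompact K.set :=
  K.1.finite_toSet.isCompact_convexHull ℝ

lemma isCompact_face {T : Mesh Ω} (F : T.Face) : IsCompact F.set :=
  F.1.finite_toSet.isCompact_convexHull ℝ

lemma measure_face_lt_top {T : Mesh Ω} (F : T.Face) : μHE[n - 1] F.set < ⊤ := by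
  obtain ⟨x₀, hx₀⟩ := T.complex.nonempty_of_mem_faces F.2.1
  set V := vectorSpan ℝ (F.1 : Set (EuclideanSpace ℝ (Fin n))) with hV
  have hn : F.1.card = (n - 1) + 1 := by
    have := Finset.card_pos.2 ⟨x₀, hx₀⟩
    have := F.2.2
    omega
  have hrank : Module.finrank ℝ V = n - 1 := by
    have h := (T.complex.indep F.2.1).finrank_vectorSpan (n := n - 1) (by simpa using hn)
    have hr : Set.range (Subtype.val : F.1 → EuclideanSpace ℝ (Fin n)) =
      (F.1 : Set (EuclideanSpace ℝ (Fin n))) := Subtype.range_coe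
    rw [hr] at h
    exact h
  let f : V → EuclideanSpace ℝ (Fin n) := fun v => v.1 + x₀
  have hf : Isometry f := by
    refine Isometry.of_dist_eq fun a b => ?_
    simp [f, Subtype.dist_eq]
  have hrange : F.set ⊆ Set.range f := by
    intro x hx
    have hxa : x ∈ affineSpan ℝ (F.1 : Set (EuclideanSpace ℝ (Fin n))) :=
      convexHull_subset_affineSpan _ hx
    have hx0a : x₀ ∈ affineSpan ℝ (F.1 : Set (EuclideanSpace ℝ (Fin n))) :=
      subset_affineSpan ℝ _ hx₀
    have h := AffineSubspace.vsub_mem_direction hxa hx0a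
    rw [direction_affineSpan] at h
    exact ⟨⟨x - x₀, h⟩, by simp [f]⟩
  have hcpt : IsCompact (f ⁻¹' F.set) := hf.isClosedEmbedding.isCompact_preimage (isCompact_face F)
  rw [← Set.image_preimage_eq_of_subset hrange, hf.euclideanHausdorffMeasure_image, ← hrank]
  exact hcpt.measure_lt_top

lemma integrableOn_elem {T : Mesh Ω} (K : T.Elem) {g : EuclideanSpace ℝ (Fin n) → ℝ}
    (hg : Continuous g) : IntegrableOn g K.set :=
  hg.continuousOn.integrableOn_compact (isCompact_elem K)

lemma integrableOn_face {T : Mesh Ω} (F : T.Face) {g : EuclideanSpace ℝ (Fin n) → ℝ}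
    (hg : Continuous g) : IntegrableOn g F.set μHE[n - 1] := by
  obtain ⟨C, hC⟩ := (isCompact_face F).exists_bound_of_continuousOn hg.continuousOn
  exact Measure.integrableOn_of_bounded (measure_face_lt_top F).ne hg.aestronglyMeasurable
    (by
      filter_upwards [ae_restrict_mem (isCompact_face F).measurableSet] with x hx using hC x hx)

lemma elem_ae_mem {T : Mesh Ω} (K : T.Elem) : ∀ᵐ x ∂(volume.restrict K.set), x ∈ Ω := by
  have h1 : volume (frontier K.set) = 0 := (convex_convexHull ℝ _).addHaar_frontier volume
  have h2 : (interior K.set : Set _) =ᵐ[volume] K.set := interior_ae_eq_of_null_frontier h1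
  rw [← Measure.restrict_congr_set h2]
  filter_upwards [ae_restrict_mem isOpen_interior.measurableSet] with x hx
  exact T.interior_subset _ K.2.1 K.2.2 hx

lemma elem_ae_le {T : Mesh Ω} (K : T.Elem) : volume.restrict K.set ≤ volume.restrict Ω := by
  have h1 : volume (frontier K.set) = 0 := (convex_convexHull ℝ _).addHaar_frontier volume
  have h2 : (interior K.set : Set _) =ᵐ[volume] K.set := interior_ae_eq_of_null_frontier h1
  rw [← Measure.restrict_congr_set h2]
  exact Measure.restrict_mono (T.interior_subset _ K.2.1 K.2.2) le_rfl

lemma measurable_inv_entry (i j : Fin n) :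
    Measurable fun m : Fin n × Fin n → ℝ => (Matrix.of fun a b => m (a, b))⁻¹ i j := by
  have hcont : Continuous fun m : Fin n × Fin n → ℝ => (Matrix.of fun a b => m (a, b)) :=
    continuous_matrix fun a b => continuous_apply _
  have h : (fun m : Fin n × Fin n → ℝ => (Matrix.of fun a b => m (a, b))⁻¹ i j) =
      fun m => (Matrix.of fun a b => m (a, b)).det⁻¹ *
        (Matrix.of fun a b => m (a, b)).adjugate i j := by
    funext m
    rw [Matrix.inv_def, Matrix.smul_apply, smul_eq_mul, Ring.inverse_eq_inv']
  rw [h]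
  exact hcont.matrix_det.measurable.inv.mul (hcont.matrix_adjugate.matrix_elem i j).measurable

lemma Coeff.integrableOn {T : Mesh Ω} {Γ : ℝ} (α : Coeff Ω Γ) (K : T.Elem) {k : ℕ}
    (q r : Fin n → Pk n k) :
    IntegrableOn (fun x => (α.c x).mulVec (evv q x) ⬝ᵥ evv r x) K.set := by
  have hm : ∀ i j, AEStronglyMeasurable (fun x => α.c x i j) (volume.restrict K.set) := by
    intro i j
    refine AEMeasurable.aestronglyMeasurable ?_
    refine AEMeasurable.mono_measure ?_ (elem_ae_le K)
    have hA : AEMeasurable (fun x => fun p : Fin n × Fin n => α.toFun x p.1 p.2)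
        (volume.restrict Ω) :=
      aemeasurable_pi_lambda _ fun p => α.aemeasurable p.1 p.2
    have e : (fun x => α.c x i j) = (fun m : Fin n × Fin n → ℝ =>
        (Matrix.of fun a b => m (a, b))⁻¹ i j) ∘ fun x p => α.toFun x p.1 p.2 := by
      funext x
      have : (Matrix.of fun a b => α.toFun x a b) = α.toFun x := rfl
      simp only [Function.comp_apply, this, Coeff.c]
    rw [e]
    exact (measurable_inv_entry i j).comp_aemeasurable hA
  have hb : ∀ i j, ∀ᵐ x ∂(volume.restrict K.set), ‖α.c x i j‖ ≤ Γ := by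
    intro i j
    filter_upwards [elem_ae_mem K] with x hx
    refine le_trans ?_ (α.norm_inv_le x hx)
    have h := (Matrix.toEuclideanCLM (𝕜 := ℝ) (α.toFun x)⁻¹).le_opNorm (EuclideanSpace.single j 1)
    refine le_trans ?_ (h.trans_eq (by simp))
    refine le_trans (le_of_eq ?_) (PiLp.norm_apply_le _ i)
    simp [Coeff.c]
  have : (fun x => (α.c x).mulVec (evv q x) ⬝ᵥ evv r x) =
      fun x => ∑ i, ∑ j, α.c x i j * (evv q x j * evv r x i) := by
    funext x
    simp [dotProduct, Matrix.mulVec, Finset.sum_mul, mul_assoc]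
  rw [this]
  refine integrable_finsetSum _ fun i _ => integrable_finsetSum _ fun j _ => ?_
  refine Integrable.bdd_mul (c := Γ) ?_ (hm i j) (hb i j)
  exact integrableOn_elem K (((continuous_apply j).comp (continuous_evv q)).mul
    ((continuous_apply i).comp (continuous_evv r)))

lemma integrableOn_trace {T : Mesh Ω} {k : ℕ} (μ : T.M k) (F : T.Face)
    {g : EuclideanSpace ℝ (Fin n) → ℝ} (hg : Continuous g) :
    IntegrableOn (fun x => μ.1 F x * g x) F.set μHE[n - 1] := by
  obtain ⟨⟨p, -, hp⟩, -⟩ := μ.2 F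
  refine (integrableOn_face F ((continuous_ev p).mul hg)).congr_fun ?_
    (isCompact_face F).measurableSet
  intro x hx
  simp [hp x hx]

lemma integrableOn_L2 {T : Mesh Ω} (K : T.Elem) (f : Lp ℝ 2 (volume.restrict Ω))
    {g : EuclideanSpace ℝ (Fin n) → ℝ} (hg : Continuous g) :
    IntegrableOn (fun x => f x * g x) K.set := by
  have hf : MemLp f 2 (volume.restrict K.set) := (Lp.memLp f).mono_measure (elem_ae_le K)
  have : IsFiniteMeasure (volume.restrict K.set) := ⟨by
    simpa using (isCompact_elem K).measure_lt_top⟩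
  obtain ⟨C, hC⟩ := (isCompact_elem K).exists_bound_of_continuousOn hg.continuousOn
  refine Integrable.mul_bdd (c := C) (hf.integrable (by norm_num)) hg.aestronglyMeasurable ?_
  filter_upwards [ae_restrict_mem (isCompact_elem K).measurableSet] with x hx using hC x hx

lemma intVD {T : Mesh Ω} (K : T.Elem) {k : ℕ} (p : MvPolynomial (Fin n) ℝ) (r : Fin n → Pk n k) :
    IntegrableOn (fun x => ev p x * dv r x) K.set :=
  integrableOn_elem K ((continuous_ev p).mul (continuous_dv r))

lemma intFF {T : Mesh Ω} (F : T.Face) (a : ℝ) (p q : MvPolynomial (Fin n) ℝ) :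
    IntegrableOn (fun x => a * (ev p x * ev q x)) F.set μHE[n - 1] :=
  integrableOn_face F (continuous_const.mul ((continuous_ev p).mul (continuous_ev q)))

lemma intMW {T : Mesh Ω} {k : ℕ} (F : T.Face) (a : ℝ) (μ : T.M k) (q : MvPolynomial (Fin n) ℝ) :
    IntegrableOn (fun x => a * (μ.1 F x * ev q x)) F.set μHE[n - 1] :=
  (integrableOn_trace μ F (continuous_ev q)).const_mul a

lemma intMN {T : Mesh Ω} {k : ℕ} (F : T.Face) (μ : T.M k) (r : Fin n → Pk n k) (v : Fin n → ℝ) :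
    IntegrableOn (fun x => μ.1 F x * (evv r x ⬝ᵥ v)) F.set μHE[n - 1] :=
  integrableOn_trace μ F (continuous_finsetSum _ fun i _ =>
    ((continuous_apply i).comp (continuous_evv r)).mul continuous_const)

/-! ### Local solution operators -/

/-- The local space `P_k(K)^n × P_k(K)`. -/
abbrev LocalSpace (n k : ℕ) : Type := (Fin n → Pk n k) × Pk n k

/-- The sum of the left-hand sides of the two equations of the local problem on `K`, for the
unknown `s = (q, u)` and the test function `t = (r, w)`:
`(c q, r)_K - (u, div r)_K + (w, div q)_K + ⟨τ u, w⟩_{∂K}`. -/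
def localForm {Γ : ℝ} (k : ℕ) (T : Mesh Ω) (α : Coeff Ω Γ) (τ : Penalty T) (K : T.Elem) :
    LocalSpace n k →ₗ[ℝ] LocalSpace n k →ₗ[ℝ] ℝ :=
  LinearMap.mk₂ ℝ (fun s t =>
      (∫ x in K.set, (α.c x).mulVec (evv s.1 x) ⬝ᵥ evv t.1 x)
      - (∫ x in K.set, ev s.2.1 x * dv t.1 x)
      + (∫ x in K.set, ev t.2.1 x * dv s.1 x)
      + ∑ F ∈ K.faces, ∫ x in F.set, τ.toFun K F * (ev s.2.1 x * ev t.2.1 x) ∂μHE[n - 1])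
    (fun s s' t => by
      simp only [Prod.fst_add, Prod.snd_add, Submodule.coe_add, ev_add, evv_add, dv_add,
        Matrix.mulVec_add, add_dotProduct, add_mul, mul_add]
      rw [integral_add (α.integrableOn K _ _) (α.integrableOn K _ _),
        integral_add (intVD K _ _) (intVD K _ _), integral_add (intVD K _ _) (intVD K _ _)]
      simp only [integral_add (intFF _ _ _ _) (intFF _ _ _ _), Finset.sum_add_distrib]
      ring)
    (fun a s t => by
      simp only [Prod.smul_fst, Prod.smul_snd, Submodule.coe_smul, ev_smul, evv_smul, dv_smul,
        Matrix.mulVec_smul, smul_dotProduct, smul_eq_mul, mul_assoc, mul_left_comm _ a,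
        integral_const_mul, ← Finset.mul_sum]
      ring)
    (fun s t t' => by
      simp only [Prod.fst_add, Prod.snd_add, Submodule.coe_add, ev_add, evv_add, dv_add,
        dotProduct_add, add_mul, mul_add]
      rw [integral_add (α.integrableOn K _ _) (α.integrableOn K _ _),
        integral_add (intVD K _ _) (intVD K _ _), integral_add (intVD K _ _) (intVD K _ _)]
      simp only [integral_add (intFF _ _ _ _) (intFF _ _ _ _), Finset.sum_add_distrib]
      ring)
    (fun a s t => by
      simp only [Prod.smul_fst, Prod.smul_snd, Submodule.coe_smul, ev_smul, evv_smul, dv_smul,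
        dotProduct_smul, smul_eq_mul, mul_assoc, mul_left_comm _ a,
        integral_const_mul, ← Finset.mul_sum]
      ring)

/-- `(r, w) ↦ -⟨μ, r·n⟩_{∂K} + ⟨τ μ, w⟩_{∂K}`. -/
def traceLoad (k : ℕ) (T : Mesh Ω) (τ : Penalty T) (K : T.Elem) :
    T.M k →ₗ[ℝ] LocalSpace n k →ₗ[ℝ] ℝ :=
  LinearMap.mk₂ ℝ (fun μ t =>
      - (∑ F ∈ K.faces, ∫ x in F.set, μ.1 F x * (evv t.1 x ⬝ᵥ K.normal F) ∂μHE[n - 1])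
      + ∑ F ∈ K.faces, ∫ x in F.set, τ.toFun K F * (μ.1 F x * ev t.2.1 x) ∂μHE[n - 1])
    (fun s s' t => by
      simp only [Submodule.coe_add, Pi.add_apply, add_mul, mul_add]
      simp only [integral_add (intMN _ _ _ _) (intMN _ _ _ _),
        integral_add (intMW _ _ _ _) (intMW _ _ _ _), Finset.sum_add_distrib]
      ring)
    (fun a s t => by
      simp only [Submodule.coe_smul, Pi.smul_apply, smul_eq_mul, mul_assoc, mul_left_comm _ a,
        integral_const_mul, ← Finset.mul_sum]
      ring)
    (fun s t t' => by
      simp only [Prod.fst_add, Prod.snd_add, Submodule.coe_add, ev_add, evv_add,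
        add_dotProduct, mul_add]
      simp only [integral_add (intMN _ _ _ _) (intMN _ _ _ _),
        integral_add (intMW _ _ _ _) (intMW _ _ _ _), Finset.sum_add_distrib]
      ring)
    (fun a s t => by
      simp only [Prod.smul_fst, Prod.smul_snd, Submodule.coe_smul, ev_smul, evv_smul,
        smul_dotProduct, smul_eq_mul, mul_left_comm _ a,
        integral_const_mul, ← Finset.mul_sum]
      ring)

/-- `(r, w) ↦ (f, w)_K`. -/
def sourceLoad (k : ℕ) (T : Mesh Ω) (K : T.Elem) :
    Lp ℝ 2 (volume.restrict Ω) →ₗ[ℝ] LocalSpace n k →ₗ[ℝ] ℝ :=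
  LinearMap.mk₂ ℝ (fun f t => ∫ x in K.set, f x * ev t.2.1 x)
    (fun f g t => by
      rw [← integral_add (integrableOn_L2 K f (continuous_ev _))
        (integrableOn_L2 K g (continuous_ev _))]
      refine integral_congr_ae ?_
      filter_upwards [ae_mono (elem_ae_le K) (Lp.coeFn_add f g)] with x hx
      rw [hx, Pi.add_apply, add_mul])
    (fun a f t => by
      rw [smul_eq_mul, ← integral_const_mul]
      refine integral_congr_ae ?_
      filter_upwards [ae_mono (elem_ae_le K) (Lp.coeFn_smul a f)] with x hx
      rw [hx, Pi.smul_apply, smul_eq_mul, mul_assoc])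
    (fun f t t' => by
      simp only [Prod.snd_add, Submodule.coe_add, ev_add, mul_add]
      exact integral_add (integrableOn_L2 K f (continuous_ev _))
        (integrableOn_L2 K f (continuous_ev _)))
    (fun a f t => by
      simp only [Prod.smul_snd, Submodule.coe_smul, ev_smul, smul_eq_mul, mul_left_comm _ a,
        integral_const_mul])

open Classical in
/-- The local solver on `K`: it sends a load `ℓ` to the unique `s` with `localForm s t = ℓ t` for
all test functions `t`. (If the local problem were not uniquely solvable, it would be `0`.) -/
def localSolve {Γ : ℝ} (k : ℕ) (T : Mesh Ω) (α : Coeff Ω Γ) (τ : Penalty T) (K : T.Elem) :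
    (LocalSpace n k →ₗ[ℝ] ℝ) →ₗ[ℝ] LocalSpace n k :=
  if h : Function.Bijective (localForm k T α τ K) then
    (LinearEquiv.ofBijective (localForm k T α τ K) h).symm.toLinearMap
  else 0

/-- `Q : M_h → V_h`. -/
def liftQ {Γ : ℝ} (k : ℕ) (T : Mesh Ω) (α : Coeff Ω Γ) (τ : Penalty T) : T.M k →ₗ[ℝ] T.V k :=
  LinearMap.pi fun K => LinearMap.fst ℝ _ _ ∘ₗ localSolve k T α τ K ∘ₗ traceLoad k T τ K

/-- `U : M_h → W_h`. -/
def liftU {Γ : ℝ} (k : ℕ) (T : Mesh Ω) (α : Coeff Ω Γ) (τ : Penalty T) : T.M k →ₗ[ℝ] T.W k :=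
  LinearMap.pi fun K => LinearMap.snd ℝ _ _ ∘ₗ localSolve k T α τ K ∘ₗ traceLoad k T τ K

/-- `Q_w : L²(Ω) → V_h`. -/
def sourceQ {Γ : ℝ} (k : ℕ) (T : Mesh Ω) (α : Coeff Ω Γ) (τ : Penalty T) :
    Lp ℝ 2 (volume.restrict Ω) →ₗ[ℝ] T.V k :=
  LinearMap.pi fun K => LinearMap.fst ℝ _ _ ∘ₗ localSolve k T α τ K ∘ₗ sourceLoad k T K

/-- `U_w : L²(Ω) → W_h`. -/
def sourceU {Γ : ℝ} (k : ℕ) (T : Mesh Ω) (α : Coeff Ω Γ) (τ : Penalty T) :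
    Lp ℝ 2 (volume.restrict Ω) →ₗ[ℝ] T.W k :=
  LinearMap.pi fun K => LinearMap.snd ℝ _ _ ∘ₗ localSolve k T α τ K ∘ₗ sourceLoad k T K

/-! ### `W_h` inside `L²(Ω)`, and `U_w` as a bounded operator on `L²(Ω)` -/

open Classical in
/-- The function on `Ω` that is equal to the polynomial `w K` on every mesh element `K`
(defined up to the null set where elements overlap). -/
def brokenFun {T : Mesh Ω} {k : ℕ} (w : T.W k) (x : EuclideanSpace ℝ (Fin n)) : ℝ :=
  ∑ K : T.Elem, K.set.indicator (ev (w K).1) x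

lemma memLp_brokenFun {T : Mesh Ω} {k : ℕ} (w : T.W k) :
    MemLp (brokenFun w) 2 (volume.restrict Ω) := by
  refine memLp_finsetSum _ fun K _ => ?_
  have hK := (isCompact_elem K).measurableSet
  obtain ⟨C, hC⟩ := (isCompact_elem K).exists_bound_of_continuousOn
    (continuous_ev (w K).1).continuousOn
  rw [memLp_indicator_iff_restrict hK]
  have h : IsFiniteMeasure ((volume.restrict Ω).restrict K.set) := ⟨by
    rw [Measure.restrict_apply_univ]
    exact (Measure.restrict_apply_le _ _).trans_lt (isCompact_elem K).measure_lt_top⟩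
  refine MemLp.of_bound (continuous_ev _).aestronglyMeasurable C ?_
  filter_upwards [ae_restrict_mem hK] with x hx using hC x hx

lemma brokenFun_add {T : Mesh Ω} {k : ℕ} (v w : T.W k) :
    brokenFun (v + w) = brokenFun v + brokenFun w := by
  funext x
  simp only [brokenFun, Pi.add_apply, ← Finset.sum_add_distrib]
  refine Finset.sum_congr rfl fun K _ => ?_
  by_cases h : x ∈ K.set <;> simp [h, ev_add]

lemma brokenFun_smul {T : Mesh Ω} {k : ℕ} (a : ℝ) (w : T.W k) :
    brokenFun (a • w) = a • brokenFun w := by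
  funext x
  simp only [brokenFun, Pi.smul_apply, smul_eq_mul, Finset.mul_sum]
  refine Finset.sum_congr rfl fun K _ => ?_
  by_cases h : x ∈ K.set <;> simp [h, ev_smul]

/-- The inclusion `W_h ⊆ L²(Ω)`. -/
def toL2 {T : Mesh Ω} {k : ℕ} : T.W k →ₗ[ℝ] Lp ℝ 2 (volume.restrict Ω) where
  toFun w := (memLp_brokenFun w).toLp
  map_add' v w := by
    simp only [brokenFun_add]
    exact MemLp.toLp_add (memLp_brokenFun v) (memLp_brokenFun w)
  map_smul' a w := by
    simp only [brokenFun_smul, RingHom.id_apply]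
    exact MemLp.toLp_const_smul a (memLp_brokenFun w)

lemma continuous_sourceLoad (k : ℕ) (T : Mesh Ω) (K : T.Elem) (t : LocalSpace n k) :
    Continuous fun f : Lp ℝ 2 (volume.restrict Ω) => sourceLoad k T K f t := by
  classical
  have hK := (isCompact_elem K).measurableSet
  have hres : (volume.restrict Ω).restrict K.set = volume.restrict K.set := by
    rw [Measure.restrict_restrict hK]
    refine Measure.restrict_congr_set ?_
    have h := (ae_restrict_iff' hK).1 (elem_ae_mem K)
    filter_upwards [h] with x hx
    exact propext ⟨fun h => h.1, fun h => ⟨h, hx h⟩⟩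
  have hm : MemLp (K.set.indicator (ev t.2.1)) 2 (volume.restrict Ω) := by
    obtain ⟨C, hC⟩ := (isCompact_elem K).exists_bound_of_continuousOn
      (continuous_ev t.2.1).continuousOn
    rw [memLp_indicator_iff_restrict hK, hres]
    have h : IsFiniteMeasure (volume.restrict K.set) := ⟨by
      rw [Measure.restrict_apply_univ]
      exact (isCompact_elem K).measure_lt_top⟩
    refine MemLp.of_bound (continuous_ev _).aestronglyMeasurable C ?_
    filter_upwards [ae_restrict_mem hK] with x hx using hC x hx
  have h : (fun f : Lp ℝ 2 (volume.restrict Ω) => sourceLoad k T K f t) =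
      fun f => inner ℝ hm.toLp f := by
    funext f
    have h1 : sourceLoad k T K f t = ∫ x in K.set, f x * ev t.2.1 x := rfl
    rw [L2.inner_def, h1, ← hres, ← integral_indicator hK]
    refine integral_congr_ae ?_
    filter_upwards [hm.coeFn_toLp] with x hx
    rw [hx]
    by_cases hxK : x ∈ K.set <;> simp [hxK]
  rw [h]
  fun_prop

lemma continuous_of_weak {H X Y : Type*} [AddCommGroup H] [Module ℝ H] [TopologicalSpace H]
    [AddCommGroup X] [Module ℝ X] [FiniteDimensional ℝ X] [NormedAddCommGroup Y]
    [NormedSpace ℝ Y] (l : H →ₗ[ℝ] X →ₗ[ℝ] ℝ) (hl : ∀ t, Continuous fun f => l f t)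
    (G : (X →ₗ[ℝ] ℝ) →ₗ[ℝ] Y) : Continuous fun f => G (l f) := by
  let b := Module.finBasis ℝ X
  have h : ∀ f, l f = ∑ j, l f (b j) • b.coord j := by
    intro f
    refine b.ext fun i => ?_
    simp
  have h2 : (fun f => G (l f)) = fun f => ∑ j, l f (b j) • G (b.coord j) := by
    funext f
    conv_lhs => rw [h f, map_sum]
    exact Finset.sum_congr rfl fun j _ => map_smul _ _ _
  rw [h2]
  exact continuous_finsetSum _ fun j _ => (hl _).smul continuous_const

lemma continuous_Uw {Γ : ℝ} (k : ℕ) (T : Mesh Ω) (α : Coeff Ω Γ) (τ : Penalty T) :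
    Continuous (toL2 ∘ₗ sourceU k T α τ) := by
  classical
  have h : ⇑(toL2 ∘ₗ sourceU k T α τ) = fun f => ∑ K, (toL2 ∘ₗ LinearMap.single ℝ _ K ∘ₗ
      LinearMap.snd ℝ _ _ ∘ₗ localSolve k T α τ K) (sourceLoad k T K f) := by
    funext f
    have : sourceU k T α τ f = ∑ K, Pi.single K (sourceU k T α τ f K) :=
      (Finset.univ_sum_single _).symm
    rw [LinearMap.comp_apply, this, map_sum]
    rfl
  rw [h]
  exact continuous_finsetSum _ fun K _ => continuous_of_weak _ (continuous_sourceLoad k T K) _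

/-- `U_w` as a bounded operator on `L²(Ω)` (with values in `W_h`). -/
def Uw {Γ : ℝ} (k : ℕ) (T : Mesh Ω) (α : Coeff Ω Γ) (τ : Penalty T) :
    Lp ℝ 2 (volume.restrict Ω) →L[ℝ] Lp ℝ 2 (volume.restrict Ω) :=
  ⟨toL2 ∘ₗ sourceU k T α τ, continuous_Uw k T α τ⟩

/-- `‖f‖_{L²(K)}`. -/
def normElem {T : Mesh Ω} (K : T.Elem) (f : Lp ℝ 2 (volume.restrict Ω)) : ℝ :=
  Real.sqrt (∫ x in K.set, f x ^ 2)

/-- `(v, w)_{Ω_h} = ∑_K (v, w)_K` for `v ∈ L²(Ω)` and `w ∈ W_h`. -/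
def innerW {T : Mesh Ω} {k : ℕ} (v : Lp ℝ 2 (volume.restrict Ω)) (w : T.W k) : ℝ :=
  ∑ K : T.Elem, ∫ x in K.set, v x * ev (w K).1 x

/-! ### The eigenproblems -/

/-- `a_h(η, μ) = (c Qη, Qμ)_{Ω_h} + ⟨τ (Uη - η), Uμ - μ⟩_{∂Ω_h}`. -/
def ah {Γ : ℝ} (k : ℕ) (T : Mesh Ω) (α : Coeff Ω Γ) (τ : Penalty T) (η μ : T.M k) : ℝ :=
  ∑ K : T.Elem,
    ((∫ x in K.set, (α.c x).mulVec (evv (liftQ k T α τ η K) x) ⬝ᵥ evv (liftQ k T α τ μ K) x)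
      + ∑ F ∈ K.faces, ∫ x in F.set, τ.toFun K F *
          ((ev (liftU k T α τ η K).1 x - η.1 F x) *
            (ev (liftU k T α τ μ K).1 x - μ.1 F x)) ∂μHE[n - 1])

/-- The branch from `K`, on the face `F` of `K`, of the numerical flux
`q̂ = q + τ (u - η) n`. -/
def flux {T : Mesh Ω} {k : ℕ} (τ : Penalty T) (q : T.V k) (u : T.W k) (η : T.M k)
    (K : T.Elem) (F : T.Face) (x : EuclideanSpace ℝ (Fin n)) : Fin n → ℝ :=
  evv (q K) x + (τ.toFun K F * (ev (u K).1 x - η.1 F x)) • (K.normal F : Fin n → ℝ)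

/-- `(lam; q, u, η)` solves the HDG eigenproblem, with `(q, u, η) ∈ V_h × W_h × M_h` nontrivial. -/
structure SolvesHDG {Γ : ℝ} {k : ℕ} {T : Mesh Ω} (α : Coeff Ω Γ) (τ : Penalty T) (lam : ℝ)
    (q : T.V k) (u : T.W k) (η : T.M k) : Prop where
  nontrivial : (q, u, η) ≠ 0
  eq_a : ∀ r : T.V k,
    (∑ K, ∫ x in K.set, (α.c x).mulVec (evv (q K) x) ⬝ᵥ evv (r K) x)
      - (∑ K, ∫ x in K.set, ev (u K).1 x * dv (r K) x)
      + (∑ K : T.Elem, ∑ F ∈ K.faces, ∫ x in F.set,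
          η.1 F x * (evv (r K) x ⬝ᵥ K.normal F) ∂μHE[n - 1]) = 0
  eq_b : ∀ w : T.W k,
    -(∑ K, ∫ x in K.set, evv (q K) x ⬝ᵥ gd (w K) x)
      + (∑ K : T.Elem, ∑ F ∈ K.faces, ∫ x in F.set,
          (flux τ q u η K F x ⬝ᵥ K.normal F) * ev (w K).1 x ∂μHE[n - 1])
      = lam * ∑ K, ∫ x in K.set, ev (u K).1 x * ev (w K).1 x
  eq_c : ∀ μ : T.M k,
    (∑ K : T.Elem, ∑ F ∈ K.faces, ∫ x in F.set,
      μ.1 F x * (flux τ q u η K F x ⬝ᵥ K.normal F) ∂μHE[n - 1]) = 0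

/-- `(I - lam U_w)⁻¹ U η ∈ L²(Ω)`. -/
def resolvedU {Γ : ℝ} {k : ℕ} {T : Mesh Ω} (α : Coeff Ω Γ) (τ : Penalty T) (lam : ℝ)
    (η : T.M k) : Lp ℝ 2 (volume.restrict Ω) :=
  Ring.inverse (1 - lam • Uw k T α τ) (toL2 (liftU k T α τ η))

/-- `(lam; η)` solves the condensed nonlinear eigenproblem, with `η ∈ M_h` nontrivial. -/
structure SolvesCondensed {Γ : ℝ} {k : ℕ} {T : Mesh Ω} (α : Coeff Ω Γ) (τ : Penalty T) (lam : ℝ)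
    (η : T.M k) : Prop where
  nontrivial : η ≠ 0
  eq : ∀ μ : T.M k, ah k T α τ η μ = lam * innerW (resolvedU α τ lam η) (liftU k T α τ μ)

end MeshDefs

end

end HDG

namespace HDG

noncomputable section

/-! ### Calculus of polynomials -/

/-! Condensation is linear algebra once two facts are known: every local problem is uniquely
solvable, and `U_w` is small on small elements. Both follow from one estimate,
`exists_energy_bound`: if `(q, u)` satisfies the first local equation on `K` with zero trace, then
`‖u‖²_K ≤ C₀ d_K² h_K² E`, where `E = (c q, q)_K + ⟨τ u, u⟩_{∂K}` is the local form on the diagonal.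

For this estimate, let `F` be a face of `K` on which `τ` is maximal, `a` the vertex opposite `F`,
`b` a vertex of `F`, and `e = a - b`. Testing with `r = G e`, `G ∈ P_k`, gives `(u, ∂_e G)_K = (c q,
G e)_K`, so `E` controls the products of `u` with `∂_e P_k`; it also controls `u` on `F`. On the
reference simplex, an element of `P_k` that vanishes on the bottom face and is orthogonal to `∂₀
P_k` is zero (`eq_zero_of_orthogonal_pderiv`), and compactness makes this quantitative
(`exists_reference_bound`). The affine chart turns `∂_e` into `∂₀`, and the Jacobians on `K` and on
`F` differ exactly by the height of `a` over `F`. Both this height and `|e|` are at most `h_K`, and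
the remaining Jacobian cancels; hence no shape regularity enters and `C₀` depends on `n`, `k`, `Γ`
only.

For a homogeneous local problem `E = 0`, which gives uniqueness, and existence by dimension
(`localForm_bijective`). For a source `f`, `E = (f, u)_K`, and Cauchy–Schwarz gives the bound for
`U_w` (`exists_sourceU_bound`). Summed over the elements it yields `‖λ U_w‖ < 1`, so a Neumann
series inverts `I - λ U_w` (`isUnit_one_sub_smul_Uw`).

By unique solvability, the first two HDG equations say exactly that `q = Qη + λ Q_w u` and `u = Uη +
λ U_w u` (`local_equations_iff`, `local_solution_iff`), and the latter means `u = (I - λ U_w)⁻¹ Uη`.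
For such `q` and `u`, testing the local problems against one another gives `⟨μ, q̂·n⟩ = λ (u, Uμ) -
a_h(η, μ)` (`sum_trace_flux_eq`), so the third HDG equation is the condensed one. Nontriviality
agrees on both sides, since `η = 0` forces `u = 0` and then `q = 0`. -/

lemma ev_C {n : ℕ} (a : ℝ) (x : EuclideanSpace ℝ (Fin n)) : ev (MvPolynomial.C a) x = a := by
  simp [ev]

lemma ev_X {n : ℕ} (i : Fin n) (x : EuclideanSpace ℝ (Fin n)) : ev (MvPolynomial.X i) x = x i := by
  simp [ev]

lemma ev_mul {n : ℕ} (p q : MvPolynomial (Fin n) ℝ) (x : EuclideanSpace ℝ (Fin n)) :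
    ev (p * q) x = ev p x * ev q x := by simp [ev]

lemma ev_zero {n : ℕ} (x : EuclideanSpace ℝ (Fin n)) :
    ev (0 : MvPolynomial (Fin n) ℝ) x = 0 := by simp [ev]

lemma ev_sum {n : ℕ} {ι : Type*} (s : Finset ι) (p : ι → MvPolynomial (Fin n) ℝ)
    (x : EuclideanSpace ℝ (Fin n)) : ev (∑ i ∈ s, p i) x = ∑ i ∈ s, ev (p i) x := by
  simp [ev]

/-- The derivative of a polynomial in the direction `e`. -/
def dirDeriv {n : ℕ} (e : Fin n → ℝ) (p : MvPolynomial (Fin n) ℝ) : MvPolynomial (Fin n) ℝ :=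
  ∑ i, e i • MvPolynomial.pderiv i p

lemma ev_dirDeriv {n : ℕ} (e : Fin n → ℝ) (p : MvPolynomial (Fin n) ℝ)
    (x : EuclideanSpace ℝ (Fin n)) :
    ev (dirDeriv e p) x = ∑ i, e i * ev (MvPolynomial.pderiv i p) x := by
  simp [dirDeriv, ev_sum, ev_smul]

lemma dirDeriv_mul {n : ℕ} (e : Fin n → ℝ) (p q : MvPolynomial (Fin n) ℝ) :
    dirDeriv e (p * q) = dirDeriv e p * q + p * dirDeriv e q := by
  simp only [dirDeriv, Derivation.leibniz, smul_eq_mul, Finset.sum_mul, Finset.mul_sum,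
    ← Finset.sum_add_distrib]
  refine Finset.sum_congr rfl fun i _ => ?_
  rw [smul_add, Algebra.mul_smul_comm, Algebra.smul_mul_assoc, add_comm, mul_comm q]

lemma dirDeriv_single {n : ℕ} (i : Fin n) (p : MvPolynomial (Fin n) ℝ) :
    dirDeriv (Pi.single i 1) p = MvPolynomial.pderiv i p := by
  simp [dirDeriv, Pi.single_apply]

lemma hasDerivAt_ev_line {n : ℕ} (p : MvPolynomial (Fin n) ℝ) (x e : EuclideanSpace ℝ (Fin n))
    (t : ℝ) : HasDerivAt (fun t : ℝ => ev p (x + t • e)) (ev (dirDeriv e p) (x + t • e)) t := by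
  induction p using MvPolynomial.induction_on with
  | C a => simpa [ev_C, ev_dirDeriv, ev_zero] using hasDerivAt_const t a
  | add p q hp hq =>
    have h : dirDeriv e (p + q) = dirDeriv e p + dirDeriv e q := by
      simp [dirDeriv, Finset.sum_add_distrib]
    simp only [ev_add, h]
    exact hp.add hq
  | mul_X p i hp =>
    have h1 : dirDeriv e (MvPolynomial.X i) = MvPolynomial.C (e i) := by
      simp [dirDeriv, MvPolynomial.pderiv_X, Pi.single_apply, MvPolynomial.smul_eq_C_mul]
    have h2 : HasDerivAt (fun t : ℝ => (x + t • e) i) (e i) t := by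
      simpa using ((hasDerivAt_id t).mul_const (e i)).const_add (x i)
    simp only [ev_mul, ev_X, dirDeriv_mul, ev_add, h1, ev_C]
    exact hp.mul h2

lemma ev_eq_zero_of_forall {n : ℕ} {p : MvPolynomial (Fin n) ℝ} (h : ∀ x, ev p x = 0) : p = 0 := by
  refine MvPolynomial.funext fun x => ?_
  simpa [ev] using h (WithLp.toLp 2 x)

lemma eq_zero_of_ev_eq_zero_on_open {n : ℕ} {p : MvPolynomial (Fin n) ℝ}
    {s : Set (EuclideanSpace ℝ (Fin n))} (hs : IsOpen s) (hne : s.Nonempty)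
    (h : ∀ x ∈ s, ev p x = 0) : p = 0 := by
  obtain ⟨x, hx⟩ := hne
  -- In the sup norm a ball is a box, and a polynomial that vanishes on a product of infinite sets
  -- is zero.
  have hs' : IsOpen ((WithLp.toLp 2 : (Fin n → ℝ) → EuclideanSpace ℝ (Fin n)) ⁻¹' s) :=
    hs.preimage (PiLp.continuous_toLp 2 _)
  obtain ⟨ε, hε, hball⟩ := Metric.isOpen_iff.1 hs' x.ofLp (by simpa using hx)
  refine MvPolynomial.funext_set (fun i => Metric.ball (x i) ε)
    (fun i => ?_) fun y hy => ?_
  · rw [Real.ball_eq_Ioo]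
    exact Set.Ioo_infinite (by linarith)
  · have : WithLp.toLp 2 y ∈ s := hball (by rw [ball_pi _ hε]; exact hy)
    simpa [ev] using h _ this

/-- A nonnegative polynomial combination that is zero almost everywhere on a set is zero inside. -/
lemma eq_zero_of_setIntegral_sq_eq_zero {X : Type*} [TopologicalSpace X] [MeasurableSpace X]
    [BorelSpace X] {ν : Measure X} [ν.IsOpenPosMeasure] {f : X → ℝ} (hf : Continuous f)
    {s : Set X} (hint : IntegrableOn f s ν) (hnn : ∀ᵐ x ∂(ν.restrict s), 0 ≤ f x)
    (h : ∫ x in s, f x ∂ν = 0) : ∀ x ∈ interior s, f x = 0 := by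
  have h0 := (setIntegral_eq_zero_iff_of_nonneg_ae hnn hint).1 h
  have h1 : f =ᵐ[ν.restrict (interior s)] fun _ => (0 : ℝ) :=
    ae_mono (Measure.restrict_mono interior_subset le_rfl) h0
  exact fun x hx => Measure.eqOn_open_of_ae_eq h1 isOpen_interior hf.continuousOn
    continuousOn_const hx

/-! ### Affine changes of variables -/

/-- A monomial of degree `d` becomes a product of `d` factors of degree at most one. This is why an
affine change of variables preserves `P_k`. -/
lemma totalDegree_bind₁_le {n m : ℕ} (l : Fin n → MvPolynomial (Fin m) ℝ)
    (hl : ∀ i, (l i).totalDegree ≤ 1) (p : MvPolynomial (Fin n) ℝ) :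
    (MvPolynomial.bind₁ l p).totalDegree ≤ p.totalDegree := by
  conv_lhs => rw [p.as_sum, map_sum]
  refine MvPolynomial.totalDegree_finsetSum_le fun d hd => ?_
  rw [MvPolynomial.bind₁_monomial]
  refine (MvPolynomial.totalDegree_mul _ _).trans ?_
  rw [MvPolynomial.totalDegree_C, zero_add]
  refine (MvPolynomial.totalDegree_finsetProd _ _).trans ?_
  refine le_trans ?_ (MvPolynomial.le_totalDegree hd)
  refine Finset.sum_le_sum fun i _ => ?_
  refine (MvPolynomial.totalDegree_pow _ _).trans ?_
  exact (Nat.mul_le_mul_left _ (hl i)).trans_eq (mul_one _)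

/-- The components of `x ↦ b + ∑ j, x j • v j`, as polynomials. -/
def affinePoly {n : ℕ} (b : EuclideanSpace ℝ (Fin n)) (v : Fin n → EuclideanSpace ℝ (Fin n))
    (i : Fin n) : MvPolynomial (Fin n) ℝ :=
  MvPolynomial.C (b i) + ∑ j, MvPolynomial.C (v j i) * MvPolynomial.X j

lemma totalDegree_affinePoly {n : ℕ} (b : EuclideanSpace ℝ (Fin n))
    (v : Fin n → EuclideanSpace ℝ (Fin n)) (i : Fin n) : (affinePoly b v i).totalDegree ≤ 1 := by
  refine (MvPolynomial.totalDegree_add _ _).trans (max_le (by simp) ?_)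
  refine MvPolynomial.totalDegree_finsetSum_le fun j _ => ?_
  exact (MvPolynomial.totalDegree_mul _ _).trans (by simp)

/-- Composition of polynomials with `x ↦ b + ∑ j, x j • v j`. -/
def affinePullback {n : ℕ} (k : ℕ) (b : EuclideanSpace ℝ (Fin n))
    (v : Fin n → EuclideanSpace ℝ (Fin n)) : Pk n k →ₗ[ℝ] Pk n k :=
  (MvPolynomial.bind₁ (affinePoly b v)).toLinearMap.restrict fun p hp =>
    (MvPolynomial.mem_restrictTotalDegree _ _ _).2
      ((totalDegree_bind₁_le _ (totalDegree_affinePoly b v) p).trans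
        ((MvPolynomial.mem_restrictTotalDegree _ _ _).1 hp))

lemma ev_affinePullback {n k : ℕ} (b : EuclideanSpace ℝ (Fin n))
    (v : Fin n → EuclideanSpace ℝ (Fin n)) (p : Pk n k) (x : EuclideanSpace ℝ (Fin n)) :
    ev (affinePullback k b v p).1 x = ev p.1 (b + ∑ j, x j • v j) := by
  have : (affinePullback k b v p).1 = MvPolynomial.bind₁ (affinePoly b v) p.1 := rfl
  rw [this, ev, ← MvPolynomial.coe_aeval_eq_eval, RingHom.coe_coe, MvPolynomial.aeval_bind₁, ev,
    ← MvPolynomial.coe_aeval_eq_eval, RingHom.coe_coe]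
  congr 2
  funext i
  simp [affinePoly, mul_comm]

/-- With `n` independent edges the affine map is onto, so only the zero polynomial pulls back to
zero; injectivity suffices in finite dimension. Every test polynomial on the reference simplex thus
comes from one on the element. -/
lemma affinePullback_surjective {n : ℕ} (k : ℕ) (b : EuclideanSpace ℝ (Fin n))
    {v : Fin n → EuclideanSpace ℝ (Fin n)} (hv : LinearIndependent ℝ v) :
    Function.Surjective (affinePullback k b v) := by
  refine LinearMap.surjective_of_injective ((injective_iff_map_eq_zero _).2 fun p hp => ?_)
  refine Subtype.ext (ev_eq_zero_of_forall fun x => ?_)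
  have hspan : ⊤ ≤ Submodule.span ℝ (Set.range v) :=
    (hv.span_eq_top_of_card_eq_finrank' (by simp)).ge
  obtain ⟨c, hc⟩ :=
    (Submodule.mem_span_range_iff_exists_fun ℝ).1 (hspan (Submodule.mem_top (x := x - b)))
  have h := ev_affinePullback b v p (WithLp.toLp 2 c)
  rw [hp] at h
  simpa [hc, ev_zero] using h.symm

/-! ### Bilinear forms -/

/-- The quotient of the two quadratic forms is continuous on the compact unit sphere of a coordinate
space, hence bounded there; homogeneity of degree two extends the bound to all vectors. -/
lemma exists_bound_of_posDef {X : Type*} [AddCommGroup X] [Module ℝ X] [FiniteDimensional ℝ X]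
    (B₁ B₂ : X →ₗ[ℝ] X →ₗ[ℝ] ℝ) (h : ∀ x, x ≠ 0 → 0 < B₂ x x) :
    ∃ C : ℝ, 0 < C ∧ ∀ x, B₁ x x ≤ C * B₂ x x := by
  let e := (Module.finBasis ℝ X).equivFun
  have hcont : ∀ B : X →ₗ[ℝ] X →ₗ[ℝ] ℝ, Continuous fun y => B (e.symm y) (e.symm y) := by
    intro B
    have : (fun y => B (e.symm y) (e.symm y)) =
        fun y => ∑ i, ∑ j, y i * y j * B (Module.finBasis ℝ X i) (Module.finBasis ℝ X j) := by
      funext y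
      simp only [e, Module.Basis.equivFun_symm_apply, map_sum, map_smul, LinearMap.sum_apply,
        LinearMap.smul_apply, smul_eq_mul, Finset.mul_sum, mul_assoc]
      exact Finset.sum_comm.trans (by simp only [mul_left_comm])
    rw [this]
    fun_prop
  have hpos : ∀ y ∈ Metric.sphere (0 : Fin (Module.finrank ℝ X) → ℝ) 1,
      0 < B₂ (e.symm y) (e.symm y) := fun y hy => h _ (by
    have : y ≠ 0 := ne_zero_of_mem_unit_sphere ⟨y, hy⟩
    simpa using this)
  obtain ⟨C, hC⟩ :=
    (isCompact_sphere (0 : Fin (Module.finrank ℝ X) → ℝ) 1).exists_bound_of_continuousOn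
    (f := fun y => B₁ (e.symm y) (e.symm y) / B₂ (e.symm y) (e.symm y))
    ((hcont B₁).continuousOn.div (hcont B₂).continuousOn fun y hy => (hpos y hy).ne')
  refine ⟨max C 1, by positivity, fun x => ?_⟩
  by_cases hx : x = 0
  · simp [hx]
  have hx' : ‖e x‖ ≠ 0 := by simpa using hx
  set y := ‖e x‖⁻¹ • e x with hy
  have hyS : y ∈ Metric.sphere (0 : Fin (Module.finrank ℝ X) → ℝ) 1 := by
    simp [hy, norm_smul, hx']
  have h1 := (le_abs_self _).trans (hC y hyS)
  rw [div_le_iff₀ (hpos y hyS)] at h1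
  have h2 : x = ‖e x‖ • e.symm y := by
    rw [hy, map_smul, smul_smul, mul_inv_cancel₀ hx', one_smul, e.symm_apply_apply]
  have h3 : B₁ (e.symm y) (e.symm y) ≤ max C 1 * B₂ (e.symm y) (e.symm y) :=
    h1.trans (by gcongr; exacts [(hpos y hyS).le, le_max_left _ _])
  rw [h2]
  simp only [map_smul, LinearMap.smul_apply, smul_eq_mul]
  nlinarith [mul_le_mul_of_nonneg_left h3 (mul_self_nonneg ‖e x‖)]

/-- Nonpositivity of the discriminant. It yields the Cauchy–Schwarz inequalities both for `(c ·,
·)_K` and in `L²(K)`. -/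
lemma sq_le_mul_of_quadratic_nonneg {a b c : ℝ} (h : ∀ s : ℝ, 0 ≤ a + 2 * s * b + s ^ 2 * c) :
    b ^ 2 ≤ a * c := by
  have := discrim_le_zero (a := c) (b := 2 * b) (c := a) fun s => by
    have := h s
    nlinarith
  rw [discrim] at this
  nlinarith

/-! ### The reference simplex -/

/-- The reference simplex. -/
def corner (m : ℕ) : Set (EuclideanSpace ℝ (Fin m)) := {y | (∀ i, 0 ≤ y i) ∧ ∑ i, y i ≤ 1}

/-- The interior of the reference simplex. -/
def openCorner (m : ℕ) : Set (EuclideanSpace ℝ (Fin m)) := {y | (∀ i, 0 < y i) ∧ ∑ i, y i < 1}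

/-- The reference simplex of dimension `m + 1`, with its first coordinate split off. -/
def splitCorner (m : ℕ) : Set (EuclideanSpace ℝ (Fin m) × ℝ) :=
  {z | z.1 ∈ corner m ∧ 0 ≤ z.2 ∧ z.2 ≤ 1 - ∑ i, z.1 i}

/-- The point with first coordinate `z.2` and remaining coordinates `z.1`. -/
def consPoint {m : ℕ} (z : EuclideanSpace ℝ (Fin m) × ℝ) : EuclideanSpace ℝ (Fin (m + 1)) :=
  WithLp.toLp 2 (Fin.cons z.2 z.1.ofLp)

@[simp] lemma consPoint_zero {m : ℕ} (z : EuclideanSpace ℝ (Fin m) × ℝ) :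
    consPoint z 0 = z.2 := rfl

@[simp] lemma consPoint_succ {m : ℕ} (z : EuclideanSpace ℝ (Fin m) × ℝ) (i : Fin m) :
    consPoint z i.succ = z.1 i := rfl

lemma continuous_consPoint {m : ℕ} : Continuous (consPoint (m := m)) := by
  refine (PiLp.continuous_toLp 2 _).comp (continuous_pi fun i => ?_)
  refine Fin.cases ?_ (fun j => ?_) i
  · exact continuous_snd
  · simp only [Fin.cons_succ]
    fun_prop

lemma consPoint_eq_add {m : ℕ} (y : EuclideanSpace ℝ (Fin m)) (t : ℝ) :
    consPoint (y, t) = consPoint (y, 0) + t • EuclideanSpace.single 0 1 := by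
  ext i
  refine Fin.cases ?_ (fun j => ?_) i <;> simp

lemma isCompact_corner (m : ℕ) : IsCompact (corner m) := by
  refine Metric.isCompact_of_isClosed_isBounded ?_ ?_
  · have : corner m = (⋂ i, {y : EuclideanSpace ℝ (Fin m) | 0 ≤ y i}) ∩
        {y : EuclideanSpace ℝ (Fin m) | ∑ i, y i ≤ 1} := by
      ext y; simp [corner]
    rw [this]
    exact (isClosed_iInter fun i => isClosed_le continuous_const (by fun_prop)).inter
      (isClosed_le (by fun_prop) continuous_const)
  · refine (Metric.isBounded_closedBall (x := 0) (r := 1)).subset fun y hy => ?_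
    rw [mem_closedBall_zero_iff, ← sq_le_one_iff₀ (norm_nonneg y), EuclideanSpace.norm_sq_eq]
    refine le_trans (Finset.sum_le_sum fun i _ => ?_) hy.2
    have h1 : y i ≤ 1 :=
      (Finset.single_le_sum (f := fun i => y i) (fun i _ => hy.1 i) (Finset.mem_univ i)).trans hy.2
    rw [Real.norm_eq_abs, sq_abs]
    nlinarith [hy.1 i]

lemma isCompact_splitCorner (m : ℕ) : IsCompact (splitCorner m) := by
  refine ((isCompact_corner m).prod (isCompact_Icc (a := (0 : ℝ)) (b := 1))).of_isClosed_subset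
    ?_ fun z hz => ⟨hz.1, hz.2.1, hz.2.2.trans ?_⟩
  · refine ((isCompact_corner m).isClosed.preimage continuous_fst).inter
      ((isClosed_le continuous_const continuous_snd).inter
        (isClosed_le continuous_snd (by fun_prop)))
  · linarith [Finset.sum_nonneg fun i (_ : i ∈ Finset.univ) => hz.1.1 i]

lemma isOpen_openCorner (m : ℕ) : IsOpen (openCorner m) := by
  have : openCorner m = (⋂ i, {y : EuclideanSpace ℝ (Fin m) | 0 < y i}) ∩
      {y : EuclideanSpace ℝ (Fin m) | ∑ i, y i < 1} := by
    ext y; simp [openCorner]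
  rw [this]
  exact (isOpen_iInter_of_finite fun i => isOpen_lt continuous_const (by fun_prop)).inter
    (isOpen_lt (by fun_prop) continuous_const)

lemma openCorner_nonempty (m : ℕ) : (openCorner m).Nonempty := by
  refine ⟨WithLp.toLp 2 fun _ => ((m : ℝ) + 1)⁻¹, fun i => by positivity, ?_⟩
  simp only [Finset.sum_const, Finset.card_univ, Fintype.card_fin, nsmul_eq_mul]
  rw [← div_eq_mul_inv, div_lt_one (by positivity)]
  linarith

lemma openCorner_subset_interior (m : ℕ) : openCorner m ⊆ interior (corner m) :=
  interior_maximal (fun _ hy => ⟨fun i => (hy.1 i).le, hy.2.le⟩) (isOpen_openCorner m)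

lemma convex_corner (m : ℕ) : Convex ℝ (corner m) := by
  intro x hx y hy a b ha hb hab
  refine ⟨fun i => ?_, ?_⟩
  · have := mul_nonneg ha (hx.1 i)
    have := mul_nonneg hb (hy.1 i)
    simp only [PiLp.add_apply, PiLp.smul_apply, smul_eq_mul]
    linarith
  · simp only [PiLp.add_apply, PiLp.smul_apply, smul_eq_mul, Finset.sum_add_distrib,
      ← Finset.mul_sum]
    nlinarith [mul_le_mul_of_nonneg_left hx.2 ha, mul_le_mul_of_nonneg_left hy.2 hb]

lemma ae_mem_interior_corner (m : ℕ) :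
    ∀ᵐ y ∂(volume.restrict (corner m)), y ∈ interior (corner m) := by
  have h1 : volume (frontier (corner m)) = 0 := (convex_corner m).addHaar_frontier volume
  rw [← Measure.restrict_congr_set (interior_ae_eq_of_null_frontier h1)]
  exact ae_restrict_mem isOpen_interior.measurableSet

lemma consPoint_mem_openCorner {m : ℕ} {z : EuclideanSpace ℝ (Fin m) × ℝ}
    (hz : consPoint z ∈ openCorner (m + 1)) :
    z ∈ interior (splitCorner m) ∧ z.1 ∈ interior (corner m) := by
  have key : ∀ z : EuclideanSpace ℝ (Fin m) × ℝ, consPoint z ∈ openCorner (m + 1) →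
      z.1 ∈ openCorner m ∧ z ∈ splitCorner m := by
    intro z hz
    have h0 : 0 < z.2 := hz.1 0
    have h1 : ∀ i, 0 < z.1 i := fun i => hz.1 i.succ
    have h2 : z.2 + ∑ i, z.1 i < 1 := by simpa [Fin.sum_univ_succ] using hz.2
    refine ⟨⟨h1, by linarith⟩, ⟨fun i => (h1 i).le, by linarith⟩, h0.le, by linarith⟩
  refine ⟨?_, openCorner_subset_interior m (key z hz).1⟩
  exact interior_maximal (s := splitCorner m) (t := consPoint ⁻¹' openCorner (m + 1))
    (fun z hz => (key z hz).2) ((isOpen_openCorner _).preimage continuous_consPoint) hz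

lemma integrableOn_corner {m : ℕ} {g : EuclideanSpace ℝ (Fin m) → ℝ} (hg : Continuous g) :
    IntegrableOn g (corner m) :=
  hg.continuousOn.integrableOn_compact (isCompact_corner m)

lemma integrableOn_splitCorner {m : ℕ} {g : EuclideanSpace ℝ (Fin m) × ℝ → ℝ}
    (hg : Continuous g) : IntegrableOn g (splitCorner m) :=
  hg.continuousOn.integrableOn_compact (isCompact_splitCorner m)

lemma setIntegral_splitCorner {m : ℕ} {g : EuclideanSpace ℝ (Fin m) × ℝ → ℝ}
    (hg : Continuous g) :
    ∫ z in splitCorner m, g z = ∫ y in corner m, ∫ t in (0)..(1 - ∑ i, y i), g (y, t) := by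
  have hS := (isCompact_splitCorner m).measurableSet
  have hint := (integrable_indicator_iff hS).2 (integrableOn_splitCorner hg)
  rw [← integral_indicator hS, Measure.volume_eq_prod, integral_prod _ hint,
    ← integral_indicator (isCompact_corner m).measurableSet]
  congr 1
  funext y
  by_cases hy : y ∈ corner m
  · rw [Set.indicator_of_mem hy, intervalIntegral.integral_of_le (by linarith [hy.2]),
      ← integral_Icc_eq_integral_Ioc, ← integral_indicator measurableSet_Icc]
    congr 1
    funext t
    by_cases ht : t ∈ Set.Icc 0 (1 - ∑ i, y i)
    · rw [Set.indicator_of_mem ht, Set.indicator_of_mem (show (y, t) ∈ splitCorner m from ⟨hy, ht⟩)]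
    · rw [Set.indicator_of_notMem ht,
        Set.indicator_of_notMem (show (y, t) ∉ splitCorner m from fun h => ht h.2)]
  · rw [Set.indicator_of_notMem hy]
    have : ∀ t, (splitCorner m).indicator g (y, t) = 0 := fun t =>
      Set.indicator_of_notMem (fun h => hy h.1) _
    simp [this]

/-- The fundamental theorem of calculus on the reference simplex. -/
lemma setIntegral_splitCorner_pderiv {m : ℕ} (p : MvPolynomial (Fin (m + 1)) ℝ) :
    ∫ z in splitCorner m, ev (MvPolynomial.pderiv 0 p) (consPoint z) =
      ∫ y in corner m, (ev p (consPoint (y, 1 - ∑ i, y i)) - ev p (consPoint (y, 0))) := by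
  have hc : ∀ q : MvPolynomial (Fin (m + 1)) ℝ, Continuous fun z => ev q (consPoint z) :=
    fun q => (continuous_ev q).comp continuous_consPoint
  rw [setIntegral_splitCorner (hc _)]
  congr 1
  funext y
  refine intervalIntegral.integral_eq_sub_of_hasDerivAt (f := fun t => ev p (consPoint (y, t)))
    (fun t _ => ?_) (Continuous.intervalIntegrable ?_ _ _)
  · have h := hasDerivAt_ev_line p (consPoint (y, 0)) (EuclideanSpace.single 0 1) t
    rw [PiLp.ofLp_single, dirDeriv_single] at h
    simpa only [← consPoint_eq_add] using h
  · exact (hc _).comp (by fun_prop)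

/-- The bilinear form `∫ p q` on polynomials, for the measure `ν` transported by `φ`. -/
def traceForm {n : ℕ} {Z : Type*} [MeasurableSpace Z] (ν : Measure Z)
    (φ : Z → EuclideanSpace ℝ (Fin n))
    (hφ : ∀ p : MvPolynomial (Fin n) ℝ, Integrable (fun z => ev p (φ z)) ν) :
    MvPolynomial (Fin n) ℝ →ₗ[ℝ] MvPolynomial (Fin n) ℝ →ₗ[ℝ] ℝ :=
  LinearMap.mk₂ ℝ (fun p q => ∫ z, ev (p * q) (φ z) ∂ν)
    (fun p p' q => by simp only [add_mul, ev_add]; exact integral_add (hφ _) (hφ _))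
    (fun a p q => by simp only [smul_mul_assoc, ev_smul, integral_const_mul, smul_eq_mul])
    (fun p q q' => by simp only [mul_add, ev_add]; exact integral_add (hφ _) (hφ _))
    (fun a p q => by simp only [mul_smul_comm, ev_smul, integral_const_mul, smul_eq_mul])

lemma traceForm_apply {n : ℕ} {Z : Type*} [MeasurableSpace Z] (ν : Measure Z)
    (φ : Z → EuclideanSpace ℝ (Fin n))
    (hφ : ∀ p : MvPolynomial (Fin n) ℝ, Integrable (fun z => ev p (φ z)) ν)
    (p q : MvPolynomial (Fin n) ℝ) :
    traceForm ν φ hφ p q = ∫ z, ev p (φ z) * ev q (φ z) ∂ν := by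
  simp [traceForm, ev_mul]

/-- The operator `x_i ∂_i` multiplies each monomial by its exponent of `x_i`, so it does not raise
the degree. It makes `x₀ ∂₀ u` an admissible test polynomial. -/
lemma X_mul_pderiv_mem {n k : ℕ} (i : Fin n) {p : MvPolynomial (Fin n) ℝ} (hp : p ∈ Pk n k) :
    MvPolynomial.X i * MvPolynomial.pderiv i p ∈ Pk n k := by
  rw [p.as_sum, map_sum, Finset.mul_sum]
  refine Submodule.sum_mem _ fun d hd => ?_
  rw [MvPolynomial.X_mul_pderiv_monomial]
  refine Submodule.smul_of_tower_mem _ _ ?_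
  rw [MvPolynomial.mem_restrictTotalDegree] at hp ⊢
  exact (MvPolynomial.totalDegree_monomial_le _ _).trans ((MvPolynomial.le_totalDegree hd).trans hp)

/-- A polynomial that vanishes on the bottom face of the reference simplex and is orthogonal to
`∂₀ P_k` is zero. -/
lemma eq_zero_of_orthogonal_pderiv {m k : ℕ} (u : Pk (m + 1) k)
    (hface : ∫ y in corner m, ev u.1 (consPoint (y, 0)) * ev u.1 (consPoint (y, 0)) = 0)
    (horth : ∀ G : Pk (m + 1) k, ∫ z in splitCorner m,
      ev u.1 (consPoint z) * ev (MvPolynomial.pderiv 0 G.1) (consPoint z) = 0) : u = 0 := by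
  have hcont : ∀ p : MvPolynomial (Fin (m + 1)) ℝ, Continuous fun z => ev p (consPoint z) :=
    fun p => (continuous_ev p).comp continuous_consPoint
  have hbc : ∀ p : MvPolynomial (Fin (m + 1)) ℝ, Continuous fun y => ev p (consPoint (y, 0)) :=
    fun p => (hcont p).comp (by fun_prop)
  have htc : ∀ p : MvPolynomial (Fin (m + 1)) ℝ,
      Continuous fun y => ev p (consPoint (y, 1 - ∑ i, y i)) :=
    fun p => (hcont p).comp (by fun_prop)
  have hcont₂ : ∀ p q : MvPolynomial (Fin (m + 1)) ℝ,
      Continuous fun z => ev p (consPoint z) * ev q (consPoint z) :=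
    fun p q => (hcont p).mul (hcont q)
  have hbc₂ : Continuous fun y => ev u.1 (consPoint (y, 0)) * ev u.1 (consPoint (y, 0)) :=
    (hbc _).mul (hbc _)
  have htc₂ : Continuous fun y => ev u.1 (consPoint (y, 1 - ∑ i, y i)) *
      ev u.1 (consPoint (y, 1 - ∑ i, y i)) := (htc _).mul (htc _)
  have hbot := eq_zero_of_setIntegral_sq_eq_zero hbc₂
    (integrableOn_corner hbc₂)
    (Filter.Eventually.of_forall fun _ => mul_self_nonneg _) hface
  -- Taking `G = u`, the integral of `∂₀(u²) = 2 u ∂₀u` vanishes; by the fundamental theorem it is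
  -- the difference of the integrals of `u²` over top and bottom, so `u` also vanishes on the top
  -- face.
  have htop : ∀ y ∈ interior (corner m), ev u.1 (consPoint (y, 1 - ∑ i, y i)) *
      ev u.1 (consPoint (y, 1 - ∑ i, y i)) = 0 := by
    refine eq_zero_of_setIntegral_sq_eq_zero htc₂
      (integrableOn_corner htc₂)
      (Filter.Eventually.of_forall fun _ => mul_self_nonneg _) ?_
    have h := setIntegral_splitCorner_pderiv (u.1 * u.1)
    simp only [ev_mul] at h
    rw [integral_sub (integrableOn_corner htc₂)
      (integrableOn_corner hbc₂), hface, sub_zero] at h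
    rw [← h]
    simp only [Derivation.leibniz, smul_eq_mul, ev_add, ev_mul]
    rw [integral_add (integrableOn_splitCorner (hcont₂ _ _))
      (integrableOn_splitCorner (hcont₂ _ _)), horth u, add_zero]
  have hD : ∀ x ∈ openCorner (m + 1), ev (MvPolynomial.pderiv 0 u.1) x = 0 := by
    -- For `G = x₀ ∂₀u` the integral of `∂₀(u G)` is zero, since `u` vanishes at both ends. As `∂₀(u
    -- G) = u ∂₀G + x₀ (∂₀u)²` and the first term integrates to zero, so does the nonnegative second
    -- one.
    let G : Pk (m + 1) k := ⟨_, X_mul_pderiv_mem 0 u.2⟩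
    have h := setIntegral_splitCorner_pderiv (u.1 * G.1)
    have hr : ∫ y in corner m, (ev (u.1 * G.1) (consPoint (y, 1 - ∑ i, y i)) -
        ev (u.1 * G.1) (consPoint (y, 0))) = 0 := by
      refine integral_eq_zero_of_ae ?_
      filter_upwards [ae_mem_interior_corner m] with y hy
      simp [ev_mul, mul_self_eq_zero.1 (htop y hy), mul_self_eq_zero.1 (hbot y hy)]
    rw [hr] at h
    set f := fun z => consPoint (m := m) z 0 * (ev (MvPolynomial.pderiv 0 u.1) (consPoint z) *
      ev (MvPolynomial.pderiv 0 u.1) (consPoint z)) with hf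
    have hfc : Continuous f :=
      continuous_snd.mul ((hcont _).mul (hcont _))
    have h0 : ∫ z in splitCorner m, f z = 0 := by
      rw [← h]
      have : ∀ z, ev (MvPolynomial.pderiv 0 (u.1 * G.1)) (consPoint z) =
          ev u.1 (consPoint z) * ev (MvPolynomial.pderiv 0 G.1) (consPoint z) + f z := by
        intro z
        simp only [Derivation.leibniz, smul_eq_mul, ev_add, ev_mul, hf, G, ev_X]
        ring
      simp only [this]
      rw [integral_add (integrableOn_splitCorner (hcont₂ _ _))
        (integrableOn_splitCorner hfc), horth G, zero_add]
    have hz := eq_zero_of_setIntegral_sq_eq_zero hfc (integrableOn_splitCorner hfc)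
      (by
        filter_upwards [ae_restrict_mem (isCompact_splitCorner m).measurableSet] with z hz
        exact mul_nonneg hz.2.1 (mul_self_nonneg _)) h0
    intro x hx
    have hxe : consPoint (WithLp.toLp 2 (Fin.tail x.ofLp), x 0) = x := by
      ext i; refine Fin.cases ?_ (fun j => ?_) i <;> simp [Fin.tail]
    rw [← hxe] at hx ⊢
    have h1 := hz _ (consPoint_mem_openCorner hx).1
    rcases mul_eq_zero.1 h1 with h1 | h1
    · exact absurd h1 (hx.1 0).ne'
    · exact mul_self_eq_zero.1 h1
  have hD0 := eq_zero_of_ev_eq_zero_on_open (isOpen_openCorner _) (openCorner_nonempty _) hD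
  refine Subtype.ext (eq_zero_of_ev_eq_zero_on_open (isOpen_openCorner _)
    (openCorner_nonempty _) fun x hx => ?_)
  have hxe : consPoint (WithLp.toLp 2 (Fin.tail x.ofLp), x 0) = x := by
    ext i; refine Fin.cases ?_ (fun j => ?_) i <;> simp [Fin.tail]
  rw [← hxe] at hx ⊢
  -- With `∂₀u = 0`, `u` is constant along the first coordinate and equals its value on the bottom
  -- face, which is zero.
  have hconst : ∀ y t, ev u.1 (consPoint (m := m) (y, t)) = ev u.1 (consPoint (y, 0)) := by
    intro y t
    have hd : ∀ t, HasDerivAt (fun t : ℝ => ev u.1 (consPoint (y, t))) 0 t := by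
      intro t
      have h := hasDerivAt_ev_line u.1 (consPoint (y, 0)) (EuclideanSpace.single 0 1) t
      rw [PiLp.ofLp_single, dirDeriv_single, hD0, ev_zero] at h
      simpa only [← consPoint_eq_add] using h
    exact is_const_of_deriv_eq_zero (fun t => (hd t).differentiableAt) (fun t => (hd t).deriv) t 0
  rw [hconst]
  exact mul_self_eq_zero.1 (hbot _ (consPoint_mem_openCorner hx).2)

/-- A polynomial is controlled on the reference simplex by its trace on the bottom face and by its
products with `∂₀ P_k`. -/
lemma exists_reference_bound (m k : ℕ) : ∃ C : ℝ, 0 < C ∧ ∀ (u : Pk (m + 1) k) (M : ℝ), 0 ≤ M →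
    (∀ G : Pk (m + 1) k, (∫ z in splitCorner m,
      ev u.1 (consPoint z) * ev (MvPolynomial.pderiv 0 G.1) (consPoint z)) ^ 2 ≤
        M * ∫ z in splitCorner m, ev G.1 (consPoint z) ^ 2) →
    ∫ z in splitCorner m, ev u.1 (consPoint z) ^ 2 ≤
      C * (M + ∫ y in corner m, ev u.1 (consPoint (y, 0)) ^ 2) := by
  have hTi : ∀ p : MvPolynomial (Fin (m + 1)) ℝ,
      Integrable (fun z => ev p (consPoint z)) (volume.restrict (splitCorner m)) := fun p =>
    integrableOn_splitCorner ((continuous_ev p).comp continuous_consPoint)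
  have hSi : ∀ p : MvPolynomial (Fin (m + 1)) ℝ,
      Integrable (fun y => ev p (consPoint (y, 0))) (volume.restrict (corner m)) := fun p =>
    integrableOn_corner (((continuous_ev p).comp continuous_consPoint).comp (by fun_prop))
  let T := traceForm _ _ hTi
  let S := traceForm _ _ hSi
  let b := Module.finBasis ℝ (Pk (m + 1) k)
  let ℓ : Pk (m + 1) k → Pk (m + 1) k →ₗ[ℝ] ℝ := fun G =>
    T.flip (MvPolynomial.pderiv 0 G.1) ∘ₗ (Pk (m + 1) k).subtype
  -- Finitely many functionals suffice: orthogonality to `∂₀` of a basis of `P_k` is orthogonality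
  -- to `∂₀ P_k`.
  let B₂ : Pk (m + 1) k →ₗ[ℝ] Pk (m + 1) k →ₗ[ℝ] ℝ :=
    ∑ j, (ℓ (b j)).smulRight (ℓ (b j)) + S.domRestrict₁₂ (Pk (m + 1) k) (Pk (m + 1) k)
  have hℓ : ∀ G u, ℓ G u = ∫ z in splitCorner m,
      ev u.1 (consPoint z) * ev (MvPolynomial.pderiv 0 G.1) (consPoint z) :=
    fun G u => traceForm_apply _ _ hTi u.1 (MvPolynomial.pderiv 0 G.1)
  have hS : ∀ u : Pk (m + 1) k, S.domRestrict₁₂ (Pk (m + 1) k) (Pk (m + 1) k) u u =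
      ∫ y in corner m, ev u.1 (consPoint (y, 0)) * ev u.1 (consPoint (y, 0)) :=
    fun u => traceForm_apply _ _ hSi u.1 u.1
  have hB₂ : ∀ u, B₂ u u = ∑ j, ℓ (b j) u ^ 2 +
      ∫ y in corner m, ev u.1 (consPoint (y, 0)) * ev u.1 (consPoint (y, 0)) := by
    intro u
    rw [← hS]
    simp [B₂, pow_two]
  obtain ⟨C, hC, hbound⟩ := exists_bound_of_posDef
    (T.domRestrict₁₂ (Pk (m + 1) k) (Pk (m + 1) k)) B₂ (by
    intro u hu
    rw [hB₂]
    have h1 : 0 ≤ ∑ j, ℓ (b j) u ^ 2 := Finset.sum_nonneg fun _ _ => sq_nonneg _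
    have h2 : 0 ≤ ∫ y in corner m, ev u.1 (consPoint (y, 0)) * ev u.1 (consPoint (y, 0)) :=
      integral_nonneg fun _ => mul_self_nonneg _
    by_contra hneg
    refine hu (eq_zero_of_orthogonal_pderiv u (by linarith) fun G => ?_)
    have h3 : ∀ j, ℓ (b j) u = 0 := fun j => by
      have h4 : ∑ j, ℓ (b j) u ^ 2 = 0 := by linarith
      exact pow_eq_zero_iff two_ne_zero |>.1
        ((Finset.sum_eq_zero_iff_of_nonneg fun _ _ => sq_nonneg _).1 h4 j (Finset.mem_univ j))
    let ℓ' : Pk (m + 1) k →ₗ[ℝ] ℝ :=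
      T u.1 ∘ₗ (MvPolynomial.pderiv 0).toLinearMap ∘ₗ (Pk (m + 1) k).subtype
    have h5 : ℓ' = 0 := b.ext fun j => h3 j
    have h6 : ℓ' G = 0 := by rw [h5]; rfl
    rw [← h6]
    exact (traceForm_apply _ _ hTi u.1 (MvPolynomial.pderiv 0 G.1)).symm)
  -- The hypothesis at the basis polynomials bounds the sum of the squared functionals by `M * R`;
  -- `R` depends on the basis alone.
  set R := ∑ j, ∫ z in splitCorner m, ev (b j).1 (consPoint z) ^ 2 with hR
  have hR0 : 0 ≤ R := Finset.sum_nonneg fun j _ => integral_nonneg fun _ => sq_nonneg _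
  refine ⟨C * (1 + R), by positivity, fun u M hM hu => ?_⟩
  have h1 := hbound u
  rw [hB₂] at h1
  have h2 : T.domRestrict₁₂ (Pk (m + 1) k) (Pk (m + 1) k) u u =
      ∫ z in splitCorner m, ev u.1 (consPoint z) ^ 2 := by
    simp only [pow_two]
    exact traceForm_apply _ _ hTi u.1 u.1
  have h3 : ∑ j, ℓ (b j) u ^ 2 ≤ M * R := by
    rw [hR, Finset.mul_sum]
    refine Finset.sum_le_sum fun j _ => ?_
    rw [hℓ]
    exact hu (b j)
  rw [h2] at h1
  simp only [← pow_two] at h1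
  have h4 : 0 ≤ ∫ y in corner m, ev u.1 (consPoint (y, 0)) ^ 2 :=
    integral_nonneg fun _ => sq_nonneg _
  refine h1.trans ?_
  rw [mul_assoc]
  refine mul_le_mul_of_nonneg_left ?_ hC.le
  nlinarith [mul_nonneg hR0 h4]

/-! ### Affine parametrizations and integrals -/

/-- Integrals over a piece of an affine subspace, in an affine parametrization. -/
lemma setIntegral_euclideanHausdorff_affine {m n : ℕ} (b : EuclideanSpace ℝ (Fin n))
    (L : EuclideanSpace ℝ (Fin m) →ₗ[ℝ] EuclideanSpace ℝ (Fin n)) (hL : L.ker = ⊥)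
    {s : Set (EuclideanSpace ℝ (Fin n))}
    (hsr : s ⊆ Set.range fun y => b + L y) (f : EuclideanSpace ℝ (Fin n) → ℝ) :
    ∫ x in s, f x ∂μHE[m] = L.normDet * ∫ y in (fun y => b + L y) ⁻¹' s, f (b + L y) := by
  have hemb : MeasurableEmbedding fun y => b + L y :=
    ((Homeomorph.addLeft b).isClosedEmbedding.comp
      (LinearMap.isClosedEmbedding_of_injective hL)).measurableEmbedding
  have hmeas : (μHE[m] : Measure (EuclideanSpace ℝ (Fin n))).restrict s =
      ENNReal.ofReal L.normDet • (volume.map fun y => b + L y).restrict s := by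
    ext t ht
    rw [Measure.smul_apply, Measure.restrict_apply ht, Measure.restrict_apply ht,
      hemb.map_apply, smul_eq_mul]
    have h1 := L.euclideanHausdorffMeasure_image_eq_normDet_mul_volume
      ((fun y => b + L y) ⁻¹' (t ∩ s))
    rw [finrank_euclideanSpace_fin] at h1
    rw [← h1, ← (IsometryEquiv.addLeft b).isometry.euclideanHausdorffMeasure_image (L '' _),
      Set.image_image]
    congr 1
    refine (Set.image_preimage_eq_of_subset ?_).symm
    exact Set.inter_subset_right.trans hsr
  rw [hmeas, integral_smul_measure, hemb.setIntegral_map, ENNReal.toReal_ofReal L.normDet_nonneg,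
    smul_eq_mul]

/-- The volume measure in affine coordinates adapted to a hyperplane. -/
lemma volume_eq_smul_map_affine {m : ℕ} (b e N : EuclideanSpace ℝ (Fin (m + 1)))
    (L : EuclideanSpace ℝ (Fin m) →ₗ[ℝ] EuclideanSpace ℝ (Fin (m + 1))) (hL : L.ker = ⊥)
    (hN : ‖N‖ = 1) (hperp : ∀ y, inner ℝ N (L y) = 0) (he : inner ℝ N e ≠ 0)
    (hemb : MeasurableEmbedding fun z : EuclideanSpace ℝ (Fin m) × ℝ => b + (L z.1 + z.2 • e)) :
    (volume : Measure (EuclideanSpace ℝ (Fin (m + 1)))) =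
      ENNReal.ofReal (L.normDet * |inner ℝ N e|) •
        (volume.map fun z : EuclideanSpace ℝ (Fin m) × ℝ => b + (L z.1 + z.2 • e)) := by
  set h := inner ℝ N e with hh
  have hN0 : N ≠ 0 := by rintro rfl; simp at hN
  -- The range of `L` lies in the hyperplane orthogonal to `N` and has the same dimension, so it is
  -- the whole hyperplane.
  have hrange : ∀ x, inner ℝ N x = 0 → ∃ y, L y = x := by
    have hle : L.range ≤ (ℝ ∙ N)ᗮ := by
      rintro _ ⟨y, rfl⟩
      exact Submodule.mem_orthogonal_singleton_iff_inner_right.2 (hperp y)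
    have h1 : Module.finrank ℝ (ℝ ∙ N)ᗮ = m := by
      have h2 := Submodule.finrank_add_finrank_orthogonal (ℝ ∙ N)
      rw [finrank_span_singleton hN0, finrank_euclideanSpace_fin] at h2
      omega
    have h3 := Submodule.eq_of_le_of_finrank_eq hle (by
      rw [h1, LinearMap.finrank_range_of_inj (LinearMap.ker_eq_bot.1 hL),
        finrank_euclideanSpace_fin])
    intro x hx
    have : x ∈ L.range := by
      rw [h3]
      exact Submodule.mem_orthogonal_singleton_iff_inner_right.2 hx
    exact this
  ext t ht
  rw [Measure.smul_apply, hemb.map_apply, Measure.volume_eq_prod,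
    Measure.prod_apply_symm (hemb.measurable ht), smul_eq_mul,
    ENNReal.ofReal_mul L.normDet_nonneg]
  -- Volume is the integral, along the normal line, of the measures of the hyperplane slices. With
  -- the normal coordinate written as `h * r`, which produces the factor `|h|`, the slice is a
  -- translate by `b + r • e` of a piece of the range of `L`, and its measure carries the factor
  -- `L.normDet`.
  have h1 := EuclideanGeometry.euclideanHausdorffMeasure_eq_lintegral b hN0 ht
  rw [InnerProductSpace.euclideanHausdorffMeasure_eq_volume, finrank_euclideanSpace_fin,
    Nat.add_sub_cancel, enorm_eq_iff_norm_eq (y := (1 : ℝ)) |>.2 (by simpa using hN), enorm_one,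
    one_mul, ← Real.smul_map_volume_mul_left he, lintegral_smul_measure,
    show (fun x : ℝ => h * x) = MeasurableEquiv.mulLeft₀ h he from rfl,
    lintegral_map_equiv, smul_eq_mul] at h1
  rw [h1, mul_comm (ENNReal.ofReal L.normDet), mul_assoc]
  congr 1
  rw [← lintegral_const_mul' _ _ ENNReal.ofReal_ne_top]
  refine lintegral_congr fun r => ?_
  have h2 := L.euclideanHausdorffMeasure_image_eq_normDet_mul_volume
    ((fun y => (y, r)) ⁻¹' ((fun z : EuclideanSpace ℝ (Fin m) × ℝ => b + (L z.1 + z.2 • e)) ⁻¹' t))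
  rw [finrank_euclideanSpace_fin] at h2
  rw [← h2, ← (IsometryEquiv.addLeft (b + r • e)).isometry.euclideanHausdorffMeasure_image
      (L '' _),
    Set.image_image]
  congr 1
  ext x
  simp only [MeasurableEquiv.coe_mulLeft₀, Set.mem_inter_iff, SetLike.mem_coe,
    AffineSubspace.mem_mk', vadd_eq_add, vsub_eq_sub, Set.mem_image, Set.mem_preimage,
    Submodule.mem_orthogonal_singleton_iff_inner_right, IsometryEquiv.addLeft_apply]
  have hNN : inner ℝ N N = 1 := by rw [real_inner_self_eq_norm_sq, hN, one_pow]
  constructor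
  · rintro ⟨hx, hx2⟩
    obtain ⟨y, hy⟩ := hrange (x - (b + r • e)) (by
      simp only [inner_sub_right, inner_add_right, inner_smul_right, hNN, ← hh] at hx2 ⊢
      linarith)
    refine ⟨y, ?_, by rw [hy]; abel⟩
    have : b + (L y + r • e) = x := by rw [hy]; abel
    rwa [this]
  · rintro ⟨y, hy, rfl⟩
    refine ⟨by convert hy using 1; abel, ?_⟩
    simp only [inner_sub_right, inner_add_right, inner_smul_right, hNN, ← hh, hperp]
    ring

/-! ### Barycentric charts of simplices -/

/-- The affine chart of the simplex with vertices `p`, based at the vertex `p 0`. -/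
def chart {N : ℕ} {V : Type*} [AddCommGroup V] [Module ℝ V] (p : Fin (N + 1) → V)
    (z : Fin N → ℝ) : V := p 0 + ∑ i, z i • (p i.succ - p 0)

lemma chart_eq_sum {N : ℕ} {V : Type*} [AddCommGroup V] [Module ℝ V] (p : Fin (N + 1) → V)
    (z : Fin N → ℝ) : chart p z = (1 - ∑ i, z i) • p 0 + ∑ i : Fin N, z i • p i.succ := by
  simp only [chart, smul_sub, Finset.sum_sub_distrib, ← Finset.sum_smul, sub_smul, one_smul]
  abel

lemma linearIndependent_edges {N : ℕ} {V : Type*} [AddCommGroup V] [Module ℝ V]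
    {p : Fin (N + 1) → V} (hp : AffineIndependent ℝ p) :
    LinearIndependent ℝ fun i : Fin N => p i.succ - p 0 := by
  have h := (affineIndependent_iff_linearIndependent_vsub ℝ p 0).1 hp
  exact h.comp (fun i : Fin N => (⟨i.succ, Fin.succ_ne_zero i⟩ : {x : Fin (N + 1) // x ≠ 0}))
    fun i j hij => Fin.succ_injective _ (congrArg Subtype.val hij)

lemma chart_injective {N : ℕ} {V : Type*} [AddCommGroup V] [Module ℝ V] {p : Fin (N + 1) → V}
    (hp : AffineIndependent ℝ p) : Function.Injective (chart p) := fun _ _ h =>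
  (linearIndependent_edges hp).fintypeLinearCombination_injective (add_left_cancel h)

/-- The chart image of the reference simplex is convex and contains the vertices, hence the hull;
injectivity of the chart identifies the parameter. Conversely the barycentric coordinates `1 - ∑ z
i` and `z i` exhibit a convex combination. -/
lemma chart_mem_convexHull {N : ℕ} {V : Type*} [AddCommGroup V] [Module ℝ V]
    {p : Fin (N + 1) → V} (hp : AffineIndependent ℝ p) (z : Fin N → ℝ) :
    chart p z ∈ convexHull ℝ (Set.range p) ↔ (∀ i, 0 ≤ z i) ∧ ∑ i, z i ≤ 1 := by
  have hmem : ∀ i, p i ∈ convexHull ℝ (Set.range p) := fun i =>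
    subset_convexHull ℝ _ (Set.mem_range_self i)
  constructor
  · intro h
    have key : convexHull ℝ (Set.range p) ⊆
        chart p '' {z | (∀ i, 0 ≤ z i) ∧ ∑ i, z i ≤ 1} := by
      refine convexHull_min ?_ ?_
      · rintro _ ⟨i, rfl⟩
        refine Fin.cases ⟨0, by simp, by simp [chart]⟩ (fun j => ?_) i
        refine ⟨Pi.single j 1, ⟨fun i => ?_, by simp⟩, by simp [chart, Pi.single_apply]⟩
        by_cases hij : i = j <;> simp [hij]
      · rintro _ ⟨x, hx, rfl⟩ _ ⟨y, hy, rfl⟩ a b ha hb hab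
        refine ⟨a • x + b • y, ⟨fun i => ?_, ?_⟩, ?_⟩
        · have := mul_nonneg ha (hx.1 i)
          have := mul_nonneg hb (hy.1 i)
          simp only [Pi.add_apply, Pi.smul_apply, smul_eq_mul]
          linarith
        · simp only [Pi.add_apply, Pi.smul_apply, smul_eq_mul, Finset.sum_add_distrib,
            ← Finset.mul_sum]
          nlinarith [mul_le_mul_of_nonneg_left hx.2 ha, mul_le_mul_of_nonneg_left hy.2 hb]
        · have h0 : p 0 = a • p 0 + b • p 0 := by rw [← add_smul, hab, one_smul]
          simp only [chart, smul_add, Finset.smul_sum, Pi.add_apply, Pi.smul_apply, add_smul,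
            Finset.sum_add_distrib, smul_eq_mul, mul_smul]
          nth_rewrite 1 [h0]
          abel
    obtain ⟨w, hw, hwz⟩ := key h
    rwa [← chart_injective hp hwz]
  · rintro ⟨h0, h1⟩
    rw [chart_eq_sum]
    have h := (convex_convexHull ℝ (Set.range p)).sum_mem (t := Finset.univ)
      (w := Fin.cons (1 - ∑ i, z i) z) (z := p) (fun i _ => ?_) ?_ fun i _ => hmem i
    · simpa [Fin.sum_univ_succ] using h
    · refine Fin.cases ?_ (fun j => ?_) i
      · simpa using h1
      · simpa using h0 j
    · simp [Fin.sum_univ_succ]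

lemma convexHull_subset_range_chart {N : ℕ} {V : Type*} [AddCommGroup V] [Module ℝ V]
    (p : Fin (N + 1) → V) : convexHull ℝ (Set.range p) ⊆ Set.range (chart p) := by
  refine convexHull_min ?_ ?_
  · rintro _ ⟨i, rfl⟩
    refine Fin.cases ⟨0, by simp [chart]⟩ (fun j => ?_) i
    exact ⟨Pi.single j 1, by simp [chart, Pi.single_apply]⟩
  · rintro _ ⟨x, rfl⟩ _ ⟨y, rfl⟩ a b _ _ hab
    refine ⟨a • x + b • y, ?_⟩
    have h0 : p 0 = a • p 0 + b • p 0 := by rw [← add_smul, hab, one_smul]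
    simp only [chart, smul_add, Finset.smul_sum, Pi.add_apply, Pi.smul_apply, add_smul,
      Finset.sum_add_distrib, smul_eq_mul, mul_smul]
    nth_rewrite 1 [h0]
    abel

/-- Integrals over a simplex with vertices `p` and over its face opposite `p 1`, in the chart
of the simplex: the two Jacobians differ by the height of `p 1`. -/
lemma exists_chart_integrals {m : ℕ} {p : Fin (m + 2) → EuclideanSpace ℝ (Fin (m + 1))}
    (hp : AffineIndependent ℝ p) (N : EuclideanSpace ℝ (Fin (m + 1))) (hN : ‖N‖ = 1)
    (hperp : ∀ j : Fin m, inner ℝ N (p j.succ.succ - p 0) = 0)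
    (hne : inner ℝ N (p 1 - p 0) ≠ 0) :
    ∃ J : ℝ, 0 < J ∧
      (∀ f : EuclideanSpace ℝ (Fin (m + 1)) → ℝ,
        ∫ x in convexHull ℝ (Set.range (p ∘ Fin.succAbove 1)), f x ∂μHE[m] =
          J * ∫ y in corner m, f (chart p (consPoint (y, 0)))) ∧
      (∀ f : EuclideanSpace ℝ (Fin (m + 1)) → ℝ,
        ∫ x in convexHull ℝ (Set.range p), f x =
          J * |inner ℝ N (p 1 - p 0)| * ∫ z in splitCorner m, f (chart p (consPoint z))) := by
  have hind := linearIndependent_edges hp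
  let L : EuclideanSpace ℝ (Fin m) →ₗ[ℝ] EuclideanSpace ℝ (Fin (m + 1)) :=
    Fintype.linearCombination ℝ (fun j : Fin m => p j.succ.succ - p 0) ∘ₗ
      (WithLp.linearEquiv 2 ℝ (Fin m → ℝ)).toLinearMap
  have hLapp : ∀ y, L y = ∑ j, y j • (p j.succ.succ - p 0) := fun y => by
    simp [L, Fintype.linearCombination_apply]
  have hchart : ∀ z : EuclideanSpace ℝ (Fin m) × ℝ,
      chart p (consPoint z) = p 0 + (L z.1 + z.2 • (p 1 - p 0)) := fun z => by
    rw [chart, Fin.sum_univ_succ, hLapp, add_comm (∑ j, _)]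
    rfl
  have hface : ∀ y : EuclideanSpace ℝ (Fin m),
      chart p (consPoint (y, 0)) = chart (p ∘ Fin.succAbove 1) y := fun y => by
    rw [hchart, hLapp, chart, zero_smul, add_zero]
    rfl
  have hL : L.ker = ⊥ := by
    have h : LinearIndependent ℝ fun j : Fin m => p j.succ.succ - p 0 :=
      hind.comp Fin.succ (Fin.succ_injective _)
    rw [LinearMap.ker_eq_bot]
    exact h.fintypeLinearCombination_injective.comp (WithLp.linearEquiv 2 ℝ (Fin m → ℝ)).injective
  have hq : AffineIndependent ℝ (p ∘ Fin.succAbove 1) :=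
    hp.comp_embedding (Fin.succAboveEmb 1)
  -- The common factor is the Jacobian of the parametrization of the face; it is nonzero because the
  -- edges of the face are independent.
  refine ⟨L.normDet, lt_of_le_of_ne L.normDet_nonneg fun h =>
    LinearMap.normDet_eq_zero_iff_ker_ne_bot.1 h.symm hL, fun f => ?_, fun f => ?_⟩
  · rw [setIntegral_euclideanHausdorff_affine (p 0) L hL]
    · have hpre : (fun y => p 0 + L y) ⁻¹' convexHull ℝ (Set.range (p ∘ Fin.succAbove 1)) =
          corner m := by
        ext y
        have h := chart_mem_convexHull hq y.ofLp
        rw [← hface, hchart, zero_smul, add_zero] at h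
        exact h
      rw [hpre]
      simp only [hchart, zero_smul, add_zero]
    · intro x hx
      obtain ⟨y, hy⟩ := convexHull_subset_range_chart _ hx
      refine ⟨WithLp.toLp 2 y, ?_⟩
      have h := hface (WithLp.toLp 2 y)
      rw [hchart, zero_smul, add_zero] at h
      exact h.trans hy
  · let Λ : EuclideanSpace ℝ (Fin m) × ℝ →ₗ[ℝ] EuclideanSpace ℝ (Fin (m + 1)) :=
      L.coprod (LinearMap.toSpanSingleton ℝ _ (p 1 - p 0))
    have hΛ : ∀ z, Λ z = L z.1 + z.2 • (p 1 - p 0) := fun z => by simp [Λ]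
    have hker : Λ.ker = ⊥ := by
      rw [LinearMap.ker_eq_bot]
      intro z w hzw
      have h1 : chart p (consPoint z) = chart p (consPoint w) := by
        rw [hchart, hchart, ← hΛ, ← hΛ, hzw]
      have h2 := chart_injective hp h1
      refine Prod.ext ?_ (congrFun h2 0)
      ext j
      exact congrFun h2 j.succ
    have hemb : MeasurableEmbedding fun z : EuclideanSpace ℝ (Fin m) × ℝ =>
        p 0 + (L z.1 + z.2 • (p 1 - p 0)) := by
      simp only [← hΛ]
      exact ((Homeomorph.addLeft (p 0)).isClosedEmbedding.comp
        (LinearMap.isClosedEmbedding_of_injective hker)).measurableEmbedding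
    rw [volume_eq_smul_map_affine (p 0) (p 1 - p 0) N L hL hN (fun y => by
        rw [hLapp, inner_sum]
        exact Finset.sum_eq_zero fun j _ => by rw [inner_smul_right, hperp, mul_zero]) hne hemb,
      Measure.restrict_smul, integral_smul_measure, hemb.setIntegral_map,
      ENNReal.toReal_ofReal (mul_nonneg L.normDet_nonneg (abs_nonneg _)), smul_eq_mul]
    simp only [← hchart]
    have hpre : (fun z : EuclideanSpace ℝ (Fin m) × ℝ => chart p (consPoint z)) ⁻¹'
        convexHull ℝ (Set.range p) = splitCorner m := by
      ext z
      rw [Set.mem_preimage, chart_mem_convexHull hp, Fin.sum_univ_succ]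
      constructor
      · rintro ⟨h0, h1⟩
        have h2 : z.2 + ∑ i, z.1 i ≤ 1 := h1
        have h3 : 0 ≤ z.2 := h0 0
        exact ⟨⟨fun i => h0 i.succ, by linarith⟩, h3, by linarith⟩
      · rintro ⟨h0, h1, h2⟩
        refine ⟨fun i => Fin.cases h1 (fun j => h0.1 j) i, ?_⟩
        have h3 : z.2 + ∑ i, z.1 i ≤ 1 := by linarith
        exact h3
    rw [hpre]

/-! ### Elements, faces and normals -/

section Geometry

variable {m : ℕ} {Ω : Set (EuclideanSpace ℝ (Fin (m + 1)))} {T : Mesh Ω}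

open Classical in
/-- The face of `K` opposite the vertex `a`. -/
def Mesh.Elem.oppFace (K : T.Elem) (a : EuclideanSpace ℝ (Fin (m + 1))) (ha : a ∈ K.1) :
    T.Face :=
  ⟨K.1.erase a, T.complex.down_closed K.2.1 (Finset.erase_subset _ _)
    (Finset.card_pos.1 (by rw [Finset.card_erase_of_mem ha, K.2.2]; omega)),
    by rw [Finset.card_erase_of_mem ha, K.2.2, Nat.add_sub_cancel]⟩

open Classical in
lemma Mesh.Elem.oppFace_val (K : T.Elem) {a : EuclideanSpace ℝ (Fin (m + 1))} (ha : a ∈ K.1) :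
    (K.oppFace a ha).1 = K.1.erase a := rfl

lemma Mesh.Elem.mem_oppFace (K : T.Elem) {a b : EuclideanSpace ℝ (Fin (m + 1))} (ha : a ∈ K.1) :
    b ∈ (K.oppFace a ha).1 ↔ b ≠ a ∧ b ∈ K.1 := by
  classical
  rw [Mesh.Elem.oppFace_val, Finset.mem_erase]

lemma Mesh.Elem.mem_faces (K : T.Elem) (F : T.Face) : F ∈ K.faces ↔ F.1 ⊆ K.1 := by
  simp [Mesh.Elem.faces]

lemma Mesh.Elem.oppFace_mem_faces (K : T.Elem) {a : EuclideanSpace ℝ (Fin (m + 1))}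
    (ha : a ∈ K.1) : K.oppFace a ha ∈ K.faces :=
  (K.mem_faces _).2 fun _ hb => ((K.mem_oppFace ha).1 hb).2

lemma Mesh.Elem.exists_eq_oppFace (K : T.Elem) {F : T.Face} (hF : F ∈ K.faces) :
    ∃ a, ∃ ha : a ∈ K.1, F = K.oppFace a ha := by
  classical
  have hsub := (K.mem_faces F).1 hF
  obtain ⟨a, ha, haF⟩ := Finset.exists_of_ssubset (Finset.ssubset_iff_subset_ne.2 ⟨hsub, fun h => by
    have h1 := F.2.2
    rw [h, K.2.2] at h1
    omega⟩)
  refine ⟨a, ha, Subtype.ext (Finset.eq_of_subset_of_card_le (fun b hb => ?_) ?_)⟩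
  · exact (K.mem_oppFace ha).2 ⟨fun h => haF (h ▸ hb), hsub hb⟩
  · rw [F.2.2, (K.oppFace a ha).2.2]

lemma Mesh.Elem.exists_vertex_ne (K : T.Elem) (a : EuclideanSpace ℝ (Fin (m + 1))) :
    ∃ b ∈ K.1, b ≠ a :=
  Finset.exists_mem_ne (by rw [K.2.2]; omega) a

/-- The vertices of an element, ordered with two prescribed first vertices. -/
lemma Mesh.Elem.exists_ordering (K : T.Elem) {a b : EuclideanSpace ℝ (Fin (m + 1))}
    (ha : a ∈ K.1) (hb : b ∈ K.1) (hab : b ≠ a) :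
    ∃ p : Fin (m + 2) → EuclideanSpace ℝ (Fin (m + 1)), AffineIndependent ℝ p ∧
      Set.range p = (K.1 : Set (EuclideanSpace ℝ (Fin (m + 1)))) ∧ p 0 = b ∧ p 1 = a := by
  classical
  -- Any enumeration is corrected by two transpositions, the first bringing `b` to position `0`, the
  -- second `a` to position `1`; the second leaves `b` in place because `b ≠ a`.
  let e₀ : Fin (m + 2) ≃ K.1 := (K.1.equivFinOfCardEq K.2.2).symm
  let e₁ : Fin (m + 2) ≃ K.1 := e₀.trans (Equiv.swap (e₀ 0) ⟨b, hb⟩)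
  have h1 : e₁ 0 = ⟨b, hb⟩ := by simp [e₁]
  let e : Fin (m + 2) ≃ K.1 := e₁.trans (Equiv.swap (e₁ 1) ⟨a, ha⟩)
  have h2 : e 1 = ⟨a, ha⟩ := by simp [e]
  have h3 : e 0 = ⟨b, hb⟩ := by
    simp only [e, Equiv.trans_apply, h1]
    refine Equiv.swap_apply_of_ne_of_ne ?_ (fun h => hab (congrArg Subtype.val h))
    rw [← h1]
    exact e₁.injective.ne (by simp)
  refine ⟨fun i => (e i).1, (T.complex.indep K.2.1).comp_embedding e.toEmbedding, ?_, ?_, ?_⟩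
  · ext x
    constructor
    · rintro ⟨i, rfl⟩
      exact (e i).2
    · intro hx
      exact ⟨e.symm ⟨x, hx⟩, by simp⟩
  · simp [h3]
  · simp [h2]

lemma Mesh.Elem.range_comp_succAbove (K : T.Elem)
    {p : Fin (m + 2) → EuclideanSpace ℝ (Fin (m + 1))} (hp : AffineIndependent ℝ p)
    (hr : Set.range p = (K.1 : Set (EuclideanSpace ℝ (Fin (m + 1))))) (i : Fin (m + 2))
    (hi : p i ∈ K.1) :
    Set.range (p ∘ Fin.succAbove i) =
      ((K.oppFace (p i) hi).1 : Set (EuclideanSpace ℝ (Fin (m + 1)))) := by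
  classical
  rw [Set.range_comp, Fin.range_succAbove, Set.image_compl_eq_range_sdiff_image hp.injective, hr,
    Set.image_singleton, Mesh.Elem.oppFace_val, Finset.coe_erase]

/-- The vector from a vertex to a point of the opposite face, projected to the normal direction. -/
lemma Mesh.Elem.normal_oppFace (K : T.Elem) {a x : EuclideanSpace ℝ (Fin (m + 1))} (ha : a ∈ K.1)
    (hx : x ∈ (K.oppFace a ha).1) :
    K.normal (K.oppFace a ha) = NormedSpace.normalize
      ((vectorSpan ℝ ((K.oppFace a ha).1 : Set (EuclideanSpace ℝ (Fin (m + 1)))))ᗮ.starProjection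
        (x - a)) := by
  classical
  set F := K.oppFace a ha with hF
  set V := vectorSpan ℝ (F.1 : Set (EuclideanSpace ℝ (Fin (m + 1)))) with hV
  -- The projection kills the directions of the face, so all its vertices have the same image.
  have hP : ∀ y ∈ F.1, Vᗮ.starProjection y = Vᗮ.starProjection x := by
    intro y hy
    rw [← sub_eq_zero, ← map_sub]
    refine (Submodule.starProjection_apply_eq_zero_iff _).2 ?_
    rw [Submodule.orthogonal_orthogonal]
    exact vsub_mem_vectorSpan ℝ hy hx
  have hcF : F.1.centroid ℝ id = ((m : ℝ) + 1)⁻¹ • ∑ y ∈ F.1, y := by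
    rw [Finset.centroid_eq_centerMass _ ⟨x, hx⟩, Finset.centerMass,
      Finset.sum_centroidWeights_eq_one_of_nonempty ℝ _ ⟨x, hx⟩]
    simp [Finset.centroidWeights, F.2.2, Finset.smul_sum]
  have hcK : K.1.centroid ℝ id = ((m : ℝ) + 1 + 1)⁻¹ • (a + ∑ y ∈ F.1, y) := by
    have h : a + ∑ y ∈ F.1, y = ∑ y ∈ K.1, y := Finset.add_sum_erase K.1 (fun y => y) ha
    rw [Finset.centroid_eq_centerMass _ ⟨a, ha⟩, Finset.centerMass,
      Finset.sum_centroidWeights_eq_one_of_nonempty ℝ _ ⟨a, ha⟩, h]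
    simp [Finset.centroidWeights, K.2.2, Finset.smul_sum]
  have hsum : Vᗮ.starProjection (∑ y ∈ F.1, y) = ((m : ℝ) + 1) • Vᗮ.starProjection x := by
    rw [map_sum, Finset.sum_congr rfl hP, Finset.sum_const, F.2.2, ← Nat.cast_smul_eq_nsmul ℝ]
    push_cast
    rfl
  have hm : (0 : ℝ) < (m : ℝ) + 1 := by positivity
  have hm' : (0 : ℝ) < (m : ℝ) + 1 + 1 := by positivity
  -- The images of the two centroids are `P x` and `(P a + (m + 1) P x) / (m + 2)`; their difference
  -- is a positive multiple of `P (x - a)`, which normalization does not see.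
  have key : Vᗮ.starProjection (F.1.centroid ℝ id - K.1.centroid ℝ id) =
      ((m : ℝ) + 1 + 1)⁻¹ • Vᗮ.starProjection (x - a) := by
    rw [hcF, hcK, map_sub, map_smul, map_smul, map_add, hsum, smul_smul,
      inv_mul_cancel₀ hm.ne', one_smul, map_sub, smul_sub, smul_add, smul_smul]
    have : Vᗮ.starProjection x = (((m : ℝ) + 1 + 1)⁻¹ + ((m : ℝ) + 1 + 1)⁻¹ * ((m : ℝ) + 1)) •
        Vᗮ.starProjection x := by
      rw [show ((m : ℝ) + 1 + 1)⁻¹ + ((m : ℝ) + 1 + 1)⁻¹ * ((m : ℝ) + 1) = 1 by field_simp; ring,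
        one_smul]
    nth_rewrite 1 [this]
    rw [add_smul]
    abel
  rw [Mesh.Elem.normal, key, NormedSpace.normalize_smul_of_pos (inv_pos.2 hm')]

lemma Mesh.Elem.notMem_affineSpan_oppFace (K : T.Elem) {a : EuclideanSpace ℝ (Fin (m + 1))}
    (ha : a ∈ K.1) : a ∉ affineSpan ℝ
      ((K.oppFace a ha).1 : Set (EuclideanSpace ℝ (Fin (m + 1)))) := by
  have h1 := (T.complex.indep K.2.1).notMem_affineSpan_sdiff ⟨a, ha⟩ Set.univ
  have h2 : (Subtype.val : K.1 → EuclideanSpace ℝ (Fin (m + 1))) '' (Set.univ \ {⟨a, ha⟩}) =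
      ((K.oppFace a ha).1 : Set (EuclideanSpace ℝ (Fin (m + 1)))) := by
    ext y
    rw [SetLike.mem_coe, K.mem_oppFace ha]
    constructor
    · rintro ⟨⟨z, hz⟩, hz2, rfl⟩
      exact ⟨fun h => hz2.2 (Subtype.ext h), hz⟩
    · rintro ⟨h1, h2⟩
      exact ⟨⟨y, h2⟩, ⟨trivial, fun h => h1 (congrArg Subtype.val h)⟩, rfl⟩
  rwa [h2] at h1

lemma Mesh.Elem.starProjection_ne_zero (K : T.Elem) {a x : EuclideanSpace ℝ (Fin (m + 1))}
    (ha : a ∈ K.1) (hx : x ∈ (K.oppFace a ha).1) :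
    (vectorSpan ℝ ((K.oppFace a ha).1 : Set (EuclideanSpace ℝ (Fin (m + 1)))))ᗮ.starProjection
      (x - a) ≠ 0 := by
  intro h
  rw [Submodule.starProjection_apply_eq_zero_iff, Submodule.orthogonal_orthogonal] at h
  refine K.notMem_affineSpan_oppFace ha ?_
  have h3 : -(x - a) +ᵥ x ∈ affineSpan ℝ
      ((K.oppFace a ha).1 : Set (EuclideanSpace ℝ (Fin (m + 1)))) :=
    AffineSubspace.vadd_mem_of_mem_direction (by
      rw [direction_affineSpan]
      exact Submodule.neg_mem _ h) (subset_affineSpan ℝ _ hx)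
  simpa using h3

lemma Mesh.Elem.norm_normal (K : T.Elem) {F : T.Face} (hF : F ∈ K.faces) : ‖K.normal F‖ = 1 := by
  obtain ⟨a, ha, rfl⟩ := K.exists_eq_oppFace hF
  obtain ⟨x, hx, hxa⟩ := K.exists_vertex_ne a
  have hx' := (K.mem_oppFace ha).2 ⟨hxa, hx⟩
  rw [K.normal_oppFace ha hx', NormedSpace.norm_normalize_eq_one_iff]
  exact K.starProjection_ne_zero ha hx'

lemma Mesh.Elem.inner_normal_eq_zero (K : T.Elem) (F : T.Face)
    {x y : EuclideanSpace ℝ (Fin (m + 1))} (hx : x ∈ F.1) (hy : y ∈ F.1) :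
    inner ℝ (K.normal F) (x - y) = 0 := by
  have h : K.normal F ∈ (vectorSpan ℝ (F.1 : Set (EuclideanSpace ℝ (Fin (m + 1)))))ᗮ :=
    Submodule.smul_mem _ _ (Submodule.starProjection_apply_mem _ _)
  exact Submodule.inner_left_of_mem_orthogonal (vsub_mem_vectorSpan ℝ hx hy) h

/-- For an orthogonal projection, `⟨P v, v⟩ = ‖P v‖²`. This positive number, divided by `‖P v‖`, is
the height of `a` over its opposite face; it also shows that the normal points out of `K`. -/
lemma Mesh.Elem.inner_normal_pos (K : T.Elem) {a x : EuclideanSpace ℝ (Fin (m + 1))} (ha : a ∈ K.1)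
    (hx : x ∈ (K.oppFace a ha).1) : 0 < inner ℝ (K.normal (K.oppFace a ha)) (x - a) := by
  have h0 := K.starProjection_ne_zero ha hx
  rw [K.normal_oppFace ha hx, NormedSpace.normalize]
  set P := (vectorSpan ℝ
    ((K.oppFace a ha).1 : Set (EuclideanSpace ℝ (Fin (m + 1)))))ᗮ.starProjection with hP
  have h1 : inner ℝ (x - a - P (x - a)) (P (x - a)) = 0 :=
    Submodule.starProjection_inner_eq_zero _ _ (Submodule.starProjection_apply_mem _ _)
  rw [inner_sub_left, sub_eq_zero, real_inner_self_eq_norm_sq] at h1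
  rw [real_inner_smul_left, real_inner_comm, h1]
  have : 0 < ‖P (x - a)‖ := norm_pos_iff.2 h0
  positivity

/-! ### Integration by parts on an element -/

lemma volume_real_splitCorner_pos (m : ℕ) : 0 < volume.real (splitCorner m) := by
  refine ENNReal.toReal_pos (Measure.measure_pos_of_nonempty_interior _ ?_).ne'
    (isCompact_splitCorner m).measure_lt_top.ne
  obtain ⟨x, hx⟩ := openCorner_nonempty (m + 1)
  have hxe : consPoint (WithLp.toLp 2 (Fin.tail x.ofLp), x 0) = x := by
    ext i; refine Fin.cases ?_ (fun j => ?_) i <;> simp [Fin.tail]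
  rw [← hxe] at hx
  exact ⟨_, (consPoint_mem_openCorner hx).1⟩

/-- The integrals over an element and its face opposite `a = p 1`, in the chart of the element. -/
lemma Mesh.Elem.exists_chart_integrals (K : T.Elem)
    {p : Fin (m + 2) → EuclideanSpace ℝ (Fin (m + 1))} (hp : AffineIndependent ℝ p)
    (hr : Set.range p = (K.1 : Set (EuclideanSpace ℝ (Fin (m + 1))))) (ha : p 1 ∈ K.1) :
    ∃ J : ℝ, 0 < J ∧
      (∀ f : EuclideanSpace ℝ (Fin (m + 1)) → ℝ,
        ∫ x in (K.oppFace (p 1) ha).set, f x ∂μHE[m] =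
          J * ∫ y in corner m, f (chart p (consPoint (y, 0)))) ∧
      (∀ f : EuclideanSpace ℝ (Fin (m + 1)) → ℝ,
        ∫ x in K.set, f x =
          J * inner ℝ (K.normal (K.oppFace (p 1) ha)) (p 0 - p 1) *
            ∫ z in splitCorner m, f (chart p (consPoint z))) := by
  have hmem : ∀ i, i ≠ 1 → p i ∈ (K.oppFace (p 1) ha).1 := by
    intro i hi
    have h : p i ∈ Set.range p := Set.mem_range_self i
    rw [hr] at h
    exact (K.mem_oppFace ha).2 ⟨hp.injective.ne hi, h⟩
  have h0 := hmem 0 (by simp)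
  have hpos := K.inner_normal_pos ha h0
  have hneg : inner ℝ (K.normal (K.oppFace (p 1) ha)) (p 1 - p 0) =
      -inner ℝ (K.normal (K.oppFace (p 1) ha)) (p 0 - p 1) := by
    rw [← inner_neg_right, neg_sub]
  obtain ⟨J, hJ, h1, h2⟩ := HDG.exists_chart_integrals hp (K.normal (K.oppFace (p 1) ha))
    (K.norm_normal (K.oppFace_mem_faces ha))
    (fun j => K.inner_normal_eq_zero _ (hmem _ (by
      rw [← Fin.succ_zero_eq_one]
      exact (Fin.succ_injective _).ne (Fin.succ_ne_zero j))) h0)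
    (by rw [hneg]; exact neg_ne_zero.2 hpos.ne')
  rw [K.range_comp_succAbove hp hr 1 ha] at h1
  rw [hr, hneg, abs_neg, abs_of_pos hpos] at h2
  exact ⟨J, hJ, h1, h2⟩

/-- Composition with a chart turns derivatives along the first edge into `∂₀`. -/
lemma ev_pderiv_affinePullback {k : ℕ} (p : Fin (m + 2) → EuclideanSpace ℝ (Fin (m + 1)))
    (g : Pk (m + 1) k) (x : EuclideanSpace ℝ (Fin (m + 1))) :
    ev (MvPolynomial.pderiv 0 (affinePullback k (p 0) (fun i => p i.succ - p 0) g).1) x =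
      ev (dirDeriv (p 1 - p 0).ofLp g.1) (chart p x) := by
  have h1 := hasDerivAt_ev_line (affinePullback k (p 0) (fun i => p i.succ - p 0) g).1 x
    (EuclideanSpace.single 0 1) 0
  have h2 := hasDerivAt_ev_line g.1 (chart p x) (p 1 - p 0) 0
  -- Moving along the first coordinate axis in the chart is moving along the edge `p 1 - p 0` in the
  -- element; uniqueness of derivatives then compares the two expressions.
  have hfun : (fun t : ℝ => ev (affinePullback k (p 0) (fun i => p i.succ - p 0) g).1
      (x + t • EuclideanSpace.single 0 1)) = fun t => ev g.1 (chart p x + t • (p 1 - p 0)) := by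
    funext t
    rw [ev_affinePullback]
    congr 1
    simp only [PiLp.add_apply, PiLp.smul_apply, smul_eq_mul, add_smul,
      Finset.sum_add_distrib, chart, ← add_assoc]
    congr 1
    simp
  rw [hfun] at h1
  have h3 := h1.unique h2
  rwa [PiLp.ofLp_single, dirDeriv_single, zero_smul, zero_smul, add_zero, add_zero] at h3

/-- The divergence theorem in the direction of an edge. -/
lemma Mesh.Elem.integral_dirDeriv_edge (K : T.Elem) {a b : EuclideanSpace ℝ (Fin (m + 1))}
    (ha : a ∈ K.1) (hb : b ∈ K.1) (hab : b ≠ a) (g : MvPolynomial (Fin (m + 1)) ℝ) :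
    ∫ x in K.set, ev (dirDeriv (a - b).ofLp g) x =
      inner ℝ (K.normal (K.oppFace b hb)) (a - b) * (∫ x in (K.oppFace b hb).set, ev g x ∂μHE[m]) +
      inner ℝ (K.normal (K.oppFace a ha)) (a - b) *
        ∫ x in (K.oppFace a ha).set, ev g x ∂μHE[m] := by
  obtain ⟨p, hp, hr, rfl, rfl⟩ := K.exists_ordering ha hb hab
  obtain ⟨J, hJ, hF, hK⟩ := K.exists_chart_integrals hp hr ha
  -- Exchanging the first two vertices charts the same element from `a`, so that the face opposite
  -- `b`, which is the top face of the first chart, becomes the bottom face of the second.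
  let p' := p ∘ Equiv.swap 0 1
  have hp0 : p' 0 = p 1 := by simp [p']
  have hp1 : p' 1 = p 0 := by simp [p']
  have hp' : AffineIndependent ℝ p' := hp.comp_embedding (Equiv.swap 0 1).toEmbedding
  have hr' : Set.range p' = (K.1 : Set (EuclideanSpace ℝ (Fin (m + 1)))) := by
    rw [← hr]
    exact (Equiv.swap 0 1).surjective.range_comp p
  have hpj : ∀ j : Fin m, p' j.succ.succ = p j.succ.succ := fun j => by
    have h1 : (j.succ.succ : Fin (m + 2)) ≠ 1 := by
      rw [← Fin.succ_zero_eq_one]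
      exact (Fin.succ_injective _).ne (Fin.succ_ne_zero j)
    simp [p', Equiv.swap_apply_of_ne_of_ne (Fin.succ_ne_zero _) h1]
  have hF' : ∃ J : ℝ, 0 < J ∧
      (∀ f : EuclideanSpace ℝ (Fin (m + 1)) → ℝ,
        ∫ x in (K.oppFace (p 0) hb).set, f x ∂μHE[m] =
          J * ∫ y in corner m, f (chart p' (consPoint (y, 0)))) ∧
      (∀ f : EuclideanSpace ℝ (Fin (m + 1)) → ℝ,
        ∫ x in K.set, f x =
          J * inner ℝ (K.normal (K.oppFace (p 0) hb)) (p 1 - p 0) *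
            ∫ z in splitCorner m, f (chart p' (consPoint z))) := by
    have h := K.exists_chart_integrals hp' hr' (by rw [hp1]; exact hb)
    simp only [hp1, hp0] at h
    exact h
  obtain ⟨J', hJ', hF', hK'⟩ := hF'
  -- Both charts compute the volume of `K`, so their volume Jacobians agree. This converts the
  -- integral over the top face to the surface measure of the face opposite `b`.
  have hvol : J' * inner ℝ (K.normal (K.oppFace (p 0) hb)) (p 1 - p 0) =
      J * inner ℝ (K.normal (K.oppFace (p 1) ha)) (p 0 - p 1) := by
    have h1 := (hK fun _ => 1).symm.trans (hK' fun _ => 1)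
    simp only [setIntegral_const, smul_eq_mul, mul_one] at h1
    exact (mul_right_cancel₀ (volume_real_splitCorner_pos m).ne' h1).symm
  have htop : ∀ y : EuclideanSpace ℝ (Fin m),
      chart p (consPoint (y, 1 - ∑ i, y i)) = chart p' (consPoint (y, 0)) := by
    intro y
    rw [chart_eq_sum, chart_eq_sum, Fin.sum_univ_succ, Fin.sum_univ_succ, Fin.sum_univ_succ,
      Fin.sum_univ_succ]
    simp only [consPoint_zero, consPoint_succ, hp0, hpj, Fin.succ_zero_eq_one]
    simp
  let G : Pk (m + 1) g.totalDegree := ⟨g, (MvPolynomial.mem_restrictTotalDegree _ _ _).2 le_rfl⟩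
  let G' := affinePullback g.totalDegree (p 0) (fun i => p i.succ - p 0) G
  have hG' : ∀ x, ev G'.1 x = ev g (chart p x) := fun x => ev_affinePullback _ _ G x
  have hGd : ∀ x : EuclideanSpace ℝ (Fin (m + 1)), ev (dirDeriv (p 1 - p 0).ofLp g) (chart p x) =
      ev (MvPolynomial.pderiv 0 G'.1) x := fun x => (ev_pderiv_affinePullback p G x).symm
  have hc : ∀ φ : EuclideanSpace ℝ (Fin m) → ℝ, Continuous φ →
      Continuous fun y => ev G'.1 (consPoint (y, φ y)) := fun φ hφ =>
    (continuous_ev _).comp (continuous_consPoint.comp (by fun_prop))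
  rw [hK, hF, hF']
  simp only [hGd]
  rw [setIntegral_splitCorner_pderiv, integral_sub (integrableOn_corner (hc _ (by fun_prop)))
    (integrableOn_corner (hc _ (by fun_prop)))]
  simp only [hG', htop]
  have hneg : inner ℝ (K.normal (K.oppFace (p 1) ha)) (p 1 - p 0) =
      -inner ℝ (K.normal (K.oppFace (p 1) ha)) (p 0 - p 1) := by
    rw [← inner_neg_right, neg_sub]
  rw [hneg, mul_sub]
  nth_rewrite 1 [← hvol]
  ring

/-- The divergence theorem on an element. -/
lemma Mesh.Elem.integral_dirDeriv (K : T.Elem) (e : EuclideanSpace ℝ (Fin (m + 1)))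
    (g : MvPolynomial (Fin (m + 1)) ℝ) :
    ∫ x in K.set, ev (dirDeriv e.ofLp g) x =
      ∑ F ∈ K.faces, inner ℝ (K.normal F) e * ∫ x in F.set, ev g x ∂μHE[m] := by
  have hint : ∀ q : MvPolynomial (Fin (m + 1)) ℝ, IntegrableOn (ev q) K.set :=
    fun q => integrableOn_elem K (continuous_ev q)
  -- Both sides are linear in `e`, and the edge vectors of a nondegenerate simplex span the whole
  -- space, so it is enough to treat edges.
  have hspan : e ∈ vectorSpan ℝ (Set.range (Subtype.val : K.1 → EuclideanSpace ℝ (Fin (m + 1)))) := by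
    rw [(T.complex.indep K.2.1).vectorSpan_eq_top_of_card_eq_finrank_add_one (by
      rw [Fintype.card_coe, K.2.2, finrank_euclideanSpace_fin])]
    trivial
  induction hspan using Submodule.span_induction with
  | zero => simp [ev_dirDeriv]
  | add x y _ _ hx hy =>
    have h : dirDeriv (x + y).ofLp g = dirDeriv x.ofLp g + dirDeriv y.ofLp g := by
      simp [dirDeriv, add_smul, Finset.sum_add_distrib]
    simp only [h, ev_add, inner_add_right, add_mul, Finset.sum_add_distrib]
    rw [integral_add (hint _) (hint _), hx, hy]
  | smul c x _ hx =>
    have h : dirDeriv (c • x).ofLp g = c • dirDeriv x.ofLp g := by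
      simp [dirDeriv, mul_smul, Finset.smul_sum]
    simp only [h, ev_smul, inner_smul_right, mul_assoc, ← Finset.mul_sum]
    rw [integral_const_mul, hx]
  | mem x hx =>
    obtain ⟨_, ⟨⟨a, ha⟩, rfl⟩, _, ⟨⟨b, hb⟩, rfl⟩, rfl⟩ := hx
    simp only [vsub_eq_sub]
    by_cases hab : b = a
    · subst hab
      simp [ev_dirDeriv]
    rw [K.integral_dirDeriv_edge ha hb hab]
    refine (Finset.sum_eq_add_of_mem
      (f := fun F => inner ℝ (K.normal F) (a - b) * ∫ x in F.set, ev g x ∂μHE[m]) _ _ (K.oppFace_mem_faces hb) (K.oppFace_mem_faces ha)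
      (fun h => ?_) fun F hF hne => ?_).symm
    · have h1 : b ∈ (K.oppFace a ha).1 := (K.mem_oppFace ha).2 ⟨hab, hb⟩
      rw [← h, K.mem_oppFace hb] at h1
      exact h1.1 rfl
    -- A face opposite a third vertex contains both ends of the edge, so its normal is orthogonal to
    -- the edge.
    · obtain ⟨v, hv, rfl⟩ := K.exists_eq_oppFace hF
      have hva : a ≠ v := by rintro rfl; exact hne.2 rfl
      have hvb : b ≠ v := by rintro rfl; exact hne.1 rfl
      rw [K.inner_normal_eq_zero _ ((K.mem_oppFace hv).2 ⟨hva, ha⟩)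
        ((K.mem_oppFace hv).2 ⟨hvb, hb⟩), zero_mul]

/-- Integration by parts on an element. -/
lemma Mesh.Elem.integral_by_parts (K : T.Elem) {k : ℕ} (q : Fin (m + 1) → Pk (m + 1) k)
    (w : Pk (m + 1) k) :
    (∫ x in K.set, evv q x ⬝ᵥ gd w x) + ∫ x in K.set, ev w.1 x * dv q x =
      ∑ F ∈ K.faces, ∫ x in F.set, (evv q x ⬝ᵥ K.normal F) * ev w.1 x ∂μHE[m] := by
  have hint : ∀ q : MvPolynomial (Fin (m + 1)) ℝ, IntegrableOn (ev q) K.set :=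
    fun q => integrableOn_elem K (continuous_ev q)
  have hgd : Continuous (gd w) := continuous_pi fun _ => continuous_ev _
  have hdot : Continuous fun x => evv q x ⬝ᵥ gd w x := continuous_finsetSum _ fun i _ =>
    ((continuous_apply i).comp (continuous_evv q)).mul ((continuous_apply i).comp hgd)
  -- The product rule: the integrand is the divergence of `w q`, a sum of coordinate derivatives of
  -- `q i * w`.
  have hL : ∀ x, evv q x ⬝ᵥ gd w x + ev w.1 x * dv q x =
      ∑ i, ev (dirDeriv (EuclideanSpace.single i (1 : ℝ)).ofLp ((q i).1 * w.1)) x := by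
    intro x
    simp only [PiLp.ofLp_single, dirDeriv_single, Derivation.leibniz, smul_eq_mul, ev_add, ev_mul,
      Finset.sum_add_distrib, dotProduct, evv, gd, dv, Finset.mul_sum]
  rw [← integral_add (integrableOn_elem K hdot) (intVD K _ _)]
  simp only [hL]
  rw [integral_finsetSum _ fun i _ => hint _]
  simp only [K.integral_dirDeriv]
  rw [Finset.sum_comm]
  refine Finset.sum_congr rfl fun F _ => ?_
  have hR : ∀ x, (evv q x ⬝ᵥ K.normal F) * ev w.1 x =
      ∑ i, K.normal F i * ev ((q i).1 * w.1) x := by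
    intro x
    simp only [dotProduct, Finset.sum_mul, ev_mul, evv]
    exact Finset.sum_congr rfl fun i _ => by ring
  simp only [hR]
  have hF : ∀ p : MvPolynomial (Fin (m + 1)) ℝ, IntegrableOn (ev p) F.set μHE[m] :=
    fun p => integrableOn_face F (continuous_ev p)
  rw [integral_finsetSum _ fun i _ => (hF _).const_mul _]
  refine Finset.sum_congr rfl fun i _ => ?_
  rw [integral_const_mul]
  congr 1
  simp [EuclideanSpace.inner_single_right]

end Geometry

/-! ### The coefficient `c` -/

section Coefficient

variable {n : ℕ} {Ω : Set (EuclideanSpace ℝ (Fin n))} {Γ : ℝ}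

lemma Coeff.posDef_c (α : Coeff Ω Γ) {x : EuclideanSpace ℝ (Fin n)} (hx : x ∈ Ω) :
    (α.c x).PosDef := (α.posDef x hx).inv

lemma Coeff.c_mulVec_dotProduct_comm (α : Coeff Ω Γ) {x : EuclideanSpace ℝ (Fin n)} (hx : x ∈ Ω)
    (v w : Fin n → ℝ) : (α.c x).mulVec v ⬝ᵥ w = (α.c x).mulVec w ⬝ᵥ v := by
  have h : (α.c x).transpose = α.c x := by
    simpa [Matrix.conjTranspose_eq_transpose_of_trivial] using (α.posDef_c hx).isHermitian.eq
  rw [dotProduct_comm, Matrix.dotProduct_mulVec, ← Matrix.mulVec_transpose, h]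

lemma Coeff.c_mulVec_dotProduct_self_nonneg (α : Coeff Ω Γ) {x : EuclideanSpace ℝ (Fin n)}
    (hx : x ∈ Ω) (v : Fin n → ℝ) : 0 ≤ (α.c x).mulVec v ⬝ᵥ v := by
  rw [dotProduct_comm]
  simpa using (α.posDef_c hx).posSemidef.dotProduct_mulVec_nonneg v

lemma Coeff.eq_zero_of_c_mulVec_dotProduct_self (α : Coeff Ω Γ) {x : EuclideanSpace ℝ (Fin n)}
    (hx : x ∈ Ω) {v : Fin n → ℝ} (h : (α.c x).mulVec v ⬝ᵥ v = 0) : v = 0 := by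
  by_contra hv
  have := (α.posDef_c hx).dotProduct_mulVec_pos hv
  rw [star_trivial, dotProduct_comm, h] at this
  exact lt_irrefl _ this

lemma Coeff.c_mulVec_dotProduct_self_le (α : Coeff Ω Γ) {x : EuclideanSpace ℝ (Fin n)}
    (hx : x ∈ Ω) (v : EuclideanSpace ℝ (Fin n)) :
    (α.c x).mulVec v.ofLp ⬝ᵥ v.ofLp ≤ Γ * ‖v‖ ^ 2 := by
  have h1 : (α.c x).mulVec v.ofLp ⬝ᵥ v.ofLp =
      inner ℝ v (Matrix.toEuclideanCLM (𝕜 := ℝ) (α.toFun x)⁻¹ v) := by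
    rw [EuclideanSpace.inner_eq_star_dotProduct]
    simp [Coeff.c]
  rw [h1, pow_two, ← mul_assoc]
  refine (real_inner_le_norm _ _).trans ?_
  rw [mul_comm]
  gcongr
  exact (ContinuousLinearMap.le_opNorm _ _).trans (by gcongr; exact α.norm_inv_le x hx)

end Coefficient

/-! ### The local problems -/

section LocalProblem

variable {m : ℕ} {Ω : Set (EuclideanSpace ℝ (Fin (m + 1)))} {T : Mesh Ω} {Γ : ℝ} {k : ℕ}

lemma localForm_apply (α : Coeff Ω Γ) (τ : Penalty T) (K : T.Elem)
    (s t : LocalSpace (m + 1) k) :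
    localForm k T α τ K s t =
      (∫ x in K.set, (α.c x).mulVec (evv s.1 x) ⬝ᵥ evv t.1 x)
      - (∫ x in K.set, ev s.2.1 x * dv t.1 x)
      + (∫ x in K.set, ev t.2.1 x * dv s.1 x)
      + ∑ F ∈ K.faces, ∫ x in F.set, τ.toFun K F * (ev s.2.1 x * ev t.2.1 x) ∂μHE[m] := rfl

lemma localForm_vector (α : Coeff Ω Γ) (τ : Penalty T) (K : T.Elem)
    (q r : Fin (m + 1) → Pk (m + 1) k) :
    localForm k T α τ K (q, 0) (r, 0) =
      ∫ x in K.set, (α.c x).mulVec (evv q x) ⬝ᵥ evv r x := by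
  simp [localForm_apply, ev_zero]

lemma localForm_self (α : Coeff Ω Γ) (τ : Penalty T) (K : T.Elem) (s : LocalSpace (m + 1) k) :
    localForm k T α τ K s s =
      (∫ x in K.set, (α.c x).mulVec (evv s.1 x) ⬝ᵥ evv s.1 x)
      + ∑ F ∈ K.faces, τ.toFun K F * ∫ x in F.set, ev s.2.1 x ^ 2 ∂μHE[m] := by
  simp only [localForm_apply, sub_add_cancel, integral_const_mul, pow_two]

lemma integral_c_comm (α : Coeff Ω Γ) (K : T.Elem) (q r : Fin (m + 1) → Pk (m + 1) k) :
    ∫ x in K.set, (α.c x).mulVec (evv q x) ⬝ᵥ evv r x =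
      ∫ x in K.set, (α.c x).mulVec (evv r x) ⬝ᵥ evv q x := by
  refine integral_congr_ae ?_
  filter_upwards [elem_ae_mem K] with x hx using α.c_mulVec_dotProduct_comm hx _ _

lemma integral_c_self_nonneg (α : Coeff Ω Γ) (K : T.Elem) (q : Fin (m + 1) → Pk (m + 1) k) :
    0 ≤ ∫ x in K.set, (α.c x).mulVec (evv q x) ⬝ᵥ evv q x := by
  refine integral_nonneg_of_ae ?_
  filter_upwards [elem_ae_mem K] with x hx using α.c_mulVec_dotProduct_self_nonneg hx _

/-- The Cauchy–Schwarz inequality for `(c ·, ·)_K`. -/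
lemma sq_integral_c_le (α : Coeff Ω Γ) (τ : Penalty T) (K : T.Elem)
    (q r : Fin (m + 1) → Pk (m + 1) k) :
    (∫ x in K.set, (α.c x).mulVec (evv q x) ⬝ᵥ evv r x) ^ 2 ≤
      (∫ x in K.set, (α.c x).mulVec (evv q x) ⬝ᵥ evv q x) *
        ∫ x in K.set, (α.c x).mulVec (evv r x) ⬝ᵥ evv r x := by
  refine sq_le_mul_of_quadratic_nonneg fun s => ?_
  have h := integral_c_self_nonneg α K (q + s • r)
  -- On pairs `(·, 0)` the local form is `(c ·, ·)_K`, so its bilinearity expands the square.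
  have hqr : ((q + s • r, 0) : LocalSpace (m + 1) k) = (q, 0) + s • (r, 0) := by simp
  rw [← localForm_vector α τ, hqr] at h
  simp only [map_add, map_smul, LinearMap.add_apply, LinearMap.smul_apply, smul_eq_mul,
    localForm_vector] at h
  rw [integral_c_comm α K r q] at h
  linarith

/-- Bounds the energy of the test fields `r = G e`. The factor `max Γ 1` in place of `Γ` keeps the
later constant positive, and at least one, for every real `Γ`. -/
lemma integral_c_smul_le (α : Coeff Ω Γ) (K : T.Elem) (G : Pk (m + 1) k)
    (e : EuclideanSpace ℝ (Fin (m + 1))) :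
    ∫ x in K.set, (α.c x).mulVec (evv (fun i => e i • G) x) ⬝ᵥ evv (fun i => e i • G) x ≤
      max Γ 1 * ‖e‖ ^ 2 * ∫ x in K.set, ev G.1 x ^ 2 := by
  rw [← integral_const_mul]
  have hsq : Continuous fun x => ev G.1 x ^ 2 := (continuous_ev _).pow 2
  refine integral_mono_ae (α.integrableOn K _ _) ((integrableOn_elem K hsq).const_mul _) ?_
  filter_upwards [elem_ae_mem K] with x hx
  have h1 : evv (fun i => e i • G) x = ev G.1 x • e.ofLp := by
    funext i
    simp [evv, ev_smul, mul_comm]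
  rw [h1, Matrix.mulVec_smul, smul_dotProduct, dotProduct_smul, smul_eq_mul, smul_eq_mul,
    ← mul_assoc, ← pow_two, mul_comm]
  refine mul_le_mul_of_nonneg_right ?_ (sq_nonneg _)
  exact (α.c_mulVec_dotProduct_self_le hx e).trans (by gcongr; exact le_max_left _ _)

lemma dv_smul_const (G : Pk (m + 1) k) (e x : EuclideanSpace ℝ (Fin (m + 1))) :
    dv (fun i => e i • G) x = ev (dirDeriv e.ofLp G.1) x := by
  simp [dv, ev_dirDeriv, ev_smul]

lemma Penalty.exists_eq_tmax (τ : Penalty T) (K : T.Elem) :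
    ∃ F ∈ K.faces, τ.toFun K F = τ.tmax K ∧ 0 < τ.tmax K := by
  obtain ⟨F₀, hF₀, hpos⟩ := τ.exists_pos K
  have hfin : (τ.toFun K '' (K.faces : Set T.Face)).Finite := K.faces.finite_toSet.image _
  obtain ⟨F, hF, hmax⟩ := Set.Nonempty.csSup_mem ⟨_, Set.mem_image_of_mem _ hF₀⟩ hfin
  exact ⟨F, hF, hmax, hpos.trans_le (le_csSup hfin.bddAbove (Set.mem_image_of_mem _ hF₀))⟩

lemma Mesh.Elem.dist_le_size (K : T.Elem) {a b : EuclideanSpace ℝ (Fin (m + 1))} (ha : a ∈ K.1)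
    (hb : b ∈ K.1) : dist a b ≤ K.size :=
  Metric.dist_le_diam_of_mem (isCompact_elem K).isBounded (subset_convexHull ℝ _ ha)
    (subset_convexHull ℝ _ hb)

lemma Mesh.Elem.size_pos (K : T.Elem) : 0 < K.size := by
  obtain ⟨a, ha⟩ := T.complex.nonempty_of_mem_faces K.2.1
  obtain ⟨b, hb, hba⟩ := K.exists_vertex_ne a
  exact (dist_pos.2 hba).trans_le (K.dist_le_size hb ha)

lemma Penalty.one_le_d_sq (τ : Penalty T) (K : T.Elem) : 1 ≤ τ.d K ^ 2 := by
  have : 0 ≤ (Real.sqrt (τ.tmax K * K.size))⁻¹ := by positivity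
  rw [Penalty.d]
  nlinarith

lemma Penalty.inv_le_d_sq (τ : Penalty T) (K : T.Elem) :
    (τ.tmax K * K.size)⁻¹ ≤ τ.d K ^ 2 := by
  obtain ⟨_, _, _, hpos⟩ := τ.exists_eq_tmax K
  have h1 : 0 ≤ (Real.sqrt (τ.tmax K * K.size))⁻¹ := by positivity
  have h2 : (Real.sqrt (τ.tmax K * K.size))⁻¹ ^ 2 = (τ.tmax K * K.size)⁻¹ := by
    rw [inv_pow, Real.sq_sqrt (mul_nonneg hpos.le K.size_pos.le)]
  rw [Penalty.d, ← h2]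
  nlinarith

/-- The constant in the local energy bound depends only on `m`, `k` and `Γ`. -/
lemma exists_energy_bound (m k : ℕ) (Γ : ℝ) : ∃ C₀ : ℝ, 0 < C₀ ∧
    ∀ (Ω : Set (EuclideanSpace ℝ (Fin (m + 1)))) (T : Mesh Ω) (α : Coeff Ω Γ) (τ : Penalty T)
      (K : T.Elem) (s : LocalSpace (m + 1) k), (∀ r, localForm k T α τ K s (r, 0) = 0) →
      ∫ x in K.set, ev s.2.1 x ^ 2 ≤
        C₀ * τ.d K ^ 2 * K.size ^ 2 * localForm k T α τ K s s := by
  obtain ⟨C, hC, hbound⟩ := exists_reference_bound m k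
  have hΓ : 1 ≤ max Γ 1 := le_max_right _ _
  refine ⟨C * max Γ 1, by positivity, fun Ω T α τ K s hs => ?_⟩
  -- The chart is adapted to a face where `τ` is maximal: there the stabilization controls `u` with
  -- the weight `τ.tmax K`. The edge `p 1 - p 0` leaves this face for the opposite vertex.
  obtain ⟨F, hF, hFmax, hpos⟩ := τ.exists_eq_tmax K
  obtain ⟨a, ha, rfl⟩ := K.exists_eq_oppFace hF
  obtain ⟨b, hb, hba⟩ := K.exists_vertex_ne a
  obtain ⟨p, hp, hr, rfl, rfl⟩ := K.exists_ordering ha hb hba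
  obtain ⟨J, hJ, hJF, hJK⟩ := K.exists_chart_integrals hp hr ha
  have hb' : p 0 ∈ (K.oppFace (p 1) ha).1 := (K.mem_oppFace ha).2 ⟨hba, hb⟩
  have hgt := K.inner_normal_pos ha hb'
  set H := inner ℝ (K.normal (K.oppFace (p 1) ha)) (p 0 - p 1) with hH
  have hHle : H ≤ K.size := by
    refine (real_inner_le_norm _ _).trans ?_
    rw [K.norm_normal hF, one_mul, ← dist_eq_norm]
    exact K.dist_le_size hb ha
  set Eq := ∫ x in K.set, (α.c x).mulVec (evv s.1 x) ⬝ᵥ evv s.1 x with hEq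
  have hEq0 : 0 ≤ Eq := integral_c_self_nonneg α K s.1
  set I := ∫ x in (K.oppFace (p 1) ha).set, ev s.2.1 x ^ 2 ∂μHE[m] with hI
  have hI0 : 0 ≤ I := integral_nonneg fun _ => sq_nonneg _
  have hE : Eq + τ.tmax K * I ≤ localForm k T α τ K s s := by
    rw [localForm_self, ← hFmax]
    refine add_le_add le_rfl (Finset.single_le_sum (f := fun F => τ.toFun K F *
      ∫ x in F.set, ev s.2.1 x ^ 2 ∂μHE[m]) (fun F hF => ?_) hF)
    exact mul_nonneg (τ.nonneg K F hF) (integral_nonneg fun _ => sq_nonneg _)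
  let P := affinePullback k (p 0) (fun i => p i.succ - p 0)
  have hP : ∀ G x, ev (P G).1 x = ev G.1 (chart p x) := fun G x => ev_affinePullback _ _ G x
  have hsz := K.size_pos
  have hD : 0 < J * H := mul_pos hJ hgt
  -- After the change of variables, Cauchy–Schwarz has the factor `J * H` twice on the left and once
  -- on the right, hence one in the denominator here.
  set M := Eq * (max Γ 1 * K.size ^ 2) / (J * H) with hM
  have key := hbound (P s.2) M (by positivity) fun G' => by
    obtain ⟨G, rfl⟩ := affinePullback_surjective k (p 0) (linearIndependent_edges hp) G'
    -- The field `r = G e` has divergence `∂_e G`, so the first local equation expresses the product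
    -- of `u` with `∂₀` of the pulled-back `G` through `(c q, r)_K`.
    set r : Fin (m + 1) → Pk (m + 1) k := fun i => (p 1 - p 0) i • G with hrdef
    have h1 : ∫ x in K.set, (α.c x).mulVec (evv s.1 x) ⬝ᵥ evv r x =
        J * H * ∫ z in splitCorner m, ev (P s.2).1 (consPoint z) *
          ev (MvPolynomial.pderiv 0 (P G).1) (consPoint z) := by
      have h2 := hs r
      rw [localForm_apply] at h2
      simp only [Submodule.coe_zero, ev_zero, zero_mul, mul_zero, integral_zero,
        Finset.sum_const_zero, add_zero] at h2
      rw [sub_eq_zero.1 h2, hJK]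
      congr 2
      funext z
      rw [hP, hrdef, dv_smul_const, ← ev_pderiv_affinePullback]
    have h3 := sq_integral_c_le α τ K s.1 r
    have h4 := integral_c_smul_le α K G (p 1 - p 0)
    rw [h1] at h3
    have h5 : ‖p 1 - p 0‖ ^ 2 ≤ K.size ^ 2 := by
      rw [← dist_eq_norm]
      exact pow_le_pow_left₀ dist_nonneg (K.dist_le_size ha hb) 2
    rw [hJK fun x => ev G.1 x ^ 2] at h4
    simp only [← hP] at h4
    set R := ∫ z in splitCorner m, ev (P G).1 (consPoint z) ^ 2 with hR
    have hR0 : 0 ≤ R := integral_nonneg fun _ => sq_nonneg _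
    set A := ∫ z in splitCorner m, ev (P s.2).1 (consPoint z) *
      ev (MvPolynomial.pderiv 0 (P G).1) (consPoint z) with hA
    have h6 : (J * H * A) ^ 2 ≤ Eq * (max Γ 1 * K.size ^ 2 * (J * H * R)) := by
      refine h3.trans (mul_le_mul_of_nonneg_left (h4.trans ?_) hEq0)
      gcongr
    change A ^ 2 ≤ M * R
    rw [hM, div_mul_eq_mul_div, le_div_iff₀ hD]
    refine le_of_mul_le_mul_right ?_ hD
    calc A ^ 2 * (J * H) * (J * H) = (J * H * A) ^ 2 := by ring
      _ ≤ _ := h6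
      _ = _ := by ring
  have h1 : J * ∫ y in corner m, ev (P s.2).1 (consPoint (y, 0)) ^ 2 = I := by
    simp only [hP]
    exact (hJF fun x => ev s.2.1 x ^ 2).symm
  have h2 : J * H * ∫ z in splitCorner m, ev (P s.2).1 (consPoint z) ^ 2 =
      ∫ x in K.set, ev s.2.1 x ^ 2 := by
    simp only [hP]
    exact (hJK fun x => ev s.2.1 x ^ 2).symm
  -- Multiplication by `J * H` cancels the denominator of `M` and turns the reference face integral
  -- into `H * I`: the Jacobian `J`, and with it the shape of `K`, disappears.
  have h3 : ∫ x in K.set, ev s.2.1 x ^ 2 ≤ C * (Eq * (max Γ 1 * K.size ^ 2) + H * I) := by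
    rw [← h2, ← h1]
    refine (mul_le_mul_of_nonneg_left key hD.le).trans_eq ?_
    rw [hM]
    field_simp
  have h4 : Eq * (max Γ 1 * K.size ^ 2) ≤ max Γ 1 * τ.d K ^ 2 * K.size ^ 2 * Eq := by
    have := mul_le_mul_of_nonneg_left (τ.one_le_d_sq K)
      (show 0 ≤ Eq * (max Γ 1 * K.size ^ 2) by positivity)
    linarith
  -- The boundary term is where `d_K` enters: `h_K I = (τ h_K)⁻¹ h_K² (τ I)`, and `(τ h_K)⁻¹ ≤ d_K²`
  -- for the maximal `τ`.
  have h5 : H * I ≤ max Γ 1 * τ.d K ^ 2 * K.size ^ 2 * (τ.tmax K * I) := by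
    have h6 : H * I ≤ K.size * I := by gcongr
    have h7 : K.size * I = (τ.tmax K * K.size)⁻¹ * (K.size ^ 2 * (τ.tmax K * I)) := by
      field_simp
    have h8 : (τ.tmax K * K.size)⁻¹ * (K.size ^ 2 * (τ.tmax K * I)) ≤
        (max Γ 1 * τ.d K ^ 2) * (K.size ^ 2 * (τ.tmax K * I)) := by
      refine mul_le_mul_of_nonneg_right ?_ (by positivity)
      nlinarith [τ.inv_le_d_sq K, τ.one_le_d_sq K]
    calc H * I ≤ K.size * I := h6
      _ = _ := h7
      _ ≤ _ := h8
      _ = _ := by ring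
  calc ∫ x in K.set, ev s.2.1 x ^ 2 ≤ C * (Eq * (max Γ 1 * K.size ^ 2) + H * I) := h3
    _ ≤ C * (max Γ 1 * τ.d K ^ 2 * K.size ^ 2 * (Eq + τ.tmax K * I)) := by
      gcongr
      linarith
    _ ≤ C * (max Γ 1 * τ.d K ^ 2 * K.size ^ 2 * localForm k T α τ K s s) := by gcongr
    _ = _ := by ring

lemma Mesh.Elem.interior_nonempty (K : T.Elem) : (interior K.set).Nonempty := by
  refine interior_convexHull_nonempty_iff_affineSpan_eq_top.2 ?_
  have h := (T.complex.indep K.2.1).affineSpan_eq_top_iff_card_eq_finrank_add_one.2 (by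
    rw [Fintype.card_coe, K.2.2, finrank_euclideanSpace_fin])
  simpa using h

lemma eq_zero_of_integral_sq_eq_zero (K : T.Elem) {u : MvPolynomial (Fin (m + 1)) ℝ}
    (h : ∫ x in K.set, ev u x ^ 2 = 0) : u = 0 := by
  have hc : Continuous fun x => ev u x ^ 2 := (continuous_ev u).pow 2
  have h0 := eq_zero_of_setIntegral_sq_eq_zero hc (integrableOn_elem K hc)
    (Filter.Eventually.of_forall fun _ => sq_nonneg _) h
  exact eq_zero_of_ev_eq_zero_on_open isOpen_interior K.interior_nonempty fun x hx =>
    pow_eq_zero_iff two_ne_zero |>.1 (h0 x hx)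

/-- Since `c` is only measurable, the vanishing integral gives `q = 0` merely almost everywhere on
`K`; the components are polynomials, so that is enough. -/
lemma eq_zero_of_integral_c_self_eq_zero (α : Coeff Ω Γ) (K : T.Elem)
    {q : Fin (m + 1) → Pk (m + 1) k}
    (h : ∫ x in K.set, (α.c x).mulVec (evv q x) ⬝ᵥ evv q x = 0) : q = 0 := by
  have h0 := (setIntegral_eq_zero_iff_of_nonneg_ae (by
    filter_upwards [elem_ae_mem K] with x hx using α.c_mulVec_dotProduct_self_nonneg hx _)
    (α.integrableOn K q q)).1 h
  funext i
  refine Subtype.ext (eq_zero_of_integral_sq_eq_zero K ?_)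
  refine integral_eq_zero_of_ae ?_
  filter_upwards [h0, elem_ae_mem K] with x hx hxΩ
  have h1 := congrFun (α.eq_zero_of_c_mulVec_dotProduct_self hxΩ hx) i
  have h2 : ev (q i).1 x = 0 := h1
  simp [h2]

/-- For a homogeneous solution the energy vanishes, so the energy bound gives `u = 0`, and then the
remaining term `(c q, q)_K = 0` gives `q = 0`. An injective map from a finite-dimensional space to
its dual is bijective. -/
lemma localForm_bijective (α : Coeff Ω Γ) (τ : Penalty T) (K : T.Elem) :
    Function.Bijective (localForm k T α τ K) := by
  have hinj : Function.Injective (localForm k T α τ K) := by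
    refine (injective_iff_map_eq_zero _).2 fun s hs => ?_
    obtain ⟨C₀, _, hC⟩ := exists_energy_bound m k Γ
    have h0 : ∀ t, localForm k T α τ K s t = 0 := fun t => by rw [hs]; rfl
    have h1 := hC Ω T α τ K s fun r => h0 _
    rw [h0, mul_zero] at h1
    have hu : s.2 = 0 := Subtype.ext (eq_zero_of_integral_sq_eq_zero K
      (le_antisymm h1 (integral_nonneg fun _ => sq_nonneg _)))
    have h2 := h0 s
    rw [localForm_self, hu] at h2
    simp only [Submodule.coe_zero, ev_zero, ne_eq, OfNat.ofNat_ne_zero, not_false_eq_true,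
      zero_pow, integral_zero, mul_zero, Finset.sum_const_zero, add_zero] at h2
    exact Prod.ext (eq_zero_of_integral_c_self_eq_zero α K h2) hu
  exact ⟨hinj, (LinearMap.injective_iff_surjective_of_finrank_eq_finrank
    (Subspace.dual_finrank_eq (K := ℝ) (V := LocalSpace (m + 1) k)).symm).1 hinj⟩

lemma localForm_localSolve (α : Coeff Ω Γ) (τ : Penalty T) (K : T.Elem)
    (ℓ : LocalSpace (m + 1) k →ₗ[ℝ] ℝ) :
    localForm k T α τ K (localSolve k T α τ K ℓ) = ℓ := by
  rw [localSolve, dif_pos (localForm_bijective α τ K)]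
  exact (LinearEquiv.ofBijective _ (localForm_bijective α τ K)).apply_symm_apply ℓ

end LocalProblem

/-! ### Broken polynomials in `L²(Ω)` -/

section L2

variable {m : ℕ} {Ω : Set (EuclideanSpace ℝ (Fin (m + 1)))} {T : Mesh Ω} {Γ : ℝ} {k : ℕ}

/-- By conformity the intersection lies in the hull of the common vertices. Some vertex `a` of `K`
is not common, so this hull lies in the hyperplane of the face opposite `a`. -/
lemma Mesh.Elem.volume_inter_eq_zero {K K' : T.Elem} (h : K ≠ K') :
    volume (K.set ∩ K'.set) = 0 := by
  classical
  obtain ⟨a, ha, ha'⟩ : ∃ a ∈ K.1, a ∉ K'.1 := by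
    by_contra! hcon
    exact h (Subtype.ext (Finset.eq_of_subset_of_card_le hcon (by rw [K.2.2, K'.2.2])))
  refine measure_mono_null ?_ (Measure.addHaar_affineSubspace volume
    (affineSpan ℝ ((K.oppFace a ha).1 : Set (EuclideanSpace ℝ (Fin (m + 1))))) fun htop => ?_)
  · refine (T.complex.inter_subset_convexHull K.2.1 K'.2.1).trans ?_
    refine (convexHull_subset_affineSpan _).trans (affineSpan_mono ℝ fun b hb => ?_)
    exact (K.mem_oppFace ha).2 ⟨fun hba => ha' (hba ▸ hb.2), hb.1⟩
  · exact K.notMem_affineSpan_oppFace ha (htop ▸ AffineSubspace.mem_top ℝ _ a)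

lemma brokenFun_ae_eq (w : T.W k) (K : T.Elem) :
    brokenFun w =ᵐ[volume.restrict K.set] ev (w K).1 := by
  have h : ∀ᵐ x ∂(volume.restrict K.set), ∀ K' : T.Elem, K' ≠ K → x ∉ K'.set := by
    rw [ae_all_iff]
    intro K'
    by_cases hK : K' = K
    · exact Filter.Eventually.of_forall fun x h => absurd hK h
    have h0 : (volume.restrict K.set) K'.set = 0 := by
      rw [Measure.restrict_apply (isCompact_elem K').measurableSet]
      exact Mesh.Elem.volume_inter_eq_zero hK
    filter_upwards [measure_eq_zero_iff_ae_notMem.1 h0] with x hx _ using hx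
  filter_upwards [h, ae_restrict_mem (isCompact_elem K).measurableSet] with x hx hxK
  rw [brokenFun, Finset.sum_eq_single K]
  · exact Set.indicator_of_mem hxK _
  · exact fun K' _ hK' => Set.indicator_of_notMem (hx K' hK') _
  · exact fun h => absurd (Finset.mem_univ K) h

lemma toL2_ae_eq (w : T.W k) (K : T.Elem) :
    (toL2 w : EuclideanSpace ℝ (Fin (m + 1)) → ℝ) =ᵐ[volume.restrict K.set] ev (w K).1 := by
  filter_upwards [ae_mono (elem_ae_le K) (memLp_brokenFun w).coeFn_toLp, brokenFun_ae_eq w K]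
    with x h1 h2
  exact h1.trans h2

/-- The simplices cover `closure Ω`, and by purity each lies in an element. Conversely an element
lies in `Ω` up to its frontier, which is null by convexity. -/
lemma ae_eq_iUnion_elem (T : Mesh Ω) : Ω =ᵐ[volume] ⋃ K : T.Elem, K.set := by
  refine Filter.EventuallyLE.antisymm (Filter.Eventually.of_forall fun x hx => ?_) ?_
  · have h : x ∈ T.complex.space := by
      rw [T.space_eq]
      exact subset_closure hx
    obtain ⟨s, hs, hxs⟩ := Set.mem_iUnion₂.1 h
    obtain ⟨t, ht, hst, hcard⟩ := T.pure s hs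
    exact Set.mem_iUnion.2 ⟨⟨t, ht, hcard⟩, convexHull_mono (Finset.coe_subset.2 hst) hxs⟩
  · have h : ∀ K : T.Elem, ∀ᵐ x ∂volume, x ∈ K.set → x ∈ Ω := fun K =>
      (ae_restrict_iff' (isCompact_elem K).measurableSet).1 (elem_ae_mem K)
    filter_upwards [ae_all_iff.2 h] with x hx hxU
    obtain ⟨K, hK⟩ := Set.mem_iUnion.1 hxU
    exact hx K hK

lemma integrableOn_sq (K : T.Elem) (f : Lp ℝ 2 (volume.restrict Ω)) :
    IntegrableOn (fun x => f x ^ 2) K.set :=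
  ((Lp.memLp f).mono_measure (elem_ae_le K)).integrable_sq

lemma norm_sq_eq_sum_normElem (T : Mesh Ω) (f : Lp ℝ 2 (volume.restrict Ω)) :
    ‖f‖ ^ 2 = ∑ K : T.Elem, normElem K f ^ 2 := by
  have h1 : ‖f‖ ^ 2 = ∫ x in Ω, f x ^ 2 := by
    rw [← real_inner_self_eq_norm_sq, L2.inner_def]
    simp [pow_two]
  rw [h1, setIntegral_congr_set (ae_eq_iUnion_elem T), integral_iUnion_ae
    (fun K => (isCompact_elem K).measurableSet.nullMeasurableSet)
    (fun K K' h => Mesh.Elem.volume_inter_eq_zero h), tsum_fintype]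
  · refine Finset.sum_congr rfl fun K _ => ?_
    rw [normElem, Real.sq_sqrt (integral_nonneg fun _ => sq_nonneg _)]
  · exact integrableOn_finite_iUnion.2 fun K => integrableOn_sq K f

lemma normElem_nonneg (K : T.Elem) (f : Lp ℝ 2 (volume.restrict Ω)) : 0 ≤ normElem K f :=
  Real.sqrt_nonneg _

lemma normElem_toL2 (w : T.W k) (K : T.Elem) :
    normElem K (toL2 w) = Real.sqrt (∫ x in K.set, ev (w K).1 x ^ 2) := by
  rw [normElem]
  congr 1
  refine integral_congr_ae ?_
  filter_upwards [toL2_ae_eq w K] with x hx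
  rw [hx]

/-- The Cauchy–Schwarz inequality in `L²(K)`. -/
lemma integral_mul_ev_le (K : T.Elem) (f : Lp ℝ 2 (volume.restrict Ω))
    (u : MvPolynomial (Fin (m + 1)) ℝ) :
    ∫ x in K.set, f x * ev u x ≤ normElem K f * Real.sqrt (∫ x in K.set, ev u x ^ 2) := by
  rw [normElem, ← Real.sqrt_mul (integral_nonneg fun _ => sq_nonneg _)]
  refine Real.le_sqrt_of_sq_le (sq_le_mul_of_quadratic_nonneg fun s => ?_)
  have hu : IntegrableOn (fun x => ev u x ^ 2) K.set :=
    integrableOn_elem K ((continuous_ev u).pow 2)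
  have hfu := integrableOn_L2 K f (continuous_ev u)
  have h : 0 ≤ ∫ x in K.set, (f x + s * ev u x) ^ 2 := integral_nonneg fun _ => sq_nonneg _
  have h2 : ∀ x, (f x + s * ev u x) ^ 2 =
      (f x ^ 2 + 2 * s * (f x * ev u x)) + s ^ 2 * ev u x ^ 2 := fun x => by ring
  simp only [h2] at h
  have hsum : IntegrableOn (fun x => f x ^ 2 + 2 * s * (f x * ev u x)) K.set :=
    (integrableOn_sq K f).add (hfu.const_mul _)
  rwa [integral_add hsum (hu.const_mul _),
    integral_add (integrableOn_sq K f) (hfu.const_mul _), integral_const_mul,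
    integral_const_mul] at h

/-- The local bound for `U_w`, with a constant that depends only on `m`, `k` and `Γ`. -/
lemma exists_sourceU_bound (m k : ℕ) (Γ : ℝ) : ∃ C₀ : ℝ, 0 < C₀ ∧
    ∀ (Ω : Set (EuclideanSpace ℝ (Fin (m + 1)))) (T : Mesh Ω) (α : Coeff Ω Γ) (τ : Penalty T)
      (K : T.Elem) (f : Lp ℝ 2 (volume.restrict Ω)),
      normElem K (Uw k T α τ f) ≤ C₀ * τ.d K ^ 2 * K.size ^ 2 * normElem K f := by
  obtain ⟨C₀, hC₀, hbound⟩ := exists_energy_bound m k Γ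
  refine ⟨C₀, hC₀, fun Ω T α τ K f => ?_⟩
  set s := localSolve k T α τ K (sourceLoad k T K f) with hs
  have hsol : ∀ t, localForm k T α τ K s t = ∫ x in K.set, f x * ev t.2.1 x := fun t => by
    rw [hs, localForm_localSolve]
    rfl
  -- A source load does not see the vector test function, so the energy bound applies, and the
  -- energy equals `(f, u)_K`.
  have h1 := hbound Ω T α τ K s fun r => by
    rw [hsol]
    simp [ev_zero]
  rw [hsol] at h1
  have h2 : normElem K (Uw k T α τ f) = Real.sqrt (∫ x in K.set, ev s.2.1 x ^ 2) :=
    normElem_toL2 (sourceU k T α τ f) K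
  have h3 := integral_mul_ev_le K f s.2.1
  rw [h2]
  set N := Real.sqrt (∫ x in K.set, ev s.2.1 x ^ 2) with hN
  have hN2 : ∫ x in K.set, ev s.2.1 x ^ 2 = N * N :=
    (Real.mul_self_sqrt (integral_nonneg fun _ => sq_nonneg _)).symm
  have hN0 : 0 ≤ N := Real.sqrt_nonneg _
  have hc : 0 ≤ C₀ * τ.d K ^ 2 * K.size ^ 2 := by positivity
  rcases hN0.eq_or_lt with h | h
  · rw [← h]
    exact mul_nonneg hc (normElem_nonneg K f)
  · refine le_of_mul_le_mul_right ?_ h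
    rw [← hN2, mul_assoc]
    exact h1.trans (mul_le_mul_of_nonneg_left h3 hc)

lemma Mesh.Elem.size_le (K : T.Elem) : K.size ≤ T.size :=
  le_ciSup (f := fun K : T.Elem => K.size) (Set.finite_range _).bddAbove K

/-- `I - lam U_w` is invertible if `lam` is small. -/
lemma isUnit_one_sub_smul_Uw (α : Coeff Ω Γ) (τ : Penalty T) {C₀ Cstar C₃ lam : ℝ}
    (hC₀ : 0 < C₀)
    (hbound : ∀ (K : T.Elem) (f : Lp ℝ 2 (volume.restrict Ω)),
      normElem K (Uw k T α τ f) ≤ C₀ * τ.d K ^ 2 * K.size ^ 2 * normElem K f)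
    (hCstar : 0 < Cstar) (hd : ∀ K : T.Elem, τ.d K ^ 2 * K.size ≤ Cstar)
    (hC₃ : 0 < C₃) (hC₃' : C₃ < (C₀ * Cstar)⁻¹) (hlam : 0 < lam) (hlam' : lam < C₃ / T.size) :
    IsUnit (1 - lam • Uw k T α τ) := by
  -- If the mesh size were not positive, `C₃ / T.size` would be at most zero (division by zero gives
  -- zero), against `0 < lam`.
  have hsize : 0 < T.size := by
    by_contra h
    exact absurd (hlam.trans hlam') (not_lt.2 (div_nonpos_of_nonneg_of_nonpos hC₃.le (not_lt.1 h)))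
  -- One factor `h_K` of the local bound is absorbed with `d_K²` into `Cstar`, the other is at most
  -- `h`; the elementwise bounds then add up in squares.
  have hop : ‖Uw k T α τ‖ ≤ C₀ * Cstar * T.size := by
    refine ContinuousLinearMap.opNorm_le_bound _ (by positivity) fun f => ?_
    refine le_of_sq_le_sq ?_ (by positivity)
    rw [mul_pow, norm_sq_eq_sum_normElem T, norm_sq_eq_sum_normElem T, Finset.mul_sum]
    refine Finset.sum_le_sum fun K _ => ?_
    rw [← mul_pow]
    refine pow_le_pow_left₀ (normElem_nonneg K _) ((hbound K f).trans ?_) 2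
    refine mul_le_mul_of_nonneg_right ?_ (normElem_nonneg K f)
    have h1 : τ.d K ^ 2 * K.size * K.size ≤ Cstar * T.size :=
      mul_le_mul (hd K) K.size_le K.size_pos.le hCstar.le
    nlinarith
  refine isUnit_one_sub_of_norm_lt_one ?_
  rw [norm_smul, Real.norm_of_nonneg hlam.le]
  calc lam * ‖Uw k T α τ‖ ≤ lam * (C₀ * Cstar * T.size) := by gcongr
    _ < C₃ / T.size * (C₀ * Cstar * T.size) := by gcongr
    _ = C₃ * (C₀ * Cstar) := by field_simp
    _ < (C₀ * Cstar)⁻¹ * (C₀ * Cstar) := by gcongr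
    _ = 1 := inv_mul_cancel₀ (by positivity)

end L2

/-! ### The condensed eigenproblem -/

section Condensation

variable {m : ℕ} {Ω : Set (EuclideanSpace ℝ (Fin (m + 1)))} {T : Mesh Ω} {Γ : ℝ} {k : ℕ}

/-- `⟨τ u, w⟩_{∂K}`. -/
def stabForm (τ : Penalty T) (K : T.Elem) (u w : Pk (m + 1) k) : ℝ :=
  ∑ F ∈ K.faces, ∫ x in F.set, τ.toFun K F * (ev u.1 x * ev w.1 x) ∂μHE[m]

/-- `⟨τ μ, w⟩_{∂K}`. -/
def traceStab (τ : Penalty T) (K : T.Elem) (μ : T.M k) (w : Pk (m + 1) k) : ℝ :=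
  ∑ F ∈ K.faces, ∫ x in F.set, τ.toFun K F * (μ.1 F x * ev w.1 x) ∂μHE[m]

/-- `⟨τ η, μ⟩_{∂K}`. -/
def traceMass (τ : Penalty T) (K : T.Elem) (η μ : T.M k) : ℝ :=
  ∑ F ∈ K.faces, ∫ x in F.set, τ.toFun K F * (η.1 F x * μ.1 F x) ∂μHE[m]

/-- `⟨μ, r·n⟩_{∂K}`. -/
def traceNormal (K : T.Elem) (μ : T.M k) (r : Fin (m + 1) → Pk (m + 1) k) : ℝ :=
  ∑ F ∈ K.faces, ∫ x in F.set, μ.1 F x * (evv r x ⬝ᵥ K.normal F) ∂μHE[m]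

lemma traceMass_comm (τ : Penalty T) (K : T.Elem) (η μ : T.M k) :
    traceMass τ K η μ = traceMass τ K μ η := by
  simp only [traceMass, mul_comm (η.1 _ _)]

lemma stabForm_comm (τ : Penalty T) (K : T.Elem) (u w : Pk (m + 1) k) :
    stabForm τ K u w = stabForm τ K w u := by
  simp only [stabForm, mul_comm (ev u.1 _)]

lemma traceLoad_apply (τ : Penalty T) (K : T.Elem) (μ : T.M k) (t : LocalSpace (m + 1) k) :
    traceLoad k T τ K μ t = -traceNormal K μ t.1 + traceStab τ K μ t.2 := rfl

lemma sourceLoad_apply (K : T.Elem) (f : Lp ℝ 2 (volume.restrict Ω))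
    (t : LocalSpace (m + 1) k) :
    sourceLoad k T K f t = ∫ x in K.set, f x * ev t.2.1 x := rfl

lemma traceLoad_scalar (τ : Penalty T) (K : T.Elem) (μ : T.M k) (w : Pk (m + 1) k) :
    traceLoad k T τ K μ (0, w) = traceStab τ K μ w := by
  simp [traceLoad_apply, traceNormal, evv, ev_zero, dotProduct]

lemma localForm_test_vector (α : Coeff Ω Γ) (τ : Penalty T) (K : T.Elem)
    (s : LocalSpace (m + 1) k) (r : Fin (m + 1) → Pk (m + 1) k) :
    localForm k T α τ K s (r, 0) =
      (∫ x in K.set, (α.c x).mulVec (evv s.1 x) ⬝ᵥ evv r x)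
      - ∫ x in K.set, ev s.2.1 x * dv r x := by
  simp [localForm_apply, ev_zero]

lemma localForm_test_scalar (α : Coeff Ω Γ) (τ : Penalty T) (K : T.Elem)
    (s : LocalSpace (m + 1) k) (w : Pk (m + 1) k) :
    localForm k T α τ K s (0, w) =
      (∫ x in K.set, ev w.1 x * dv s.1 x) + stabForm τ K s.2 w := by
  simp [localForm_apply, evv, dv, ev_zero, stabForm, dotProduct]

lemma integrableOn_trace_mul (η μ : T.M k) (F : T.Face) :
    IntegrableOn (fun x => η.1 F x * μ.1 F x) F.set μHE[m] := by
  obtain ⟨⟨p, -, hp⟩, -⟩ := μ.2 F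
  refine IntegrableOn.congr_fun (integrableOn_trace η F (continuous_ev p)) (fun x hx => ?_)
    (isCompact_face F).measurableSet
  simp only [hp x hx]

lemma flux_dotProduct_normal (τ : Penalty T) (q : T.V k) (u : T.W k) (η : T.M k) (K : T.Elem)
    {F : T.Face} (hF : F ∈ K.faces) (x : EuclideanSpace ℝ (Fin (m + 1))) :
    flux τ q u η K F x ⬝ᵥ K.normal F =
      evv (q K) x ⬝ᵥ K.normal F + τ.toFun K F * (ev (u K).1 x - η.1 F x) := by
  have h : (K.normal F).ofLp ⬝ᵥ (K.normal F).ofLp = 1 := by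
    have h1 := real_inner_self_eq_norm_sq (K.normal F)
    rw [K.norm_normal hF, EuclideanSpace.inner_eq_star_dotProduct] at h1
    simpa using h1
  rw [flux, add_dotProduct, smul_dotProduct, h, smul_eq_mul, mul_one]

lemma sum_integral_trace_flux (τ : Penalty T) (q : T.V k) (u : T.W k) (η μ : T.M k)
    (K : T.Elem) :
    ∑ F ∈ K.faces, ∫ x in F.set, μ.1 F x * (flux τ q u η K F x ⬝ᵥ K.normal F) ∂μHE[m] =
      traceNormal K μ (q K) + traceStab τ K μ (u K) - traceMass τ K μ η := by
  rw [traceNormal, traceStab, traceMass, ← Finset.sum_add_distrib, ← Finset.sum_sub_distrib]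
  refine Finset.sum_congr rfl fun F hF => ?_
  have h1 : IntegrableOn (fun x => μ.1 F x * (evv (q K) x ⬝ᵥ K.normal F)) F.set μHE[m] :=
    intMN F μ (q K) _
  have h2 : IntegrableOn (fun x => τ.toFun K F * (μ.1 F x * ev (u K).1 x)) F.set μHE[m] :=
    intMW F _ μ _
  have h3 : IntegrableOn (fun x => τ.toFun K F * (μ.1 F x * η.1 F x)) F.set μHE[m] :=
    (integrableOn_trace_mul μ η F).const_mul _
  have h12 : IntegrableOn (fun x => μ.1 F x * (evv (q K) x ⬝ᵥ K.normal F) +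
    τ.toFun K F * (μ.1 F x * ev (u K).1 x)) F.set μHE[m] := h1.add h2
  rw [← integral_add h1 h2, ← integral_sub h12 h3]
  congr 1
  funext x
  rw [flux_dotProduct_normal τ q u η K hF]
  ring

/-- Integration by parts puts the second HDG equation in the form `(w, div q)_K + ⟨τ (u - η),
w⟩_{∂K}` used by the local problems. -/
lemma sum_integral_flux_mul (τ : Penalty T) (q : T.V k) (u : T.W k) (η : T.M k)
    (K : T.Elem) (w : Pk (m + 1) k) :
    -(∫ x in K.set, evv (q K) x ⬝ᵥ gd w x) +
      ∑ F ∈ K.faces, ∫ x in F.set, (flux τ q u η K F x ⬝ᵥ K.normal F) * ev w.1 x ∂μHE[m] =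
      (∫ x in K.set, ev w.1 x * dv (q K) x) + stabForm τ K (u K) w - traceStab τ K η w := by
  have h0 : ∑ F ∈ K.faces, ∫ x in F.set,
      (flux τ q u η K F x ⬝ᵥ K.normal F) * ev w.1 x ∂μHE[m] =
      (∑ F ∈ K.faces, ∫ x in F.set, (evv (q K) x ⬝ᵥ K.normal F) * ev w.1 x ∂μHE[m]) +
        stabForm τ K (u K) w - traceStab τ K η w := by
    rw [stabForm, traceStab, ← Finset.sum_add_distrib, ← Finset.sum_sub_distrib]
    refine Finset.sum_congr rfl fun F hF => ?_
    have hN : Continuous fun x => evv (q K) x ⬝ᵥ K.normal F := continuous_finsetSum _ fun i _ =>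
      ((continuous_apply i).comp (continuous_evv (q K))).mul continuous_const
    have h1 : IntegrableOn (fun x => (evv (q K) x ⬝ᵥ K.normal F) * ev w.1 x) F.set μHE[m] :=
      integrableOn_face F (hN.mul (continuous_ev _))
    have h2 : IntegrableOn (fun x => τ.toFun K F * (ev (u K).1 x * ev w.1 x)) F.set μHE[m] :=
      intFF F _ _ _
    have h3 : IntegrableOn (fun x => τ.toFun K F * (η.1 F x * ev w.1 x)) F.set μHE[m] :=
      intMW F _ η _
    have h12 : IntegrableOn (fun x => (evv (q K) x ⬝ᵥ K.normal F) * ev w.1 x +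
      τ.toFun K F * (ev (u K).1 x * ev w.1 x)) F.set μHE[m] := h1.add h2
    rw [← integral_add h1 h2, ← integral_sub h12 h3]
    congr 1
    funext x
    rw [flux_dotProduct_normal τ q u η K hF]
    ring
  rw [h0, ← K.integral_by_parts (q K) w]
  ring

lemma ah_eq_sum (α : Coeff Ω Γ) (τ : Penalty T) (η μ : T.M k) :
    ah k T α τ η μ = ∑ K : T.Elem,
      ((∫ x in K.set, (α.c x).mulVec (evv (liftQ k T α τ η K) x) ⬝ᵥ evv (liftQ k T α τ μ K) x)
        + (stabForm τ K (liftU k T α τ η K) (liftU k T α τ μ K)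
          - traceStab τ K μ (liftU k T α τ η K) - traceStab τ K η (liftU k T α τ μ K)
          + traceMass τ K η μ)) := by
  rw [ah]
  refine Finset.sum_congr rfl fun K _ => ?_
  congr 1
  rw [stabForm, traceStab, traceStab, traceMass, ← Finset.sum_sub_distrib,
    ← Finset.sum_sub_distrib, ← Finset.sum_add_distrib]
  refine Finset.sum_congr rfl fun F _ => ?_
  set u := liftU k T α τ η K
  set w := liftU k T α τ μ K
  have h1 : IntegrableOn (fun x => τ.toFun K F * (ev u.1 x * ev w.1 x)) F.set μHE[m] :=
    intFF F _ _ _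
  have h2 : IntegrableOn (fun x => τ.toFun K F * (μ.1 F x * ev u.1 x)) F.set μHE[m] :=
    intMW F _ μ _
  have h3 : IntegrableOn (fun x => τ.toFun K F * (η.1 F x * ev w.1 x)) F.set μHE[m] :=
    intMW F _ η _
  have h4 : IntegrableOn (fun x => τ.toFun K F * (η.1 F x * μ.1 F x)) F.set μHE[m] :=
    (integrableOn_trace_mul η μ F).const_mul _
  have h12 : IntegrableOn (fun x => τ.toFun K F * (ev u.1 x * ev w.1 x) -
    τ.toFun K F * (μ.1 F x * ev u.1 x)) F.set μHE[m] := h1.sub h2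
  have h123 : IntegrableOn (fun x => τ.toFun K F * (ev u.1 x * ev w.1 x) -
    τ.toFun K F * (μ.1 F x * ev u.1 x) - τ.toFun K F * (η.1 F x * ev w.1 x)) F.set μHE[m] :=
    h12.sub h3
  rw [← integral_sub h1 h2, ← integral_sub h12 h3, ← integral_add h123 h4]
  congr 1
  funext x
  ring

lemma integral_toL2_mul (u : T.W k) (K : T.Elem) (w : Pk (m + 1) k) :
    ∫ x in K.set, toL2 u x * ev w.1 x = ∫ x in K.set, ev (u K).1 x * ev w.1 x := by
  refine integral_congr_ae ?_
  filter_upwards [toL2_ae_eq u K] with x hx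
  rw [hx]

lemma lift_solves (α : Coeff Ω Γ) (τ : Penalty T) (μ : T.M k) (K : T.Elem) :
    localForm k T α τ K (liftQ k T α τ μ K, liftU k T α τ μ K) = traceLoad k T τ K μ :=
  localForm_localSolve α τ K _

lemma source_solves (α : Coeff Ω Γ) (τ : Penalty T) (f : Lp ℝ 2 (volume.restrict Ω))
    (K : T.Elem) :
    localForm k T α τ K (sourceQ k T α τ f K, sourceU k T α τ f K) = sourceLoad k T K f :=
  localForm_localSolve α τ K _

/-- The local equations of the HDG eigenproblem express `q` and `u` by `η` and `u`. -/
lemma local_solution_iff (α : Coeff Ω Γ) (τ : Penalty T) (lam : ℝ) (q : T.V k) (u : T.W k)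
    (η : T.M k) :
    (∀ K, localForm k T α τ K (q K, u K) =
        traceLoad k T τ K η + lam • sourceLoad k T K (toL2 u)) ↔
      q = liftQ k T α τ η + lam • sourceQ k T α τ (toL2 u) ∧
        u = liftU k T α τ η + lam • sourceU k T α τ (toL2 u) := by
  have h : ∀ K, localForm k T α τ K ((liftQ k T α τ η + lam • sourceQ k T α τ (toL2 u)) K,
      (liftU k T α τ η + lam • sourceU k T α τ (toL2 u)) K) =
        traceLoad k T τ K η + lam • sourceLoad k T K (toL2 u) := by
    intro K
    have hz : ((liftQ k T α τ η + lam • sourceQ k T α τ (toL2 u)) K,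
        (liftU k T α τ η + lam • sourceU k T α τ (toL2 u)) K) =
        (liftQ k T α τ η K, liftU k T α τ η K) +
          lam • (sourceQ k T α τ (toL2 u) K, sourceU k T α τ (toL2 u) K) := by
      simp only [Pi.add_apply, Pi.smul_apply, Prod.mk_add_mk, Prod.smul_mk]
    rw [hz, map_add, map_smul, lift_solves, source_solves]
  constructor
  · intro hloc
    have hK : ∀ K, (q K, u K) = ((liftQ k T α τ η + lam • sourceQ k T α τ (toL2 u)) K,
        (liftU k T α τ η + lam • sourceU k T α τ (toL2 u)) K) := fun K =>
      (localForm_bijective α τ K).1 ((hloc K).trans (h K).symm)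
    exact ⟨funext fun K => congrArg Prod.fst (hK K), funext fun K => congrArg Prod.snd (hK K)⟩
  · rintro ⟨hq, hu⟩ K
    rw [← h K, ← hq, ← hu]

/-- The first two equations of the HDG eigenproblem are the local equations. -/
lemma local_equations_iff (α : Coeff Ω Γ) (τ : Penalty T) (lam : ℝ) (q : T.V k) (u : T.W k)
    (η : T.M k) :
    ((∀ r : T.V k,
      (∑ K, ∫ x in K.set, (α.c x).mulVec (evv (q K) x) ⬝ᵥ evv (r K) x)
        - (∑ K, ∫ x in K.set, ev (u K).1 x * dv (r K) x)
        + (∑ K : T.Elem, ∑ F ∈ K.faces, ∫ x in F.set,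
            η.1 F x * (evv (r K) x ⬝ᵥ K.normal F) ∂μHE[m]) = 0) ∧
    (∀ w : T.W k,
      -(∑ K, ∫ x in K.set, evv (q K) x ⬝ᵥ gd (w K) x)
        + (∑ K : T.Elem, ∑ F ∈ K.faces, ∫ x in F.set,
            (flux τ q u η K F x ⬝ᵥ K.normal F) * ev (w K).1 x ∂μHE[m])
        = lam * ∑ K, ∫ x in K.set, ev (u K).1 x * ev (w K).1 x)) ↔
    ∀ K, localForm k T α τ K (q K, u K) =
        traceLoad k T τ K η + lam • sourceLoad k T K (toL2 u) := by
  classical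
  -- The residual of the local problem on `K`. The two global equations say that the residuals,
  -- tested with `(r, 0)` and with `(0, w)`, sum to zero; test functions supported on one element
  -- isolate each summand.
  let R : (K : T.Elem) → LocalSpace (m + 1) k →ₗ[ℝ] ℝ := fun K =>
    localForm k T α τ K (q K, u K) - (traceLoad k T τ K η + lam • sourceLoad k T K (toL2 u))
  have hR1 : ∀ r : T.V k, (∑ K, ∫ x in K.set, (α.c x).mulVec (evv (q K) x) ⬝ᵥ evv (r K) x)
        - (∑ K, ∫ x in K.set, ev (u K).1 x * dv (r K) x)
        + (∑ K : T.Elem, ∑ F ∈ K.faces, ∫ x in F.set,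
            η.1 F x * (evv (r K) x ⬝ᵥ K.normal F) ∂μHE[m]) = ∑ K, R K (r K, 0) := by
    intro r
    rw [← Finset.sum_sub_distrib, ← Finset.sum_add_distrib]
    refine Finset.sum_congr rfl fun K _ => ?_
    simp only [R, LinearMap.sub_apply, LinearMap.add_apply, LinearMap.smul_apply,
      localForm_test_vector, traceLoad_apply, sourceLoad_apply, traceStab, traceNormal,
      Submodule.coe_zero, ev_zero, mul_zero, integral_zero, Finset.sum_const_zero, smul_zero]
    ring
  have hR2 : ∀ w : T.W k, -(∑ K, ∫ x in K.set, evv (q K) x ⬝ᵥ gd (w K) x)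
        + (∑ K : T.Elem, ∑ F ∈ K.faces, ∫ x in F.set,
            (flux τ q u η K F x ⬝ᵥ K.normal F) * ev (w K).1 x ∂μHE[m])
        - lam * ∑ K, ∫ x in K.set, ev (u K).1 x * ev (w K).1 x = ∑ K, R K (0, w K) := by
    intro w
    rw [← Finset.sum_neg_distrib, ← Finset.sum_add_distrib, Finset.mul_sum,
      ← Finset.sum_sub_distrib]
    refine Finset.sum_congr rfl fun K _ => ?_
    rw [sum_integral_flux_mul, ← integral_toL2_mul]
    simp only [R, LinearMap.sub_apply, LinearMap.add_apply, LinearMap.smul_apply,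
      localForm_test_scalar, traceLoad_scalar, sourceLoad_apply, smul_eq_mul]
    ring
  have hsingle : ∀ (K : T.Elem) (t : LocalSpace (m + 1) k),
      ∑ K', R K' ((Pi.single K t.1 : T.V k) K', 0) = R K (t.1, 0) ∧
      ∑ K', R K' (0, (Pi.single K t.2 : T.W k) K') = R K (0, t.2) := by
    intro K t
    constructor
    · rw [Finset.sum_eq_single K _ fun h => absurd (Finset.mem_univ K) h, Pi.single_eq_same]
      intro K' _ hK'
      rw [Pi.single_eq_of_ne hK']
      exact map_zero _
    · rw [Finset.sum_eq_single K _ fun h => absurd (Finset.mem_univ K) h, Pi.single_eq_same]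
      intro K' _ hK'
      rw [Pi.single_eq_of_ne hK']
      exact map_zero _
  have hiff : (∀ K, localForm k T α τ K (q K, u K) =
      traceLoad k T τ K η + lam • sourceLoad k T K (toL2 u)) ↔ ∀ K, R K = 0 :=
    forall_congr' fun K => sub_eq_zero.symm
  rw [hiff]
  constructor
  · rintro ⟨ha, hb⟩ K
    refine LinearMap.ext fun t => ?_
    have h1 := ha (Pi.single K t.1)
    have h2 := sub_eq_zero.2 (hb (Pi.single K t.2))
    rw [hR1, (hsingle K t).1] at h1
    rw [hR2, (hsingle K t).2] at h2
    have ht : t = (t.1, 0) + (0, t.2) := by simp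
    rw [ht, map_add, h1, h2, add_zero]
    rfl
  · intro h
    refine ⟨fun r => ?_, fun w => sub_eq_zero.1 ?_⟩
    · rw [hR1]
      exact Finset.sum_eq_zero fun K _ => by rw [h K]; rfl
    · rw [hR2]
      exact Finset.sum_eq_zero fun K _ => by rw [h K]; rfl

/-- The contribution of one element to the conservation equation, in terms of the solutions
`s` and `e` of the local problems with traces `μ` and `η`, and `y` with source `f`. -/
lemma trace_flux_elem_eq (α : Coeff Ω Γ) (τ : Penalty T) (K : T.Elem) (lam : ℝ)
    (f : Lp ℝ 2 (volume.restrict Ω)) (η μ : T.M k) {s e y : LocalSpace (m + 1) k}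
    (hs : localForm k T α τ K s = traceLoad k T τ K μ)
    (he : localForm k T α τ K e = traceLoad k T τ K η)
    (hy : localForm k T α τ K y = sourceLoad k T K f) :
    traceNormal K μ (e + lam • y).1 + traceStab τ K μ (e + lam • y).2 - traceMass τ K μ η =
      lam * (∫ x in K.set, f x * ev s.2.1 x) -
        ((∫ x in K.set, (α.c x).mulVec (evv e.1 x) ⬝ᵥ evv s.1 x) +
          (stabForm τ K e.2 s.2 - traceStab τ K μ e.2 - traceStab τ K η s.2 +
            traceMass τ K η μ)) := by
  have hN : ∀ r, traceNormal K μ r = -traceLoad k T τ K μ (r, 0) := by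
    intro r
    have h : traceStab τ K μ 0 = 0 := by
      rw [← traceLoad_scalar]
      exact map_zero _
    rw [traceLoad_apply, h]
    ring
  have hadd : ∀ g : LocalSpace (m + 1) k →ₗ[ℝ] ℝ,
      g ((e + lam • y).1, 0) = g (e.1, 0) + lam * g (y.1, 0) := by
    intro g
    have h : (((e + lam • y).1, 0) : LocalSpace (m + 1) k) = (e.1, 0) + lam • (y.1, 0) := by
      simp
    rw [h, map_add, map_smul, smul_eq_mul]
  have hadd' : ∀ g : LocalSpace (m + 1) k →ₗ[ℝ] ℝ,
      g (0, (e + lam • y).2) = g (0, e.2) + lam * g (0, y.2) := by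
    intro g
    have h : ((0, (e + lam • y).2) : LocalSpace (m + 1) k) = (0, e.2) + lam • (0, y.2) := by
      simp
    rw [h, map_add, map_smul, smul_eq_mul]
  have hsource : ∀ r, sourceLoad k T K f (r, 0) = 0 := fun r => by
    simp [sourceLoad_apply, ev_zero]
  -- Reciprocity: the problem for `s` is tested with the vector parts of `e` and `y` and the scalar
  -- part of `y`, and theirs with parts of `s`. By symmetry of `c` and of the stabilization, the
  -- divergence terms cancel.
  have h1 := localForm_test_vector α τ K s e.1
  have h2 := localForm_test_vector α τ K s y.1
  have h3 := localForm_test_scalar α τ K e s.2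
  have h4 := localForm_test_scalar α τ K y s.2
  have h5 := localForm_test_vector α τ K y s.1
  have h6 := localForm_test_scalar α τ K s y.2
  rw [hs] at h1 h2 h6
  rw [he, traceLoad_scalar] at h3
  rw [hy, sourceLoad_apply] at h4
  rw [hy, hsource] at h5
  rw [traceLoad_scalar] at h6
  rw [hN, hadd, ← traceLoad_scalar, hadd', traceLoad_scalar, traceLoad_scalar, h1, h2,
    integral_c_comm α K e.1 s.1, integral_c_comm α K s.1 y.1, traceMass_comm τ K μ η, h6,
    stabForm_comm τ K s.2 y.2]
  linear_combination -h3 - lam * h4 + lam * h5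

/-- For local solutions, the conservation equation is the condensed equation. -/
lemma sum_trace_flux_eq (α : Coeff Ω Γ) (τ : Penalty T) (lam : ℝ) (u : T.W k) (η μ : T.M k)
    (hu : u = liftU k T α τ η + lam • sourceU k T α τ (toL2 u)) :
    (∑ K : T.Elem, ∑ F ∈ K.faces, ∫ x in F.set, μ.1 F x *
      (flux τ (liftQ k T α τ η + lam • sourceQ k T α τ (toL2 u)) u η K F x ⬝ᵥ K.normal F)
        ∂μHE[m]) =
      lam * innerW (toL2 u) (liftU k T α τ μ) - ah k T α τ η μ := by
  rw [ah_eq_sum, innerW, Finset.mul_sum, ← Finset.sum_sub_distrib]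
  refine Finset.sum_congr rfl fun K _ => ?_
  have huK : u K = liftU k T α τ η K + lam • sourceU k T α τ (toL2 u) K := by
    conv_lhs => rw [hu]
    simp only [Pi.add_apply, Pi.smul_apply]
  have h := trace_flux_elem_eq α τ K lam (toL2 u) η μ (lift_solves α τ μ K)
    (lift_solves α τ η K) (source_solves α τ (toL2 u) K)
  simp only [Prod.smul_mk, Prod.mk_add_mk] at h
  rw [sum_integral_trace_flux, huK]
  simp only [Pi.add_apply, Pi.smul_apply]
  exact h

/-- The solution operators turn the HDG eigenproblem into the condensed one. -/
lemma solvesCondensed_iff_solvesHDG (α : Coeff Ω Γ) (τ : Penalty T) {lam : ℝ}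
    {u : T.W k} {η : T.M k}
    (hu : u = liftU k T α τ η + lam • sourceU k T α τ (toL2 u))
    (hres : toL2 u = resolvedU α τ lam η) :
    SolvesCondensed α τ lam η ↔
      SolvesHDG α τ lam (liftQ k T α τ η + lam • sourceQ k T α τ (toL2 u)) u η := by
  have hloc := (local_equations_iff α τ lam _ u η).2
    ((local_solution_iff α τ lam (liftQ k T α τ η + lam • sourceQ k T α τ (toL2 u)) u η).2
      ⟨rfl, hu⟩)
  constructor
  · rintro ⟨hne, heq⟩
    refine ⟨fun h => hne (congrArg (fun z => z.2.2) h), hloc.1, hloc.2, fun μ => ?_⟩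
    have h := sum_trace_flux_eq α τ lam u η μ hu
    rw [hres, ← heq μ, sub_self, ← hres] at h
    exact h
  · rintro ⟨hne, -, -, hc⟩
    refine ⟨fun h0 => hne ?_, fun μ => ?_⟩
    -- With `η = 0` the resolved function is zero, so `u` and `q`, being given by the solution
    -- operators, vanish too: a nontrivial triple has a nontrivial trace.
    · subst h0
      have h1 : toL2 u = 0 := by
        rw [hres, resolvedU, map_zero, map_zero, map_zero]
      have h2 : u = 0 := by
        rw [hu, h1, map_zero, map_zero, smul_zero, add_zero]
      simp [h2]
    · have h := (sum_trace_flux_eq α τ lam u η μ hu).symm.trans (hc μ)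
      rw [← hres]
      linarith

/-- The resolved function `v` satisfies `v = Uη + λ U_w v`, and the right-hand side is a broken
polynomial; hence the inverse, taken in `L²(Ω)`, lands in `W_h`. -/
lemma exists_toL2_eq_resolvedU (α : Coeff Ω Γ) (τ : Penalty T) {lam : ℝ}
    (hunit : IsUnit (1 - lam • Uw k T α τ)) (η : T.M k) :
    ∃ u : T.W k, toL2 u = resolvedU α τ lam η ∧
      u = liftU k T α τ η + lam • sourceU k T α τ (toL2 u) := by
  set v := resolvedU α τ lam η with hv
  have h1 : (1 - lam • Uw k T α τ) v = toL2 (liftU k T α τ η) := by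
    rw [hv, resolvedU, ← mul_apply_eq_comp, Ring.mul_inverse_cancel _ hunit]
    rfl
  have h2 : v = toL2 (liftU k T α τ η + lam • sourceU k T α τ v) := by
    rw [map_add, map_smul, ← h1]
    change v = (v - lam • Uw k T α τ v) + lam • Uw k T α τ v
    rw [sub_add_cancel]
  exact ⟨_, h2.symm, by rw [← h2]⟩

/-- The reason no eigenvalue is lost: the `u` of an HDG solution satisfies `(I - λ U_w) u = Uη`, so
invertibility recovers it from `η`. -/
lemma toL2_eq_resolvedU (α : Coeff Ω Γ) (τ : Penalty T) {lam : ℝ}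
    (hunit : IsUnit (1 - lam • Uw k T α τ)) {u : T.W k} {η : T.M k}
    (hu : u = liftU k T α τ η + lam • sourceU k T α τ (toL2 u)) :
    toL2 u = resolvedU α τ lam η := by
  have h1 : (1 - lam • Uw k T α τ) (toL2 u) = toL2 (liftU k T α τ η) := by
    change toL2 u - lam • toL2 (sourceU k T α τ (toL2 u)) = _
    rw [← map_smul, ← map_sub]
    congr 1
    rw [sub_eq_iff_eq_add]
    exact hu
  rw [resolvedU, ← h1, ← mul_apply_eq_comp, Ring.inverse_mul_cancel _ hunit]
  rfl

end Condensation

end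

end HDG

/-! ### Equivalence of the HDG and the condensed eigenproblems -/

theorem theorem5p3 (n : ℕ) (hn : 2 ≤ n) (k : ℕ) (Γ : ℝ) :
    ∃ C₀ : ℝ, 0 < C₀ ∧
      ∀ (Ω : Set (EuclideanSpace ℝ (Fin n))), IsOpen Ω → IsConnected Ω →
      ∀ (T : HDG.Mesh Ω) (α : HDG.Coeff Ω Γ) (τ : HDG.Penalty T),
        -- the local problems defining `Q`, `U`, `Q_w`, `U_w` are uniquely solvable
        (∀ K : T.Elem, Function.Bijective (HDG.localForm k T α τ K)) ∧
        -- `C₀` is an admissible constant in the local bound for `U_w`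
        (∀ (K : T.Elem) (f : MeasureTheory.Lp ℝ 2 (MeasureTheory.volume.restrict Ω)),
          HDG.normElem K (HDG.Uw k T α τ f) ≤
            C₀ * τ.d K ^ 2 * K.size ^ 2 * HDG.normElem K f) ∧
        ∀ Cstar C₃ lam : ℝ,
          0 < Cstar → (∀ K : T.Elem, τ.d K ^ 2 * K.size ≤ Cstar ∧ τ.cc K ≤ Cstar) →
          0 < C₃ → C₃ < (C₀ * Cstar)⁻¹ →
          0 < lam → lam < C₃ / T.size →
            IsUnit (1 - lam • HDG.Uw k T α τ) ∧
            (∀ η : T.M k, ∃ u : T.W k,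
              HDG.toL2 u = HDG.resolvedU α τ lam η ∧
              (HDG.SolvesCondensed α τ lam η ↔
                HDG.SolvesHDG α τ lam
                  (HDG.liftQ k T α τ η + lam • HDG.sourceQ k T α τ (HDG.toL2 u)) u η)) ∧
            ((∃ η : T.M k, HDG.SolvesCondensed α τ lam η) ↔
              ∃ (q : T.V k) (u : T.W k) (η : T.M k), HDG.SolvesHDG α τ lam q u η) := by
  obtain ⟨m, rfl⟩ : ∃ m, n = m + 1 := ⟨n - 1, by omega⟩
  obtain ⟨C₀, hC₀, hbound⟩ := HDG.exists_sourceU_bound m k Γ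
  refine ⟨C₀, hC₀, fun Ω _ _ T α τ => ⟨HDG.localForm_bijective α τ, hbound Ω T α τ, ?_⟩⟩
  intro Cstar C₃ lam hCstar hmesh hC₃ hC₃' hlam hlam'
  have hunit := HDG.isUnit_one_sub_smul_Uw (k := k) α τ hC₀ (hbound Ω T α τ) hCstar
    (fun K => (hmesh K).1) hC₃ hC₃' hlam hlam'
  refine ⟨hunit, fun η => ?_, ?_, ?_⟩
  · obtain ⟨u, hres, hu⟩ := HDG.exists_toL2_eq_resolvedU α τ hunit η
    exact ⟨u, hres, HDG.solvesCondensed_iff_solvesHDG α τ hu hres⟩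
  · rintro ⟨η, hη⟩
    obtain ⟨u, hres, hu⟩ := HDG.exists_toL2_eq_resolvedU α τ hunit η
    exact ⟨_, u, η, (HDG.solvesCondensed_iff_solvesHDG α τ hu hres).1 hη⟩
  · rintro ⟨q, u, η, h⟩
    -- The first two equations force the given `q` and `u` to be the ones recovered from `η`, so the
    -- equivalence for recovered triples applies.
    obtain ⟨rfl, hu⟩ := (HDG.local_solution_iff α τ lam q u η).1
      ((HDG.local_equations_iff α τ lam q u η).1 ⟨h.eq_a, h.eq_b⟩)
    exact ⟨η, (HDG.solvesCondensed_iff_solvesHDG α τ hu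
      (HDG.toL2_eq_resolvedU α τ hunit hu)).2 h⟩
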